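/- Setting. Let $d\ge 1$, let $\Omega\subset\mathbb R^d$ be open with $\operatorname{int}\overline\Omega=\Omega$, and $J=(a,b]$, $a<b$. For the phases $\alpha\in\{o,w\}$ consider two-phase flow on $J\times\Omega$: $$\partial_t(\phi C_\alpha)+\nabla\cdot u_\alpha=q_\alpha,\qquad u_\alpha=-\lambda_\alpha K(\nabla p_\alpha-\rho_\alpha g),\qquad u_\alpha\cdot\nu=0\ \text{ on }\partial\Omega,$$ $$\rho_\alpha=\rho_{\alpha,ref}\,e^{c_{f,\alpha}(p_\alpha-p_{\alpha,ref})},\quad C_\alpha=\rho_\alpha s_\alpha,\quad \lambda_\alpha=\frac{k_{r\alpha}(s_\alpha)\rho_\alpha}{\mu_\alpha},\quad p_o-p_w=p_c(s_w),\quad s_o+s_w=1 ,$$ with $\mu_\alpha>0$, $\phi\in L^\infty(\Omega)$, $q_\alpha\in L^2(J\times\Omega)$ and a measurable, symmetric, bounded tensor $K$ satisfying $\xi\cdot K\xi\ge k_0|\xi|^2$ on $\Omega$, $k_0>0$. The exact solution satisfies the equations with weak derivatives, all terms $p_\alpha,\nabla p_\alpha,\phi C_\alpha,\partial_t(\phi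 C_\alpha),u_\alpha,\nabla\cdot u_\alpha$ being in $L^2(J\times\Omega)$, and the boundary condition in the sense of the normal trace. Mesh and spaces. Let $\mathcal T_h$ be a partition of $J\times\Omega$ into finitely many non-overlapping space-time boxes $E=(\tau_E^0,\tau_E^1]\times F_E$, possibly non-matching in time and space. $W_h$ is the space of functions constant on every $E$. For every rectangle $e$ in which the upper $k$-face of one element meets the lower $k$-face of another one (a time interval times a spatial face), $v_e$ is the lowest order Raviart–Thomas function, constant in time, supported on the two sub-boxes of the adjacent elements that lie over $e$, with normal component $1$ on $e$ and $0$ on the other faces of the sub-boxes; the enhanced velocity space $V_h^*$ is the span of the $v_e$. For $f$ piecewise constant in time, with a given value $f(a^-,\cdot)$ at the start of the slab, $f_\tau(t,\cdot)=\frac{t-\tau_E^0}{\tau_E^1-\tau_E^0}f(\tau_E^{1,-},\cdot)+\frac{\tau_E^1-t}{\tau_E^1-\tau_E^0}f(\tau_E^{0,-},\cdot)$ on $E$. Scheme. $p_{\alpha,h},s_{\alpha,h}\in W_h$ and $u_{\alpha,h},\tilde u_{\alpha,h},u_{up,\alpha,h}\in V_h^*$ satisfy, with $C_{\alpha,h}=\rho_\alpha(p_{\alpha,h})s_{\alpha,h}$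 and with $(\cdot,\cdot)$ the $L^2(J\times\Omega)$ product, $$(\partial_t(\phi C_{\alpha,h,\tau}),w)+(\nabla\cdot u_{up,\alpha,h},w)=(q_\alpha,w),\qquad (K^{-1}\tilde u_{\alpha,h},v)=(p_{\alpha,h},\nabla\cdot v),$$ $$(u_{\alpha,h},v)=(\lambda_\alpha\tilde u_{\alpha,h},v),\qquad (u_{up,\alpha,h},v)=(\lambda^*_\alpha\tilde u_{\alpha,h},v)\qquad\forall w\in W_h,\ v\in V_h^*,$$ together with $p_{o,h}-p_{w,h}=p_c(s_{w,h})$ and $s_{o,h}+s_{w,h}=1$. Here $\lambda^*_\alpha\tilde u_{\alpha,h}=\sum_e\lambda^*_{\alpha,e}\tilde U_e v_e$ if $\tilde u_{\alpha,h}=\sum_e\tilde U_ev_e$, where $\lambda^*_{\alpha,e}$ is $\frac1{\mu_\alpha}$ times the mean of the densities in the two adjacent elements times $k_{r\alpha}(s_{\alpha,h})$ in the upstream element (the lower element if $\tilde U_e>0$, otherwise the upper one). The starting values at $a^-$ of $C_{\alpha,h},u_{\alpha,h},u_{up,\alpha,h}$ are given functions in $L^2(\Omega)$. Error measure and estimators.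 Let $X=L^2(J;H^1(\Omega))\cap H^1(J;L^2(\Omega))$ with $\|\psi\|_X^2=\int_J\int_\Omega\big(\psi^2+|K^{1/2}\nabla\psi|^2+\psi_t^2\big)$, and $$N_\alpha=\sup_{\psi\in X,\ \|\psi\|_X=1}\int_J\Big(\int_\Omega\partial_t(\phi C_\alpha-\phi C_{\alpha,h,\tau})\psi-\int_\Omega(u_\alpha-u_{\alpha,h,\tau})\cdot\nabla\psi\Big).$$ For a velocity $v$ let $R_E(v)=\|\partial_t(\phi C_{\alpha,h,\tau})+\nabla\cdot v-q_\alpha\|_{L^2(E)}$ and $$\eta_{t,r,E}(v)=|\tau_E^1-\tau_E^0|\,R_E(v),\quad \eta_{s,r,E}(v)=\operatorname{diam}(F_E)\,R_E(v),$$ $$\eta_{t,f,E}=\Big(\int_EK^{-1}|u_{\alpha,h}-u_{\alpha,h,\tau}|^2\Big)^{1/2},\quad \eta_{s,f,E}=\Big(\int_EK^{-1}|u_{up,\alpha,h}-u_{\alpha,h}|^2\Big)^{1/2}.$$ Lemma. There is a constant $C_{poin}>0$ depending only on $d$, and for every $k_0>0$ a constant $C>0$ depending only on $d$ and $k_0$,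 such that for all data, exact solutions, meshes, starting values and discrete solutions as above, for $\alpha\in\{o,w\}$, the supremum $N_\alpha$ is finite and $$N_\alpha\le\Big(\sum_{E}\eta_{t,f,E}^2\Big)^{1/2}+\Big(\sum_{E}\eta_{s,f,E}^2\Big)^{1/2}+C\,C_{poin}\Big\{\Big(\sum_{E}\eta_{t,r,E}(v)^2\Big)^{1/2}+\Big(\sum_{E}\eta_{s,r,E}(v)^2\Big)^{1/2}\Big\}$$ with $v=u_{up,\alpha,h}$. If on every element $E$ the field $u_{up,\alpha,h}$ is a Raviart–Thomas field of $F_E$ (with components $\alpha_k+\beta_kx_k$), constant in time, and its value at $\tau_E^{0,-}$ is also a Raviart–Thomas field of $F_E$, then the estimate holds with $v=u_{up,\alpha,h,\tau}$ too, with the same constants. -/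

import Mathlib

open MeasureTheory Set
open scoped Matrix ContDiff

noncomputable section

namespace TwoPhase

/-- Points of `ℝ^d`.  Only Lebesgue measure and coordinates are used; Euclidean products and
lengths are always written out with `⬝ᵥ`. -/
abbrev Space (d : ℕ) := Fin d → ℝ

/-- Points `(t, x)` of space-time. -/
abbrev SpaceTime (d : ℕ) := ℝ × Space d

/-- The two phases; oil is the non-wetting and water the wetting phase. -/
inductive Phase
  | oil
  | water

/-- The space-time slab `J × Ω` with `J = (a, b]`. -/
def slab {d : ℕ} (Ω : Set (Space d)) (a b : ℝ) : Set (SpaceTime d) := Ioc a b ×ˢ Ω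

/-! ### Weak derivatives and the space `X = L²(J; H¹(Ω)) ∩ H¹(J; L²(Ω))` -/

/-- `g` is the weak derivative of `f` in the space-time direction `v` on `(a, b) × Ω`. -/
def HasWeakDeriv {d : ℕ} (Ω : Set (Space d)) (a b : ℝ) (v : SpaceTime d)
    (f g : SpaceTime d → ℝ) : Prop :=
  ∀ θ : SpaceTime d → ℝ, ContDiff ℝ ∞ θ → HasCompactSupport θ →
    tsupport θ ⊆ Ioo a b ×ˢ Ω →
    ∫ y in slab Ω a b, f y * fderiv ℝ θ y v = - ∫ y in slab Ω a b, g y * θ y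

/-- Square integrability over the slab. -/
abbrev MemL2 {d : ℕ} (Ω : Set (Space d)) (a b : ℝ) (f : SpaceTime d → ℝ) : Prop :=
  MemLp f 2 (volume.restrict (slab Ω a b))

/-- The time direction. -/
def dirT (d : ℕ) : SpaceTime d := (1, 0)

/-- The `k`-th space direction. -/
def dirX {d : ℕ} (k : Fin d) : SpaceTime d := (0, Pi.single k 1)

/-- An element of `X = L²(J; H¹(Ω)) ∩ H¹(J; L²(Ω))`: a square integrable function together with
its square integrable weak time derivative and weak spatial gradient. -/
structure XSpace {d : ℕ} (Ω : Set (Space d)) (a b : ℝ) where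
  val : SpaceTime d → ℝ
  dt : SpaceTime d → ℝ
  grad : SpaceTime d → Fin d → ℝ
  val_mem : MemL2 Ω a b val
  dt_mem : MemL2 Ω a b dt
  grad_mem : ∀ k, MemL2 Ω a b (fun y => grad y k)
  dt_weak : HasWeakDeriv Ω a b (dirT d) val dt
  grad_weak : ∀ k, HasWeakDeriv Ω a b (dirX k) val (fun y => grad y k)

/-- `D = ∇ · u` weakly on `J × Ω` and `u · ν = 0` on `∂Ω`.  The normal trace of a field of
`L²(J; H(div; Ω))` is the functional `ψ ↦ ∫∫ u · ∇ψ + (∇ · u) ψ`; it is required to vanish. -/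
structure HasDivNoFlow {d : ℕ} (Ω : Set (Space d)) (a b : ℝ)
    (u : SpaceTime d → Fin d → ℝ) (D : SpaceTime d → ℝ) : Prop where
  u_mem : ∀ k, MemL2 Ω a b (fun y => u y k)
  div_mem : MemL2 Ω a b D
  green : ∀ ψ : XSpace Ω a b,
    ∫ y in slab Ω a b, (u y ⬝ᵥ ψ.grad y + D y * ψ.val y) = 0

/-! ### Data of the two-phase flow problem -/

/-- Data of slightly compressible two-phase flow on `J × Ω`. -/
structure FlowData (d : ℕ) (Ω : Set (Space d)) (a b : ℝ) where
  /-- porosity -/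
  φ : Space d → ℝ
  /-- permeability tensor -/
  K : Space d → Matrix (Fin d) (Fin d) ℝ
  /-- sources and sinks -/
  q : Phase → SpaceTime d → ℝ
  /-- gravity vector -/
  g : Fin d → ℝ
  /-- reference densities -/
  ρref : Phase → ℝ
  /-- fluid compressibilities -/
  cf : Phase → ℝ
  /-- reference pressures -/
  pref : Phase → ℝ
  /-- viscosities -/
  μ : Phase → ℝ
  /-- relative permeabilities, as functions of the saturation of the phase -/
  kr : Phase → ℝ → ℝ
  /-- capillary pressure, as a function of the saturation of the wetting phase -/
  pc : ℝ → ℝ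
  μ_pos : ∀ α, 0 < μ α
  φ_bdd : MemLp φ ⊤ (volume.restrict Ω)
  q_mem : ∀ α, MemL2 Ω a b (q α)
  K_meas : ∀ i j, AEStronglyMeasurable (fun x => K x i j) (volume.restrict Ω)
  K_symm : ∀ x ∈ Ω, (K x).IsSymm
  K_bdd : ∃ k₁ : ℝ, ∀ x ∈ Ω, ∀ ξ : Fin d → ℝ, ξ ⬝ᵥ (K x *ᵥ ξ) ≤ k₁ * (ξ ⬝ᵥ ξ)

namespace FlowData

variable {d : ℕ} {Ω : Set (Space d)} {a b : ℝ}

/-- Density `ρ_α(p) = ρ_ref exp(c_f (p - p_ref))`. -/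
def ρ (P : FlowData d Ω a b) (α : Phase) (p : ℝ) : ℝ :=
  P.ρref α * Real.exp (P.cf α * (p - P.pref α))

/-- Phase mass concentration `C_α = ρ_α(p) s`. -/
def conc (P : FlowData d Ω a b) (α : Phase) (p s : ℝ) : ℝ := P.ρ α p * s

/-- Mobility ratio `λ_α = k_{rα}(s) ρ_α(p) / μ_α`. -/
def mob (P : FlowData d Ω a b) (α : Phase) (p s : ℝ) : ℝ := P.kr α s * P.ρ α p / P.μ α

/-- The norm of `X`, with square
`∫_J (‖ψ‖² + ‖K^{1/2} ∇ψ‖² + ‖∂_t ψ‖²)`. -/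
def normX (P : FlowData d Ω a b) (ψ : XSpace Ω a b) : ℝ :=
  Real.sqrt (∫ y in slab Ω a b,
    (ψ.val y ^ 2 + ψ.grad y ⬝ᵥ (P.K y.2 *ᵥ ψ.grad y) + ψ.dt y ^ 2))

end FlowData

/-- A solution of the two-phase flow equations with no-flow boundary condition on `J × Ω`. -/
structure ExactSolution {d : ℕ} {Ω : Set (Space d)} {a b : ℝ} (P : FlowData d Ω a b) where
  /-- pressures -/
  p : Phase → SpaceTime d → ℝ
  /-- saturations -/
  s : Phase → SpaceTime d → ℝ
  /-- velocities -/
  u : Phase → SpaceTime d → Fin d → ℝ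
  /-- the weak gradients of the pressures -/
  gradp : Phase → SpaceTime d → Fin d → ℝ
  /-- the weak time derivatives of `φ C_α` -/
  dtC : Phase → SpaceTime d → ℝ
  /-- the weak divergences of the velocities -/
  divu : Phase → SpaceTime d → ℝ
  p_mem : ∀ α, MemL2 Ω a b (p α)
  gradp_mem : ∀ α k, MemL2 Ω a b (fun y => gradp α y k)
  gradp_weak : ∀ α k, HasWeakDeriv Ω a b (dirX k) (p α) (fun y => gradp α y k)
  C_mem : ∀ α, MemL2 Ω a b (fun y => P.φ y.2 * P.conc α (p α y) (s α y))
  dtC_mem : ∀ α, MemL2 Ω a b (dtC α)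
  dtC_weak : ∀ α,
    HasWeakDeriv Ω a b (dirT d) (fun y => P.φ y.2 * P.conc α (p α y) (s α y)) (dtC α)
  div_noFlow : ∀ α, HasDivNoFlow Ω a b (u α) (divu α)
  mass_balance : ∀ α, ∀ᵐ y ∂(volume.restrict (slab Ω a b)), dtC α y + divu α y = P.q α y
  darcy : ∀ α, ∀ᵐ y ∂(volume.restrict (slab Ω a b)),
    u α y = - (P.mob α (p α y) (s α y) • (P.K y.2 *ᵥ (gradp α y - P.ρ α (p α y) • P.g)))
  capillary : ∀ᵐ y ∂(volume.restrict (slab Ω a b)),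
    P.pc (s .water y) = p .oil y - p .water y
  saturation : ∀ᵐ y ∂(volume.restrict (slab Ω a b)), s .oil y + s .water y = 1

/-! ### Space-time meshes -/

/-- A space-time box `E = (t₀, t₁] × F`, with `F` a `d`-dimensional box. -/
structure Elem (d : ℕ) where
  t₀ : ℝ
  t₁ : ℝ
  lo : Fin d → ℝ
  hi : Fin d → ℝ
  time_lt : t₀ < t₁
  space_lt : ∀ k, lo k < hi k

namespace Elem

variable {d : ℕ}

/-- The points of the element, half-open in every variable. -/
def carrier (E : Elem d) : Set (SpaceTime d) :=
  Ioc E.t₀ E.t₁ ×ˢ Set.pi univ (fun k => Ioc (E.lo k) (E.hi k))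

/-- Length of the time interval. -/
def timeSize (E : Elem d) : ℝ := |E.t₁ - E.t₀|

/-- Euclidean diameter of the spatial box. -/
def spaceSize (E : Elem d) : ℝ := Real.sqrt (∑ k, (E.hi k - E.lo k) ^ 2)

end Elem

/-- A partition of `(a, b] × Ω` into finitely many non-overlapping space-time boxes.  Neighbouring
boxes need not match, neither in time nor in space. -/
structure Mesh {d : ℕ} (Ω : Set (Space d)) (a b : ℝ) where
  N : ℕ
  elem : Fin N → Elem d
  disjoint : ∀ i j, i ≠ j → Disjoint (elem i).carrier (elem j).carrier
  cover : (⋃ i, Ioc (elem i).t₀ (elem i).t₁ ×ˢ Icc (elem i).lo (elem i).hi)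
    = Ioc a b ×ˢ closure Ω

/-- The divergence in the space variables, taken pointwise.  On piecewise polynomial fields with
continuous normal components this is almost everywhere the divergence. -/
def divX {d : ℕ} (u : SpaceTime d → Fin d → ℝ) (y : SpaceTime d) : ℝ :=
  ∑ k, deriv (fun r => u (y.1, Function.update y.2 k r) k) (y.2 k)

namespace Mesh

variable {d : ℕ} {Ω : Set (Space d)} {a b : ℝ}

/-- Candidates `(i, j, k)` for interior faces: `elem i` below and `elem j` above in
direction `k`. -/
abbrev FaceIdx (M : Mesh Ω a b) := Fin M.N × Fin M.N × Fin d

/-- `(i, j, k)` is an interior face: the upper `k`-face of `elem i` meets the lower `k`-face of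
`elem j` in a set `e` of positive `d`-dimensional measure (time included).  These sets `e` are the
rectangles of the intersection of the two traces. -/
def IsFace (M : Mesh Ω a b) (e : M.FaceIdx) : Prop :=
  (M.elem e.1).hi e.2.2 = (M.elem e.2.1).lo e.2.2 ∧
  max (M.elem e.1).t₀ (M.elem e.2.1).t₀ < min (M.elem e.1).t₁ (M.elem e.2.1).t₁ ∧
  ∀ l, l ≠ e.2.2 → max ((M.elem e.1).lo l) ((M.elem e.2.1).lo l) <
    min ((M.elem e.1).hi l) ((M.elem e.2.1).hi l)

open Classical in
/-- The finite set of interior faces. -/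
def faces (M : Mesh Ω a b) : Finset M.FaceIdx := Finset.univ.filter M.IsFace

/-- `(t, x)` projects, along direction `k`, into the face `e`. -/
def OverFace (M : Mesh Ω a b) (e : M.FaceIdx) (y : SpaceTime d) : Prop :=
  y.1 ∈ Ioc (max (M.elem e.1).t₀ (M.elem e.2.1).t₀) (min (M.elem e.1).t₁ (M.elem e.2.1).t₁) ∧
  ∀ l, l ≠ e.2.2 → y.2 l ∈ Ioc (max ((M.elem e.1).lo l) ((M.elem e.2.1).lo l))
    (min ((M.elem e.1).hi l) ((M.elem e.2.1).hi l))

/-- The hat function in the variable `x_k`: zero on the lower face of `elem i`, one on the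
common face, zero on the upper face of `elem j`. -/
def hat (M : Mesh Ω a b) (e : M.FaceIdx) (r : ℝ) : ℝ :=
  if r ∈ Ioc ((M.elem e.1).lo e.2.2) ((M.elem e.1).hi e.2.2) then
    (r - (M.elem e.1).lo e.2.2) / ((M.elem e.1).hi e.2.2 - (M.elem e.1).lo e.2.2)
  else if r ∈ Ioc ((M.elem e.2.1).lo e.2.2) ((M.elem e.2.1).hi e.2.2) then
    ((M.elem e.2.1).hi e.2.2 - r) / ((M.elem e.2.1).hi e.2.2 - (M.elem e.2.1).lo e.2.2)
  else 0

open Classical in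
/-- The lowest order Raviart-Thomas function `v_e` of the face `e`, constant in time: it lives on
the two sub-boxes of the adjacent elements lying over `e`, its normal component is one on `e` and
zero on all other faces of these sub-boxes. -/
def faceFun (M : Mesh Ω a b) (e : M.FaceIdx) (y : SpaceTime d) : Fin d → ℝ :=
  if M.OverFace e y then Pi.single e.2.2 (M.hat e (y.2 e.2.2)) else 0

/-- The field of the enhanced velocity space with coefficients `U`.  The space is the span of the
`v_e` over the interior faces (no faces on `∂Ω`, because of the no-flow condition). -/
def vel (M : Mesh Ω a b) (U : M.FaceIdx → ℝ) (y : SpaceTime d) : Fin d → ℝ :=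
  ∑ e ∈ M.faces, U e • M.faceFun e y

/-- The function of `W_h` with the values `w` on the elements. -/
def scal (M : Mesh Ω a b) (w : Fin M.N → ℝ) (y : SpaceTime d) : ℝ :=
  ∑ i, (M.elem i).carrier.indicator (fun _ => w i) y

open Classical in
/-- `f(τ⁻, x)` for a discrete function `f` on `(a, b] × Ω`, which is left-continuous in time;
`f₀` is the value at `a⁻`, from the previous slab or the initial condition. -/
def leftVal {V : Type} (a : ℝ) (f₀ : Space d → V) (f : SpaceTime d → V) (τ : ℝ) (x : Space d) : V :=
  if τ = a then f₀ x else f (τ, x)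

/-- The linear interpolation in time `f_τ`, element by element. -/
def interp {V : Type} [AddCommGroup V] [Module ℝ V] (M : Mesh Ω a b)
    (f₀ : Space d → V) (f : SpaceTime d → V) (y : SpaceTime d) : V :=
  ∑ i, (M.elem i).carrier.indicator
    (fun z =>
      ((z.1 - (M.elem i).t₀) / ((M.elem i).t₁ - (M.elem i).t₀)) •
        leftVal a f₀ f (M.elem i).t₁ z.2 +
      (((M.elem i).t₁ - z.1) / ((M.elem i).t₁ - (M.elem i).t₀)) •
        leftVal a f₀ f (M.elem i).t₀ z.2) y

end Mesh

/-- The values at the beginning `a⁻` of the slab (initial data, or the end of the previous slab). -/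
structure StartData {d : ℕ} {Ω : Set (Space d)} {a b : ℝ} (P : FlowData d Ω a b) where
  p : Phase → Space d → ℝ
  s : Phase → Space d → ℝ
  u : Phase → Space d → Fin d → ℝ
  uup : Phase → Space d → Fin d → ℝ
  C_mem : ∀ α, MemLp (fun x => P.conc α (p α x) (s α x)) 2 (volume.restrict Ω)
  u_mem : ∀ α k, MemLp (fun x => u α x k) 2 (volume.restrict Ω)
  uup_mem : ∀ α k, MemLp (fun x => uup α x k) 2 (volume.restrict Ω)

/-- Discrete unknowns: coefficients of pressures, saturations (in `W_h`) and of the velocities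
`u`, `ũ`, `u_up` (in the enhanced velocity space). -/
structure DiscreteState {d : ℕ} {Ω : Set (Space d)} {a b : ℝ} (M : Mesh Ω a b) where
  p : Phase → Fin M.N → ℝ
  s : Phase → Fin M.N → ℝ
  u : Phase → M.FaceIdx → ℝ
  ut : Phase → M.FaceIdx → ℝ
  uup : Phase → M.FaceIdx → ℝ

section Scheme

variable {d : ℕ} {Ω : Set (Space d)} {a b : ℝ} {P : FlowData d Ω a b} {M : Mesh Ω a b}

/-- The discrete concentration `C_{α,h} = ρ_α(p_{α,h}) s_{α,h}`. -/
def concH (P : FlowData d Ω a b) (S : DiscreteState M) (α : Phase) (y : SpaceTime d) : ℝ :=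
  P.conc α (M.scal (S.p α) y) (M.scal (S.s α) y)

/-- `∂_t (φ C_{α,h,τ})`. -/
def dtConc (S : DiscreteState M) (Z : StartData P) (α : Phase) (y : SpaceTime d) : ℝ :=
  deriv (fun t => P.φ y.2 *
    M.interp (fun x => P.conc α (Z.p α x) (Z.s α x)) (concH P S α) (t, y.2)) y.1

/-- `u_{α,h,τ}`. -/
def velTau (S : DiscreteState M) (Z : StartData P) (α : Phase) : SpaceTime d → Fin d → ℝ :=
  M.interp (Z.u α) (M.vel (S.u α))

/-- `u_{up,α,h,τ}`. -/
def upTau (S : DiscreteState M) (Z : StartData P) (α : Phase) : SpaceTime d → Fin d → ℝ :=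
  M.interp (Z.uup α) (M.vel (S.uup α))

open Classical in
/-- The upwind mobility ratio `λ*_α` on a face: the mean of the two densities times the relative
permeability on the upstream side, divided by the viscosity. -/
def upMob (P : FlowData d Ω a b) (S : DiscreteState M) (α : Phase) (e : M.FaceIdx) : ℝ :=
  1 / (2 * P.μ α) * (P.ρ α (S.p α e.1) + P.ρ α (S.p α e.2.1)) *
    (if 0 < S.ut α e then P.kr α (S.s α e.1) else P.kr α (S.s α e.2.1))

/-- The space-time enhanced velocity scheme on the slab. -/
structure IsDiscreteSolution (P : FlowData d Ω a b) (M : Mesh Ω a b) (Z : StartData P)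
    (S : DiscreteState M) : Prop where
  mass_balance : ∀ α, ∀ w : Fin M.N → ℝ,
    (∫ y in slab Ω a b, dtConc S Z α y * M.scal w y) +
      (∫ y in slab Ω a b, divX (M.vel (S.uup α)) y * M.scal w y) =
    ∫ y in slab Ω a b, P.q α y * M.scal w y
  darcy : ∀ α, ∀ V : M.FaceIdx → ℝ,
    ∫ y in slab Ω a b, ((P.K y.2)⁻¹ *ᵥ M.vel (S.ut α) y) ⬝ᵥ M.vel V y =
    ∫ y in slab Ω a b, M.scal (S.p α) y * divX (M.vel V) y
  flux : ∀ α, ∀ V : M.FaceIdx → ℝ,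
    ∫ y in slab Ω a b, M.vel (S.u α) y ⬝ᵥ M.vel V y =
    ∫ y in slab Ω a b,
      P.mob α (M.scal (S.p α) y) (M.scal (S.s α) y) * (M.vel (S.ut α) y ⬝ᵥ M.vel V y)
  upwind : ∀ α, ∀ V : M.FaceIdx → ℝ,
    ∫ y in slab Ω a b, M.vel (S.uup α) y ⬝ᵥ M.vel V y =
    ∫ y in slab Ω a b, M.vel (fun e => upMob P S α e * S.ut α e) y ⬝ᵥ M.vel V y
  capillary : ∀ i, P.pc (S.s .water i) = S.p .oil i - S.p .water i
  saturation : ∀ i, S.s .oil i + S.s .water i = 1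

/-! ### Dual norm of the residual and error estimators -/

/-- `∫_J (∫_Ω ∂_t(φ C_α - φ C_{α,h,τ}) ψ - ∫_Ω (u_α - u_{α,h,τ}) · ∇ψ)`. -/
def residual (X : ExactSolution P) (Z : StartData P) (S : DiscreteState M) (α : Phase)
    (ψ : XSpace Ω a b) : ℝ :=
  ∫ y in slab Ω a b, ((X.dtC α y - dtConc S Z α y) * ψ.val y -
    (X.u α y - velTau S Z α y) ⬝ᵥ ψ.grad y)

/-- The values of the residual on the unit sphere of `X`. -/
def residualValues (X : ExactSolution P) (Z : StartData P) (S : DiscreteState M) (α : Phase) :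
    Set ℝ :=
  {r | ∃ ψ : XSpace Ω a b, P.normX ψ = 1 ∧ r = residual X Z S α ψ}

/-- The dual norm `N_α` of the residual. -/
def dualNorm (X : ExactSolution P) (Z : StartData P) (S : DiscreteState M) (α : Phase) : ℝ :=
  sSup (residualValues X Z S α)

/-- `‖∂_t(φ C_{α,h,τ}) + ∇ · v - q_α‖_{L²(E)}`, for a velocity `v`. -/
def elemResidual (Z : StartData P) (S : DiscreteState M) (α : Phase)
    (v : SpaceTime d → Fin d → ℝ) (i : Fin M.N) : ℝ :=
  Real.sqrt (∫ y in (M.elem i).carrier, |dtConc S Z α y + divX v y - P.q α y| ^ 2)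

/-- Temporal residual estimator, with `v` in the place of the upwind velocity. -/
def etaTR (Z : StartData P) (S : DiscreteState M) (α : Phase)
    (v : SpaceTime d → Fin d → ℝ) (i : Fin M.N) : ℝ :=
  (M.elem i).timeSize * elemResidual Z S α v i

/-- Spatial residual estimator, with `v` in the place of the upwind velocity. -/
def etaSR (Z : StartData P) (S : DiscreteState M) (α : Phase)
    (v : SpaceTime d → Fin d → ℝ) (i : Fin M.N) : ℝ :=
  (M.elem i).spaceSize * elemResidual Z S α v i

/-- `(∫_E K⁻¹ |v|²)^{1/2}`, that is `(∫_E v · K⁻¹ v)^{1/2}`. -/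
def elemFluxNorm (P : FlowData d Ω a b) (M : Mesh Ω a b) (v : SpaceTime d → Fin d → ℝ)
    (i : Fin M.N) : ℝ :=
  Real.sqrt (∫ y in (M.elem i).carrier, v y ⬝ᵥ ((P.K y.2)⁻¹ *ᵥ v y))

/-- Temporal flux estimator. -/
def etaTF (Z : StartData P) (S : DiscreteState M) (α : Phase) (i : Fin M.N) : ℝ :=
  elemFluxNorm P M (fun y => M.vel (S.u α) y - velTau S Z α y) i

/-- Spatial flux estimator. -/
def etaSF (P : FlowData d Ω a b) (S : DiscreteState M) (α : Phase) (i : Fin M.N) : ℝ :=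
  elemFluxNorm P M (fun y => M.vel (S.uup α) y - M.vel (S.u α) y) i

/-- The right-hand side of the estimate, with the residual estimators formed with `v`. -/
def errorBound (c : ℝ) (Z : StartData P) (S : DiscreteState M) (α : Phase)
    (v : SpaceTime d → Fin d → ℝ) : ℝ :=
  Real.sqrt (∑ i, etaTF Z S α i ^ 2) + Real.sqrt (∑ i, etaSF P S α i ^ 2) +
    c * (Real.sqrt (∑ i, etaTR Z S α v i ^ 2) + Real.sqrt (∑ i, etaSR Z S α v i ^ 2))

/-- On every element `E = (t₀, t₁] × F`, the upwind velocity on `E` and its value at `t₀⁻` are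
lowest order Raviart-Thomas fields of the box `F`, the former constant in time: every component
`v_k` has the form `α_k + β_k x_k`. -/
def UpwindElementwiseRT0 (Z : StartData P) (S : DiscreteState M) (α : Phase) : Prop :=
  ∀ i, ∃ A B A₀ B₀ : Fin d → ℝ, ∀ y ∈ (M.elem i).carrier, ∀ k,
    M.vel (S.uup α) y k = A k + B k * y.2 k ∧
    Mesh.leftVal a (Z.uup α) (M.vel (S.uup α)) (M.elem i).t₀ y.2 k = A₀ k + B₀ k * y.2 k

end Scheme

end TwoPhase

end

noncomputable section

/-! ### Poincaré inequality for weakly differentiable functions on convex open sets -/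

section Poincare

open Filter Topology Convolution

/-! Fix a test function ψ of unit norm. Green's formula for the exact velocity and the exact mass
balance eliminate the exact solution from the residual; Green's formula for the upwind velocity
brings in its divergence. What remains (`residual_eq`) is ∫ r ψ − ∫ (u_h − u_{h,τ})·∇ψ − ∫ (u_up −
u_h)·∇ψ with r = q − ∂_t(φ C_{h,τ}) − ∇·u_up. The two flux terms are bounded by Cauchy-Schwarz on
each element with the weights K⁻¹ and K (`abs_flux_le`).

The discrete mass balance, tested with the indicator of an element, says that r has mean zero there.
So only differences of values of ψ matter, and a Poincaré inequality on the box applies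
(`Mesh.abs_integral_mul_le`). It is proved directly in dimension d + 1, with the time step attached
to ψ_t and the diameter to ∇ψ: ψ(x) − ψ(y) is an integral along the segment, the derivative in the
direction x − y is at most τ|ψ_t| + diam|∇ψ|, and a change of variables in whichever endpoint has
weight at least 1/2 costs a factor 2^(d+1) (`lintegral_segment_le`). Mollification inside the box
and Fatou's lemma extend this to weak derivatives (`lintegral_lintegral_sub_sq_le`).

Green's formula for the enhanced velocity space (`Mesh.hasDivNoFlow_vel`) avoids traces of ψ: each
v_e is a limit of smooth fields with compact support inside (a, b) × Ω, and the weak derivative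
identity passes to the limit.

With the interpolated upwind velocity, the Raviart-Thomas assumption makes the divergence on an
element change by c (t₁ − t)/(t₁ − t₀) with a constant c. Since r has mean zero while this weight
has mean 1/2, the new residual controls c, and hence r up to a factor 4
(`sqrt_massResidual_le_upTau`). -/

theorem sq_lintegral_le {α : Type*} [MeasurableSpace α] (ν : Measure α) {f : α → ENNReal}
    (hf : AEMeasurable f ν) : (∫⁻ x, f x ∂ν) ^ 2 ≤ ν univ * ∫⁻ x, f x ^ 2 ∂ν := by
  have h := ENNReal.lintegral_mul_le_Lp_mul_Lq ν Real.HolderConjugate.two_two hf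
    (aemeasurable_const (b := (1 : ENNReal)))
  simp only [Pi.mul_apply, mul_one, one_pow, lintegral_one, ENNReal.rpow_two] at h
  calc (∫⁻ x, f x ∂ν) ^ 2
      ≤ ((∫⁻ x, f x ^ 2 ∂ν) ^ (1 / 2 : ℝ) * ν univ ^ (1 / 2 : ℝ)) ^ 2 := by gcongr
    _ = ν univ * ∫⁻ x, f x ^ 2 ∂ν := by
      rw [mul_pow, ← ENNReal.rpow_two, ← ENNReal.rpow_two, ← ENNReal.rpow_mul,
        ← ENNReal.rpow_mul]
      norm_num [mul_comm]

/-- Cauchy-Schwarz for the measure with density `w`. For a mollifier `w`, which has mass one, this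
is Jensen's inequality. -/
theorem sq_lintegral_mul_le {α : Type*} [MeasurableSpace α] (ν : Measure α) {f w : α → ENNReal}
    (hf : Measurable f) (hw : Measurable w) :
    (∫⁻ x, w x * f x ∂ν) ^ 2 ≤ (∫⁻ x, w x ∂ν) * ∫⁻ x, w x * f x ^ 2 ∂ν := by
  have h := sq_lintegral_le (ν.withDensity w) hf.aemeasurable
  rw [lintegral_withDensity_eq_lintegral_mul _ hw hf,
    lintegral_withDensity_eq_lintegral_mul _ hw (hf.pow_const 2),
    withDensity_apply _ MeasurableSet.univ, Measure.restrict_univ] at h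
  exact h

variable {V : Type*} [NormedAddCommGroup V] [NormedSpace ℝ V] [FiniteDimensional ℝ V]
  [MeasurableSpace V] [BorelSpace V] {μ : Measure V} [μ.IsAddHaarMeasure]

theorem lintegral_comp_smul_add {F : V → ENNReal} (hF : Measurable F) {s : ℝ} (hs : s ≠ 0)
    (c : V) :
    ∫⁻ x, F (s • x + c) ∂μ
      = ENNReal.ofReal |(s ^ Module.finrank ℝ V)⁻¹| * ∫⁻ x, F x ∂μ := by
  have h : ∫⁻ x, F (x + c) ∂(μ.map (s • ·)) = ∫⁻ x, F (s • x + c) ∂μ :=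
    lintegral_map (by fun_prop) (by fun_prop)
  rw [← h, Measure.map_addHaar_smul μ hs, lintegral_smul_measure, lintegral_add_right_eq_self]
  rfl

/-- The substitution has Jacobian s⁻ⁿ, which s ≥ 1/2 keeps below 2ⁿ; this is the only source of the
dimensional constant in the Poincaré inequality. -/
theorem lintegral_comp_smul_add_le {F : V → ENNReal} (hF : Measurable F) {s : ℝ}
    (hs : 1 / 2 ≤ s) (c : V) :
    ∫⁻ x, F (s • x + c) ∂μ ≤ 2 ^ Module.finrank ℝ V * ∫⁻ x, F x ∂μ := by
  rw [lintegral_comp_smul_add hF (by positivity)]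
  gcongr
  have : |(s ^ Module.finrank ℝ V)⁻¹| ≤ (2 : ℝ) ^ Module.finrank ℝ V := by
    rw [abs_of_nonneg (by positivity), ← inv_pow]
    gcongr
    exact inv_le_of_inv_le₀ (by norm_num) (by linarith)
  calc _ ≤ ENNReal.ofReal ((2 : ℝ) ^ Module.finrank ℝ V) := ENNReal.ofReal_le_ofReal this
    _ = _ := by rw [ENNReal.ofReal_pow (by norm_num)]; norm_num

/-- Averages of `F` over the segments that join the points of `B`. -/
theorem lintegral_segment_le {F : V → ENNReal} (hF : Measurable F) (B : Set V) {s : ℝ} (c : V) :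
    ∫⁻ x in B, ∫⁻ y in B, F (y + s • (x - y) - c) ∂μ ∂μ
      ≤ 2 ^ Module.finrank ℝ V * μ B * ∫⁻ x, F x ∂μ := by
  -- The point y + s(x − y) carries x with weight s and y with weight 1 − s. One of them is at least
  -- 1/2, and that variable is integrated first.
  rcases le_total (1 / 2) s with h | h
  · rw [lintegral_lintegral_swap (by fun_prop)]
    calc _ ≤ ∫⁻ y in B, 2 ^ Module.finrank ℝ V * ∫⁻ x, F x ∂μ ∂μ := by
          refine lintegral_mono fun y => ?_
          refine le_trans (setLIntegral_le_lintegral _ _) ?_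
          refine le_trans (le_of_eq ?_) (lintegral_comp_smul_add_le hF h (y - s • y - c))
          congr! 2 with x
          congr 1
          module
      _ = _ := by rw [setLIntegral_const]; ring
  · calc _ ≤ ∫⁻ y in B, 2 ^ Module.finrank ℝ V * ∫⁻ x, F x ∂μ ∂μ := by
          refine lintegral_mono fun x => ?_
          refine le_trans (setLIntegral_le_lintegral _ _) ?_
          refine le_trans (le_of_eq ?_)
            (lintegral_comp_smul_add_le hF (s := 1 - s) (by linarith) (s • x - c))
          congr! 2 with y
          congr 1
          module
      _ = _ := by rw [setLIntegral_const]; ring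

/-- `g` is the weak Fréchet derivative of `ψ` on `B`. -/
def HasWeakGradient (μ : Measure V) (B : Set V) (ψ : V → ℝ) (g : V → V → ℝ) : Prop :=
  ∀ θ : V → ℝ, ContDiff ℝ ∞ θ → HasCompactSupport θ → tsupport θ ⊆ B →
    ∀ v, ∫ y in B, ψ y * fderiv ℝ θ y v ∂μ = - ∫ y in B, g y v * θ y ∂μ

variable {B : Set V} {ψ : V → ℝ} {g : V → V → ℝ}

/-- The mollification of `ψ` restricted to `B`. -/
def mollify (μ : Measure V) (B : Set V) (ψ : V → ℝ) (φ : ContDiffBump (0 : V)) : V → ℝ :=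
  φ.normed μ ⋆[ContinuousLinearMap.lsmul ℝ ℝ, μ] (B.indicator ψ)

theorem contDiff_mollify (hB : MeasurableSet B) (hψ : IntegrableOn ψ B μ)
    (φ : ContDiffBump (0 : V)) : ContDiff ℝ 1 (mollify μ B ψ φ) :=
  φ.hasCompactSupport_normed.contDiff_convolution_left _ (φ.contDiff_normed (n := 1))
    (hψ.integrable_indicator hB).locallyIntegrable

/-- The derivative falls on the kernel, and z ↦ kernel(p − z) is an admissible test function once
the ball around p lies in `B`; the jump of the truncated ψ at the boundary of `B` is then not seen
at `p`. The sign from the reflection cancels the sign in the weak derivative identity. -/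
theorem fderiv_mollify (hB : MeasurableSet B) (hψ : IntegrableOn ψ B μ)
    (hg : HasWeakGradient μ B ψ g) (φ : ContDiffBump (0 : V)) {p : V}
    (hp : Metric.closedBall p φ.rOut ⊆ B) (v : V) :
    fderiv ℝ (mollify μ B ψ φ) p v = ∫ z in B, g z v * φ.normed μ (p - z) ∂μ := by
  have hint := (hψ.integrable_indicator hB).locallyIntegrable
  have hflip : mollify μ B ψ φ =
      B.indicator ψ ⋆[(ContinuousLinearMap.lsmul ℝ ℝ : ℝ →L[ℝ] ℝ →L[ℝ] ℝ).flip, μ] φ.normed μ :=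
    (convolution_flip _).symm
  have h := φ.hasCompactSupport_normed.hasFDerivAt_convolution_right
    (ContinuousLinearMap.lsmul ℝ ℝ : ℝ →L[ℝ] ℝ →L[ℝ] ℝ).flip hint
    (φ.contDiff_normed (μ := μ) (n := 1)) p
  rw [hflip, h.fderiv]
  set θ : V → ℝ := fun z => φ.normed μ (p - z) with hθ
  have hθc : ContDiff ℝ ∞ θ := (φ.contDiff_normed (n := ⊤)).comp (contDiff_const.sub contDiff_id)
  have hsupp : tsupport θ ⊆ Metric.closedBall p φ.rOut := by
    refine closure_minimal (fun z hz => ?_) Metric.isClosed_closedBall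
    have : p - z ∈ Function.support (φ.normed μ) := hz
    rw [φ.support_normed_eq, mem_ball_zero_iff] at this
    rw [mem_closedBall_iff_norm']
    exact this.le
  have hcs : HasCompactSupport θ :=
    (isCompact_closedBall p φ.rOut).of_isClosed_subset (isClosed_tsupport _) hsupp
  have hd : ∀ z, fderiv ℝ θ z v = - fderiv ℝ (φ.normed μ) (p - z) v := by
    intro z
    have h1 : HasFDerivAt (φ.normed μ) (fderiv ℝ (φ.normed μ) (p - z)) (p - z) :=
      ((φ.contDiff_normed (n := 1)).differentiable (by simp) _).hasFDerivAt
    have h2 := h1.comp z ((hasFDerivAt_id z).const_sub p)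
    rw [show fderiv ℝ θ z = _ from h2.fderiv]
    simp
  have key := hg θ hθc hcs (hsupp.trans hp) v
  rw [← neg_eq_iff_eq_neg] at key
  rw [show (∫ z in B, g z v * φ.normed μ (p - z) ∂μ) = ∫ z in B, g z v * θ z ∂μ from rfl, ← key]
  rw [convolution_precompR_apply _ hint (φ.hasCompactSupport_normed.fderiv ℝ)
    ((φ.contDiff_normed (n := 1)).continuous_fderiv (by simp))]
  rw [convolution_def, ← integral_neg, ← integral_indicator hB]
  refine integral_congr_ae (ae_of_all _ fun z => ?_)
  by_cases hz : z ∈ B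
  · simp [hz, hd, mul_comm]
  · simp [hz]

/-- Fundamental theorem of calculus along the segment from y to x, then Cauchy-Schwarz in s and
Jensen for the kernel. The majorant `H` serves all directions x − y at once, so the right-hand side
depends on x and y only through the point of evaluation. -/
theorem enorm_sub_mollify_sq_le (hB : IsOpen B) (hBc : Convex ℝ B) (hψ : IntegrableOn ψ B μ)
    (hg : HasWeakGradient μ B ψ g) {H : V → ENNReal} (hH : Measurable H)
    (hgH : ∀ᵐ z ∂(μ.restrict B), ∀ x ∈ B, ∀ y ∈ B, ‖g z (x - y)‖ₑ ≤ H z)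
    (φ : ContDiffBump (0 : V)) {x y : V}
    (hx : Metric.closedBall x φ.rOut ⊆ B) (hy : Metric.closedBall y φ.rOut ⊆ B) :
    ‖mollify μ B ψ φ x - mollify μ B ψ φ y‖ₑ ^ 2 ≤
      ∫⁻ s in Icc (0 : ℝ) 1, ∫⁻ w, ENNReal.ofReal (φ.normed μ w) *
        (B.indicator H (y + s • (x - y) - w)) ^ 2 ∂μ := by
  set f := mollify μ B ψ φ with hf
  have hfc : ContDiff ℝ 1 f := contDiff_mollify hB.measurableSet hψ φ
  have hxB : x ∈ B := hx (Metric.mem_closedBall_self φ.rOut_pos.le)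
  have hyB : y ∈ B := hy (Metric.mem_closedBall_self φ.rOut_pos.le)
  have hφm : Measurable (φ.normed μ) := φ.continuous_normed.measurable
  have hI : Measurable (B.indicator H) := hH.indicator hB.measurableSet
  -- By convexity, balls in `B` around both endpoints give balls of the same radius in `B` around
  -- all points of the segment.
  have hball : ∀ s ∈ Icc (0 : ℝ) 1, Metric.closedBall (y + s • (x - y)) φ.rOut ⊆ B := by
    intro s hs z hz
    rw [mem_closedBall_iff_norm] at hz
    have h1 : x + (z - (y + s • (x - y))) ∈ B := hx (by simpa [mem_closedBall_iff_norm] using hz)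
    have h2 : y + (z - (y + s • (x - y))) ∈ B := hy (by simpa [mem_closedBall_iff_norm] using hz)
    have h3 := hBc h1 h2 hs.1 (sub_nonneg.2 hs.2) (by ring)
    convert h3 using 1
    module
  set d : ℝ → ℝ := fun s => fderiv ℝ f (y + s • (x - y)) (x - y) with hd
  have hdc : Continuous d := by
    have := hfc.continuous_fderiv (by simp)
    fun_prop
  have hderiv : ∀ s, HasDerivAt (fun s : ℝ => f (y + s • (x - y))) (d s) s := by
    intro s
    have h1 : HasFDerivAt f (fderiv ℝ f (y + s • (x - y))) (y + s • (x - y)) :=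
      (hfc.differentiable (by simp) _).hasFDerivAt
    have h2 : HasDerivAt (fun s : ℝ => y + s • (x - y)) (x - y) s := by
      simpa using ((hasDerivAt_id s).smul_const (x - y)).const_add y
    exact h1.comp_hasDerivAt s h2
  have hftc : f x - f y = ∫ s in (0 : ℝ)..1, d s := by
    rw [intervalIntegral.integral_eq_sub_of_hasDerivAt (fun s _ => hderiv s)
      (hdc.intervalIntegrable _ _)]
    simp
  have hd_le : ∀ s ∈ Icc (0 : ℝ) 1, ‖d s‖ₑ ≤
      ∫⁻ w, ENNReal.ofReal (φ.normed μ w) * B.indicator H (y + s • (x - y) - w) ∂μ := by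
    intro s hs
    rw [hd]
    simp only
    rw [hf, fderiv_mollify hB.measurableSet hψ hg φ (hball s hs)]
    refine (enorm_integral_le_lintegral_enorm _).trans ?_
    -- Substituting w = y + s(x − y) − z turns the integral over z ∈ `B` into one over the kernel
    -- variable.
    rw [← lintegral_sub_left_eq_self (fun w => ENNReal.ofReal (φ.normed μ w) *
      B.indicator H (y + s • (x - y) - w)) (y + s • (x - y)),
      ← lintegral_indicator hB.measurableSet]
    refine lintegral_mono_ae ?_
    filter_upwards [(ae_restrict_iff' hB.measurableSet).1 hgH] with z hz
    by_cases hzB : z ∈ B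
    · simp only [hzB, indicator_of_mem, enorm_mul, sub_sub_cancel]
      rw [mul_comm, Real.enorm_of_nonneg (φ.nonneg_normed _)]
      gcongr
      exact hz hzB x hxB y hyB
    · simp [hzB]
  have hone : ∫⁻ w, ENNReal.ofReal (φ.normed μ w) ∂μ = 1 := by
    rw [← ofReal_integral_eq_lintegral_ofReal φ.integrable_normed
      (ae_of_all _ φ.nonneg_normed), φ.integral_normed, ENNReal.ofReal_one]
  rw [hftc, intervalIntegral.integral_of_le zero_le_one, ← integral_Icc_eq_integral_Ioc]
  calc ‖∫ s in Icc (0 : ℝ) 1, d s‖ₑ ^ 2 ≤ (∫⁻ s in Icc (0 : ℝ) 1, ‖d s‖ₑ) ^ 2 := by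
        gcongr; exact enorm_integral_le_lintegral_enorm _
    _ ≤ (volume.restrict (Icc (0 : ℝ) 1)) univ * ∫⁻ s in Icc (0 : ℝ) 1, ‖d s‖ₑ ^ 2 :=
        sq_lintegral_le _ hdc.enorm.measurable.aemeasurable
    _ = ∫⁻ s in Icc (0 : ℝ) 1, ‖d s‖ₑ ^ 2 := by simp
    _ ≤ _ := by
      refine setLIntegral_mono' measurableSet_Icc fun s hs => ?_
      calc ‖d s‖ₑ ^ 2 ≤ (∫⁻ w, ENNReal.ofReal (φ.normed μ w) *
            B.indicator H (y + s • (x - y) - w) ∂μ) ^ 2 := by gcongr; exact hd_le s hs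
        _ ≤ _ := by
          refine (sq_lintegral_mul_le μ (by fun_prop) (by fun_prop)).trans ?_
          rw [hone, one_mul]

theorem measurable_mollified_bound {H : V → ENNReal} (hH : Measurable H) (ρ : V → ℝ)
    (hρ : Measurable ρ) :
    Measurable (fun q : V × V => ∫⁻ s in Icc (0 : ℝ) 1, ∫⁻ w, ENNReal.ofReal (ρ w) *
        (H (q.2 + s • (q.1 - q.2) - w)) ^ 2 ∂μ) := by
  refine Measurable.lintegral_prod_right' (f := fun r : (V × V) × ℝ =>
    ∫⁻ w, ENNReal.ofReal (ρ w) * (H (r.1.2 + r.2 • (r.1.1 - r.1.2) - w)) ^ 2 ∂μ) ?_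
  refine Measurable.lintegral_prod_right' (f := fun r : ((V × V) × ℝ) × V =>
    ENNReal.ofReal (ρ r.2) * (H (r.1.1.2 + r.1.2 • (r.1.1.1 - r.1.1.2) - r.2)) ^ 2) ?_
  fun_prop

/-- Tonelli brings the integrals over x and y inside. For fixed s and w the segment bound depends on
neither of them, and both the kernel and [0, 1] have mass one. -/
theorem lintegral_mollified_bound_le {H : V → ENNReal} (hH : Measurable H) (B : Set V)
    (φ : ContDiffBump (0 : V)) :
    ∫⁻ x in B, ∫⁻ y in B, (∫⁻ s in Icc (0 : ℝ) 1, (∫⁻ w, ENNReal.ofReal (φ.normed μ w) *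
        (H (y + s • (x - y) - w)) ^ 2 ∂μ)) ∂μ ∂μ
      ≤ 2 ^ Module.finrank ℝ V * μ B * ∫⁻ x, H x ^ 2 ∂μ := by
  have hφm : Measurable (φ.normed μ) := φ.continuous_normed.measurable
  have hone : ∫⁻ w, ENNReal.ofReal (φ.normed μ w) ∂μ = 1 := by
    rw [← ofReal_integral_eq_lintegral_ofReal φ.integrable_normed
      (ae_of_all _ φ.nonneg_normed), φ.integral_normed, ENNReal.ofReal_one]
  have hm2 : Measurable fun r : ((V × V) × ℝ) => ∫⁻ w, ENNReal.ofReal (φ.normed μ w) *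
        (H (r.1.2 + r.2 • (r.1.1 - r.1.2) - w)) ^ 2 ∂μ := by
    refine Measurable.lintegral_prod_right' (f := fun r : ((V × V) × ℝ) × V =>
      ENNReal.ofReal (φ.normed μ r.2) *
        (H (r.1.1.2 + r.1.2 • (r.1.1.1 - r.1.1.2) - r.2)) ^ 2) ?_
    fun_prop
  rw [lintegral_lintegral (f := fun x y => ∫⁻ s in Icc (0 : ℝ) 1, (∫⁻ w,
      ENNReal.ofReal (φ.normed μ w) * (H (y + s • (x - y) - w)) ^ 2 ∂μ))
    (measurable_mollified_bound (μ := μ) hH _ hφm).aemeasurable]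
  rw [lintegral_lintegral_swap hm2.aemeasurable]
  calc _ ≤ ∫⁻ s in Icc (0 : ℝ) 1, 2 ^ Module.finrank ℝ V * μ B * ∫⁻ x, H x ^ 2 ∂μ := by
        refine lintegral_mono fun s => ?_
        rw [lintegral_lintegral_swap (by fun_prop)]
        calc _ ≤ ∫⁻ w, ENNReal.ofReal (φ.normed μ w) *
              (2 ^ Module.finrank ℝ V * μ B * ∫⁻ x, H x ^ 2 ∂μ) ∂μ := by
              refine lintegral_mono fun w => ?_
              rw [lintegral_const_mul _ (by fun_prop)]
              gcongr
              rw [lintegral_prod _ (by fun_prop)]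
              exact lintegral_segment_le (hH.pow_const 2) B w
          _ = _ := by rw [lintegral_mul_const _ (by fun_prop), hone, one_mul]
    _ = _ := by simp

/-- Poincaré inequality in double integral form, for a weakly differentiable function on a convex
open set. -/
theorem lintegral_lintegral_sub_sq_le (hB : IsOpen B) (hBc : Convex ℝ B)
    (hψ : IntegrableOn ψ B μ)
    (hg : HasWeakGradient μ B ψ g) {H : V → ENNReal} (hH : Measurable H)
    (hgH : ∀ᵐ z ∂(μ.restrict B), ∀ x ∈ B, ∀ y ∈ B, ‖g z (x - y)‖ₑ ≤ H z) :
    ∫⁻ q, ‖ψ q.1 - ψ q.2‖ₑ ^ 2 ∂((μ.restrict B).prod (μ.restrict B))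
      ≤ 2 ^ Module.finrank ℝ V * μ B * ∫⁻ x in B, H x ^ 2 ∂μ := by
  -- The ratio of outer to inner radius stays equal to 2; a bounded ratio is what almost everywhere
  -- convergence of mollifications of a locally integrable function requires.
  let φ : ℕ → ContDiffBump (0 : V) := fun n =>
    ⟨1 / (n + 1 : ℝ) / 2, 1 / (n + 1 : ℝ), by positivity, by
      have : 0 < 1 / (n + 1 : ℝ) := by positivity
      linarith⟩
  have hrout : ∀ n, (φ n).rOut = 1 / (n + 1 : ℝ) := fun n => rfl
  have hlim : Tendsto (fun n => (φ n).rOut) atTop (𝓝 0) := tendsto_one_div_add_atTop_nhds_zero_nat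
  have hconv : ∀ᵐ x ∂μ, Tendsto (fun n => mollify μ B ψ (φ n) x) atTop (𝓝 (B.indicator ψ x)) :=
    ContDiffBump.ae_convolution_tendsto_right_of_locallyIntegrable hlim (K := 2)
      (Eventually.of_forall fun n => le_of_eq (by
        change 1 / (n + 1 : ℝ) = 2 * (1 / (n + 1 : ℝ) / 2); ring))
      (hψ.integrable_indicator hB.measurableSet).locallyIntegrable
  have hconvB : ∀ᵐ x ∂(μ.restrict B), Tendsto (fun n => mollify μ B ψ (φ n) x) atTop (𝓝 (ψ x)) := by
    rw [ae_restrict_iff' hB.measurableSet]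
    filter_upwards [hconv] with x hx hxB
    simpa [hxB] using hx
  have hballs : ∀ x ∈ B, ∀ᶠ n in atTop, Metric.closedBall x (φ n).rOut ⊆ B := by
    intro x hx
    obtain ⟨ε, hε, h⟩ := Metric.nhds_basis_closedBall.mem_iff.1 (hB.mem_nhds hx)
    filter_upwards [hlim.eventually (gt_mem_nhds hε)] with n hn
    exact (Metric.closedBall_subset_closedBall hn.le).trans h
  set G : ℕ → V × V → ENNReal := fun n q => ∫⁻ s in Icc (0 : ℝ) 1, ∫⁻ w,
    ENNReal.ofReal ((φ n).normed μ w) * (B.indicator H (q.2 + s • (q.1 - q.2) - w)) ^ 2 ∂μ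
  have hI : Measurable (B.indicator H) := hH.indicator hB.measurableSet
  have hGm : ∀ n, Measurable (G n) := fun n =>
    measurable_mollified_bound hI _ (φ n).continuous_normed.measurable
  -- The estimate for the mollifications holds at a given pair of points only for large n, depending
  -- on the pair; hence a lower limit and Fatou's lemma instead of a uniform bound.
  have hle : ∀ᵐ q ∂((μ.restrict B).prod (μ.restrict B)),
      ‖ψ q.1 - ψ q.2‖ₑ ^ 2 ≤ liminf (fun n => G n q) atTop := by
    filter_upwards [Measure.quasiMeasurePreserving_fst.ae hconvB,
      Measure.quasiMeasurePreserving_snd.ae hconvB,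
      Measure.quasiMeasurePreserving_fst.ae (ae_restrict_mem hB.measurableSet),
      Measure.quasiMeasurePreserving_snd.ae (ae_restrict_mem hB.measurableSet)] with q h1 h2 h3 h4
    have ht : Tendsto (fun n => ‖mollify μ B ψ (φ n) q.1 - mollify μ B ψ (φ n) q.2‖ₑ ^ 2) atTop
        (𝓝 (‖ψ q.1 - ψ q.2‖ₑ ^ 2)) := ENNReal.Tendsto.pow (h1.sub h2).enorm
    rw [← ht.liminf_eq]
    refine liminf_le_liminf ?_
    filter_upwards [hballs _ h3, hballs _ h4] with n hn3 hn4
    exact enorm_sub_mollify_sq_le hB hBc hψ hg hH hgH (φ n) hn3 hn4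
  calc _ ≤ ∫⁻ q, liminf (fun n => G n q) atTop ∂((μ.restrict B).prod (μ.restrict B)) :=
        lintegral_mono_ae hle
    _ ≤ liminf (fun n => ∫⁻ q, G n q ∂((μ.restrict B).prod (μ.restrict B))) atTop :=
        lintegral_liminf_le hGm
    _ ≤ liminf (fun _ : ℕ => 2 ^ Module.finrank ℝ V * μ B * ∫⁻ x in B, H x ^ 2 ∂μ) atTop := by
        refine liminf_le_liminf (Eventually.of_forall fun n => ?_)
        rw [lintegral_prod _ (hGm n).aemeasurable]
        refine (lintegral_mollified_bound_le hI B (φ n)).trans (le_of_eq ?_)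
        rw [← lintegral_indicator hB.measurableSet]
        congr! 2
        ext x
        by_cases hx : x ∈ B <;> simp [hx]
    _ = _ := by simp

/-- Duality form of the Poincaré inequality for a mean zero weight. -/
theorem enorm_integral_mul_sq_le (hB : IsOpen B) (hBc : Convex ℝ B) (hμB : μ B ≠ ⊤)
    (hψ : MemLp ψ 2 (μ.restrict B))
    (hg : HasWeakGradient μ B ψ g) {H : V → ENNReal} (hH : Measurable H)
    (hgH : ∀ᵐ z ∂(μ.restrict B), ∀ x ∈ B, ∀ y ∈ B, ‖g z (x - y)‖ₑ ≤ H z)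
    {r : V → ℝ} (hr : MemLp r 2 (μ.restrict B)) (hr0 : ∫ x in B, r x ∂μ = 0) :
    ‖∫ x in B, r x * ψ x ∂μ‖ₑ ^ 2 ≤
      2 ^ Module.finrank ℝ V * (∫⁻ x in B, ‖r x‖ₑ ^ 2 ∂μ) * ∫⁻ x in B, H x ^ 2 ∂μ := by
  rcases eq_or_ne (μ B) 0 with h0 | h0
  · simp [Measure.restrict_eq_zero.2 h0]
  set ν := μ.restrict B with hν
  have : IsFiniteMeasure ν := ⟨by simpa [hν] using hμB.lt_top⟩
  have hψ1 : Integrable ψ ν := hψ.integrable (by norm_num)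
  have hr1 : Integrable r ν := hr.integrable (by norm_num)
  have hrψ : Integrable (fun x => r x * ψ x) ν := hr.integrable_mul hψ
  -- Mean zero of `r` kills the term r(x) ψ(y), so ψ(x) can be replaced by ψ(x) − ψ(y); the free
  -- variable y contributes the factor μ(B).
  have hid : ∫ q, r q.1 * (ψ q.1 - ψ q.2) ∂(ν.prod ν) = (μ B).toReal * ∫ x, r x * ψ x ∂ν := by
    have i1 : Integrable (fun q : V × V => (r q.1 * ψ q.1) * 1) (ν.prod ν) :=
      hrψ.mul_prod (integrable_const (1 : ℝ))
    have i2 : Integrable (fun q : V × V => r q.1 * ψ q.2) (ν.prod ν) := hr1.mul_prod hψ1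
    have : ∀ q : V × V, r q.1 * (ψ q.1 - ψ q.2) = (r q.1 * ψ q.1) * 1 - r q.1 * ψ q.2 := by
      intro q; ring
    simp_rw [this]
    rw [integral_sub i1 i2, integral_prod_mul (fun x => r x * ψ x) (fun _ => (1 : ℝ)),
      integral_prod_mul, hr0]
    simp [hν, Measure.real, mul_comm]
  have hm1 : AEMeasurable (fun q : V × V => ‖r q.1‖ₑ) (ν.prod ν) :=
    (hr.1.comp_fst (ν := ν)).enorm
  have hm2 : AEMeasurable (fun q : V × V => ‖ψ q.1 - ψ q.2‖ₑ) (ν.prod ν) :=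
    ((hψ.1.comp_fst (ν := ν)).sub (hψ.1.comp_snd (μ := ν))).enorm
  have hcs := ENNReal.lintegral_mul_le_Lp_mul_Lq (ν.prod ν) Real.HolderConjugate.two_two hm1 hm2
  have hsq : (∫⁻ q, ‖r q.1‖ₑ * ‖ψ q.1 - ψ q.2‖ₑ ∂(ν.prod ν)) ^ 2 ≤
      (∫⁻ q, ‖r q.1‖ₑ ^ 2 ∂(ν.prod ν)) * ∫⁻ q, ‖ψ q.1 - ψ q.2‖ₑ ^ 2 ∂(ν.prod ν) := by
    simp only [Pi.mul_apply, ENNReal.rpow_two] at hcs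
    calc _ ≤ _ := pow_le_pow_left' hcs 2
      _ = _ := by
        rw [mul_pow, ← ENNReal.rpow_two, ← ENNReal.rpow_two, ← ENNReal.rpow_mul,
          ← ENNReal.rpow_mul]
        norm_num
  have hfst : ∫⁻ q, ‖r q.1‖ₑ ^ 2 ∂(ν.prod ν) = (∫⁻ x, ‖r x‖ₑ ^ 2 ∂ν) * μ B := by
    rw [lintegral_prod _ (hm1.pow_const 2)]
    simp only [lintegral_const]
    rw [lintegral_mul_const' _ _ (measure_ne_top _ _)]
    simp [hν]
  -- On the right one factor μ(B) comes from integrating ‖r‖² over the second variable and one from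
  -- the Poincaré inequality; they cancel against the square on the left.
  have hmain : (μ B) ^ 2 * ‖∫ x, r x * ψ x ∂ν‖ₑ ^ 2 ≤
      (μ B) ^ 2 * (2 ^ Module.finrank ℝ V * (∫⁻ x, ‖r x‖ₑ ^ 2 ∂ν) * ∫⁻ x, H x ^ 2 ∂ν) := by
    calc _ = ‖∫ q, r q.1 * (ψ q.1 - ψ q.2) ∂(ν.prod ν)‖ₑ ^ 2 := by
          rw [hid, enorm_mul, mul_pow, Real.enorm_of_nonneg ENNReal.toReal_nonneg,
            ENNReal.ofReal_toReal hμB]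
      _ ≤ (∫⁻ q, ‖r q.1 * (ψ q.1 - ψ q.2)‖ₑ ∂(ν.prod ν)) ^ 2 := by
          gcongr; exact enorm_integral_le_lintegral_enorm _
      _ ≤ _ := by simpa only [enorm_mul] using hsq
      _ ≤ ((∫⁻ x, ‖r x‖ₑ ^ 2 ∂ν) * μ B) *
          (2 ^ Module.finrank ℝ V * μ B * ∫⁻ x, H x ^ 2 ∂ν) := by
          rw [hfst]
          gcongr
          exact lintegral_lintegral_sub_sq_le hB hBc hψ1 hg hH hgH
      _ = _ := by ring
  exact (ENNReal.mul_le_mul_iff_right (pow_ne_zero 2 h0) (ENNReal.pow_ne_top hμB)).1 hmain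

end Poincare

/-! ### Elements and the decomposition of the slab into open boxes -/

namespace TwoPhase

open Filter Topology

variable {d : ℕ} {Ω : Set (Space d)} {a b : ℝ}

namespace Elem

/-- The interior of the element. -/
def box (E : Elem d) : Set (SpaceTime d) :=
  Ioo E.t₀ E.t₁ ×ˢ Set.pi univ (fun k => Ioo (E.lo k) (E.hi k))

theorem mem_box {E : Elem d} {y : SpaceTime d} :
    y ∈ E.box ↔ y.1 ∈ Ioo E.t₀ E.t₁ ∧ ∀ k, y.2 k ∈ Ioo (E.lo k) (E.hi k) := by
  simp [box]

theorem mem_carrier {E : Elem d} {y : SpaceTime d} :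
    y ∈ E.carrier ↔ y.1 ∈ Ioc E.t₀ E.t₁ ∧ ∀ k, y.2 k ∈ Ioc (E.lo k) (E.hi k) := by
  simp [carrier]

theorem isOpen_box (E : Elem d) : IsOpen E.box :=
  isOpen_Ioo.prod (isOpen_set_pi finite_univ fun _ _ => isOpen_Ioo)

theorem convex_box (E : Elem d) : Convex ℝ E.box :=
  (convex_Ioo _ _).prod (convex_pi fun _ _ => convex_Ioo _ _)

theorem measurableSet_box (E : Elem d) : MeasurableSet E.box := E.isOpen_box.measurableSet

theorem measurableSet_carrier (E : Elem d) : MeasurableSet E.carrier :=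
  measurableSet_Ioc.prod (MeasurableSet.univ_pi fun _ => measurableSet_Ioc)

theorem box_subset_carrier (E : Elem d) : E.box ⊆ E.carrier :=
  prod_mono Ioo_subset_Ioc_self (pi_mono fun _ _ => Ioo_subset_Ioc_self)

theorem box_ae_eq_carrier (E : Elem d) : E.box =ᵐ[volume] E.carrier :=
  Measure.set_prod_ae_eq Ioo_ae_eq_Ioc Measure.pi_Ioo_ae_eq_pi_Ioc

theorem box_ae_eq_closed (E : Elem d) :
    E.box =ᵐ[volume] (Ioc E.t₀ E.t₁ ×ˢ Icc E.lo E.hi : Set (SpaceTime d)) := by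
  rw [← pi_univ_Icc]
  exact Measure.set_prod_ae_eq Ioo_ae_eq_Ioc Measure.pi_Ioo_ae_eq_pi_Icc

theorem volume_box_ne_top (E : Elem d) : volume E.box ≠ ⊤ := by
  refine ne_top_of_le_ne_top ?_ (measure_mono
    (prod_mono Ioo_subset_Icc_self (pi_mono fun _ _ => Ioo_subset_Icc_self)))
  exact (isCompact_Icc.prod (isCompact_univ_pi fun _ => isCompact_Icc)).measure_lt_top.ne

theorem timeLength_pos (E : Elem d) : 0 < E.t₁ - E.t₀ := sub_pos.2 E.time_lt

end Elem

namespace Mesh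

variable (M : Mesh Ω a b)

theorem closedBox_subset (i : Fin M.N) :
    Ioc (M.elem i).t₀ (M.elem i).t₁ ×ˢ Icc (M.elem i).lo (M.elem i).hi ⊆
      Ioc a b ×ˢ closure Ω := by
  rw [← M.cover]
  exact subset_iUnion (fun i => Ioc (M.elem i).t₀ (M.elem i).t₁ ×ˢ
    Icc (M.elem i).lo (M.elem i).hi) i

theorem carrier_subset (i : Fin M.N) : (M.elem i).carrier ⊆ Ioc a b ×ˢ closure Ω := by
  refine Subset.trans ?_ (M.closedBox_subset i)
  rw [← pi_univ_Icc]
  exact prod_mono subset_rfl (pi_mono fun _ _ => Ioc_subset_Icc_self)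

/-- An open space-time set inside `(a, b] × closure Ω` lies in `(a, b) × Ω`. -/
theorem _root_.TwoPhase.subset_open_slab (hΩ : interior (closure Ω) = Ω)
    {U : Set (SpaceTime d)} (hU : IsOpen U) (h : U ⊆ Ioc a b ×ˢ closure Ω) :
    U ⊆ Ioo a b ×ˢ Ω := by
  have := interior_maximal h hU
  rwa [interior_prod_eq, interior_Ioc, hΩ] at this

theorem box_subset (hΩ : interior (closure Ω) = Ω) (i : Fin M.N) :
    (M.elem i).box ⊆ Ioo a b ×ˢ Ω :=
  subset_open_slab hΩ (M.elem i).isOpen_box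
    ((M.elem i).box_subset_carrier.trans (M.carrier_subset i))

theorem box_subset_slab (hΩ : interior (closure Ω) = Ω) (i : Fin M.N) :
    (M.elem i).box ⊆ slab Ω a b :=
  (M.box_subset hΩ i).trans (prod_mono Ioo_subset_Ioc_self subset_rfl)

/-- The closed boxes cover the slab and differ from the open ones by null sets. Conversely the open
boxes lie in the slab because `Ω` is the interior of its closure. -/
theorem slab_ae_eq (hΩ : interior (closure Ω) = Ω) :
    slab Ω a b =ᵐ[volume] ⋃ i, (M.elem i).box := by
  refine EventuallyLE.antisymm ?_ ?_
  · have h1 : slab Ω a b ⊆ ⋃ i, (Ioc (M.elem i).t₀ (M.elem i).t₁ ×ˢ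
        Icc (M.elem i).lo (M.elem i).hi) := by
      rw [M.cover]
      exact prod_mono subset_rfl subset_closure
    exact h1.eventuallyLE.trans
      (Filter.EventuallyEq.countable_iUnion fun i => (M.elem i).box_ae_eq_closed).symm.le
  · exact (iUnion_subset fun i => M.box_subset_slab hΩ i).eventuallyLE

theorem pairwise_disjoint_box : Pairwise (Function.onFun Disjoint fun i => (M.elem i).box) :=
  fun i j h => (M.disjoint i j h).mono (M.elem i).box_subset_carrier (M.elem j).box_subset_carrier

theorem setIntegral_slab (hΩ : interior (closure Ω) = Ω) {f : SpaceTime d → ℝ}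
    (hf : IntegrableOn f (slab Ω a b)) :
    ∫ y in slab Ω a b, f y = ∑ i, ∫ y in (M.elem i).box, f y := by
  rw [setIntegral_congr_set (M.slab_ae_eq hΩ)]
  exact integral_iUnion_fintype (fun i => (M.elem i).measurableSet_box) M.pairwise_disjoint_box
    fun i => hf.mono_set (M.box_subset_slab hΩ i)

theorem ae_slab_iff (hΩ : interior (closure Ω) = Ω) {p : SpaceTime d → Prop} :
    (∀ᵐ y ∂(volume.restrict (slab Ω a b)), p y) ↔
      ∀ i, ∀ᵐ y ∂(volume.restrict (M.elem i).box), p y := by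
  rw [Measure.restrict_congr_set (M.slab_ae_eq hΩ), ae_restrict_iUnion_iff]

theorem restrict_box_le (hΩ : interior (closure Ω) = Ω) (i : Fin M.N) :
    volume.restrict (M.elem i).box ≤ volume.restrict (slab Ω a b) :=
  Measure.restrict_mono (M.box_subset_slab hΩ i) le_rfl

/-- Finiteness is a consequence of the mesh: up to a null set the slab is a finite union of bounded
boxes. -/
theorem volume_slab_ne_top (M : Mesh Ω a b) (hΩ : interior (closure Ω) = Ω) :
    volume (slab Ω a b) ≠ ⊤ := by
  rw [measure_congr (M.slab_ae_eq hΩ)]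
  refine ne_top_of_le_ne_top ?_ (measure_iUnion_fintype_le _ _)
  exact (ENNReal.sum_lt_top.2 fun i _ => (M.elem i).volume_box_ne_top.lt_top).ne

theorem volume_domain_ne_top (M : Mesh Ω a b) (hab : a < b) (hΩ : interior (closure Ω) = Ω) :
    volume Ω ≠ ⊤ := by
  intro h
  apply M.volume_slab_ne_top hΩ
  rw [slab, Measure.volume_eq_prod, Measure.prod_prod, h, ENNReal.mul_top]
  simpa using hab

theorem time_bounds (hΩ : interior (closure Ω) = Ω) (i : Fin M.N) :
    a ≤ (M.elem i).t₀ ∧ (M.elem i).t₁ ≤ b := by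
  obtain ⟨x, hx⟩ : (Set.pi univ (fun k => Ioo ((M.elem i).lo k) ((M.elem i).hi k))).Nonempty :=
    univ_pi_nonempty_iff.2 fun k => nonempty_Ioo.2 ((M.elem i).space_lt k)
  have h : Ioo (M.elem i).t₀ (M.elem i).t₁ ⊆ Ioo a b := fun t ht =>
    (M.box_subset hΩ i (show (t, x) ∈ (M.elem i).box from ⟨ht, hx⟩)).1
  exact (Ioo_subset_Ioo_iff (M.elem i).time_lt).1 h

theorem restrict_slab_eq (Ω : Set (Space d)) (a b : ℝ) :
    (volume.restrict (slab Ω a b) : Measure (SpaceTime d)) =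
      (volume.restrict (Ioc a b)).prod (volume.restrict Ω) := by
  rw [slab, Measure.volume_eq_prod, Measure.prod_restrict]

theorem sum_indicator_carrier {V : Type*} [AddCommMonoid V] (F : Fin M.N → SpaceTime d → V)
    {i : Fin M.N} {y : SpaceTime d} (hy : y ∈ (M.elem i).carrier) :
    ∑ j, (M.elem j).carrier.indicator (F j) y = F i y := by
  rw [Finset.sum_eq_single i]
  · simp [hy]
  · intro j _ hj
    exact indicator_of_notMem (fun h => (M.disjoint j i hj).le_bot ⟨h, hy⟩) _
  · simp

theorem interp_eq {V : Type} [AddCommGroup V] [Module ℝ V] (f₀ : Space d → V)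
    (f : SpaceTime d → V) {i : Fin M.N} {y : SpaceTime d} (hy : y ∈ (M.elem i).carrier) :
    M.interp f₀ f y =
      ((y.1 - (M.elem i).t₀) / ((M.elem i).t₁ - (M.elem i).t₀)) •
        leftVal a f₀ f (M.elem i).t₁ y.2 +
      (((M.elem i).t₁ - y.1) / ((M.elem i).t₁ - (M.elem i).t₀)) •
        leftVal a f₀ f (M.elem i).t₀ y.2 :=
  M.sum_indicator_carrier (fun i z =>
      ((z.1 - (M.elem i).t₀) / ((M.elem i).t₁ - (M.elem i).t₀)) •
        leftVal a f₀ f (M.elem i).t₁ z.2 +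
      (((M.elem i).t₁ - z.1) / ((M.elem i).t₁ - (M.elem i).t₀)) •
        leftVal a f₀ f (M.elem i).t₀ z.2) hy

theorem scal_eq (w : Fin M.N → ℝ) {i : Fin M.N} {y : SpaceTime d}
    (hy : y ∈ (M.elem i).carrier) : M.scal w y = w i :=
  M.sum_indicator_carrier (fun i _ => w i) hy

end Mesh

end TwoPhase

namespace TwoPhase

open Filter Topology

/-! ### Smooth cutoffs -/

/-- A smooth cutoff function of the interval `(l, h)`. -/
def cut (n : ℕ) (l h t : ℝ) : ℝ :=
  Real.smoothTransition ((n + 1) * (t - l) - 1) * Real.smoothTransition ((n + 1) * (h - t) - 1)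

theorem contDiff_cut (n : ℕ) (l h : ℝ) : ContDiff ℝ ∞ (cut n l h) := by
  unfold cut
  exact (Real.smoothTransition.contDiff.comp (by fun_prop)).mul
    (Real.smoothTransition.contDiff.comp (by fun_prop))

theorem cut_nonneg (n : ℕ) (l h t : ℝ) : 0 ≤ cut n l h t :=
  mul_nonneg (Real.smoothTransition.nonneg _) (Real.smoothTransition.nonneg _)

theorem cut_le_one (n : ℕ) (l h t : ℝ) : cut n l h t ≤ 1 :=
  mul_le_one₀ (Real.smoothTransition.le_one _) (Real.smoothTransition.nonneg _)
    (Real.smoothTransition.le_one _)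

theorem abs_cut_le_one (n : ℕ) (l h t : ℝ) : |cut n l h t| ≤ 1 :=
  abs_le.2 ⟨by linarith [cut_nonneg n l h t], cut_le_one n l h t⟩

theorem cut_eq_zero {n : ℕ} {l h t : ℝ} (ht : t ∉ Ioo (l + 1 / (n + 1 : ℝ)) (h - 1 / (n + 1 : ℝ))) :
    cut n l h t = 0 := by
  have hn : (0 : ℝ) < n + 1 := by positivity
  rw [mem_Ioo, not_and_or, not_lt, not_lt] at ht
  rcases ht with ht | ht
  · rw [cut, Real.smoothTransition.zero_of_nonpos, zero_mul]
    rw [← sub_le_iff_le_add', le_div_iff₀ hn] at ht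
    linarith
  · rw [cut, Real.smoothTransition.zero_of_nonpos (x := (n + 1) * (h - t) - 1), mul_zero]
    have : h - t ≤ 1 / (n + 1 : ℝ) := by linarith
    rw [le_div_iff₀ hn] at this
    linarith

/-- The point t = h is excluded because every cutoff vanishes there, whereas the half-open interval
contains it. At t = l both sides are zero. -/
theorem tendsto_cut {l h t : ℝ} (ht : t ≠ h) :
    Tendsto (fun n => cut n l h t) atTop (𝓝 (if t ∈ Ioc l h then 1 else 0)) := by
  split_ifs with hm
  · have h1 : 0 < t - l := sub_pos.2 hm.1
    have h2 : 0 < h - t := sub_pos.2 (lt_of_le_of_ne hm.2 ht)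
    refine tendsto_const_nhds.congr' ?_
    obtain ⟨N, hN⟩ := exists_nat_gt (max (2 / (t - l)) (2 / (h - t)))
    filter_upwards [eventually_ge_atTop N] with n hn
    have hn' : (N : ℝ) ≤ n := by exact_mod_cast hn
    rw [max_lt_iff, div_lt_iff₀ h1, div_lt_iff₀ h2] at hN
    rw [cut, Real.smoothTransition.one_of_one_le, Real.smoothTransition.one_of_one_le, mul_one]
    · nlinarith [hN.2, mul_le_mul_of_nonneg_right hn' h2.le]
    · nlinarith [hN.1, mul_le_mul_of_nonneg_right hn' h1.le]
  · refine tendsto_const_nhds.congr fun n => (cut_eq_zero fun hc => hm ?_).symm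
    have : 0 < 1 / (n + 1 : ℝ) := by positivity
    exact ⟨by linarith [hc.1], by linarith [hc.2]⟩

/-- A smooth approximation of the function that is `0` on `(-∞, 0]`, `s` on `[0, 1]` and `1` on
`[1, ∞)`. -/
def ramp (n : ℕ) (s : ℝ) : ℝ := ∫ t in (0 : ℝ)..s, cut n 0 1 t

theorem hasDerivAt_ramp (n : ℕ) (s : ℝ) : HasDerivAt (ramp n) (cut n 0 1 s) s :=
  intervalIntegral.integral_hasDerivAt_right
    ((contDiff_cut n 0 1).continuous.intervalIntegrable _ _)
    ((contDiff_cut n 0 1).continuous.stronglyMeasurableAtFilter _ _)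
    (contDiff_cut n 0 1).continuous.continuousAt

theorem contDiff_ramp (n : ℕ) : ContDiff ℝ ∞ (ramp n) := by
  rw [contDiff_infty_iff_deriv]
  refine ⟨fun s => (hasDerivAt_ramp n s).differentiableAt, ?_⟩
  rw [show deriv (ramp n) = cut n 0 1 from funext fun s => (hasDerivAt_ramp n s).deriv]
  exact contDiff_cut n 0 1

theorem ramp_eq_zero {n : ℕ} {s : ℝ} (hs : s ≤ 1 / (n + 1 : ℝ)) : ramp n s = 0 := by
  have hn : 0 < 1 / (n + 1 : ℝ) := by positivity
  rw [ramp, intervalIntegral.integral_congr (g := fun _ => 0), intervalIntegral.integral_zero]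
  intro t ht
  refine cut_eq_zero fun h => ?_
  have h1 := ht.2
  have h2 := h.1
  have : max 0 s ≤ 1 / (n + 1 : ℝ) := max_le hn.le hs
  rw [zero_add] at h2
  exact absurd h2 (not_lt.2 (h1.trans this))

/-- The plateau value `ramp n 1` only tends to one. It suffices that it is the same for all ramps of
index n, so that differences of two ramps vanish exactly. -/
theorem ramp_eq_ramp_one {n : ℕ} {s : ℝ} (hs : 1 - 1 / (n + 1 : ℝ) ≤ s) :
    ramp n s = ramp n 1 := by
  have hn : 0 < 1 / (n + 1 : ℝ) := by positivity
  have hi := fun x y => (contDiff_cut n 0 1).continuous.intervalIntegrable (μ := volume) x y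
  rw [← sub_eq_zero, ramp, ramp, intervalIntegral.integral_interval_sub_left (hi _ _) (hi _ _),
    intervalIntegral.integral_congr (g := fun _ => 0), intervalIntegral.integral_zero]
  intro t ht
  refine cut_eq_zero fun h => ?_
  have h1 := ht.1
  have : 1 - 1 / (n + 1 : ℝ) ≤ min 1 s := le_min (by linarith) hs
  exact absurd h.2 (not_lt.2 (this.trans h1))

theorem abs_ramp_le_one (n : ℕ) (s : ℝ) : |ramp n s| ≤ 1 := by
  have hn : 0 < 1 / (n + 1 : ℝ) := by positivity
  have h : ∀ s : ℝ, |ramp n s| ≤ |s| := fun s => by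
    have := intervalIntegral.norm_integral_le_of_norm_le_const (a := 0) (b := s) (C := 1)
      (f := cut n 0 1) fun x _ => abs_cut_le_one n 0 1 x
    simpa [ramp] using this
  rcases le_total s 0 with h0 | h0
  · rw [ramp_eq_zero (by linarith)]; simp
  rcases le_total s 1 with h1 | h1
  · exact (h s).trans (by rwa [abs_of_nonneg h0])
  · rw [ramp_eq_ramp_one (by linarith)]; simpa using h 1

theorem tendsto_ramp {s : ℝ} (h0 : 0 ≤ s) (h1 : s ≤ 1) :
    Tendsto (fun n => ramp n s) atTop (𝓝 s) := by
  have h := intervalIntegral.tendsto_integral_filter_of_dominated_convergence (μ := volume)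
    (a := 0) (b := s) (F := fun n t => cut n 0 1 t) (f := fun _ => (1 : ℝ)) (l := atTop)
    (fun _ => 1) (Eventually.of_forall fun n =>
      (contDiff_cut n 0 1).continuous.aestronglyMeasurable)
    (Eventually.of_forall fun n => ae_of_all _ fun t _ => abs_cut_le_one n 0 1 t)
    (by simp) (by
      have : ∀ᵐ t : ℝ, t ≠ 1 := by simp [ae_iff]
      filter_upwards [this] with t ht hts
      rw [uIoc_of_le h0] at hts
      have := tendsto_cut (l := 0) ht
      rwa [if_pos ⟨hts.1, hts.2.trans h1⟩] at this)
  simpa [ramp] using h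

variable {d : ℕ} {Ω : Set (Space d)} {a b : ℝ}

/-! ### The Raviart-Thomas function of a face and its divergence -/

namespace Mesh

variable (M : Mesh Ω a b)

/-- Derivative of the hat function. -/
def hatDeriv (e : M.FaceIdx) (r : ℝ) : ℝ :=
  if r ∈ Ioc ((M.elem e.1).lo e.2.2) ((M.elem e.1).hi e.2.2) then
    1 / ((M.elem e.1).hi e.2.2 - (M.elem e.1).lo e.2.2)
  else if r ∈ Ioc ((M.elem e.2.1).lo e.2.2) ((M.elem e.2.1).hi e.2.2) then
    - (1 / ((M.elem e.2.1).hi e.2.2 - (M.elem e.2.1).lo e.2.2))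
  else 0

open Classical in
/-- The normal component of the Raviart-Thomas function of a face. -/
def faceHat (e : M.FaceIdx) (y : SpaceTime d) : ℝ :=
  if M.OverFace e y then M.hat e (y.2 e.2.2) else 0

open Classical in
/-- The divergence of the Raviart-Thomas function of a face. -/
def faceDiv (e : M.FaceIdx) (y : SpaceTime d) : ℝ :=
  if M.OverFace e y then M.hatDeriv e (y.2 e.2.2) else 0

theorem faceFun_eq (e : M.FaceIdx) (y : SpaceTime d) :
    M.faceFun e y = Pi.single e.2.2 (M.faceHat e y) := by
  unfold faceFun faceHat
  split_ifs <;> simp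

/-- `y` lies on no hyperplane spanned by a face of the mesh. -/
def Generic (y : SpaceTime d) : Prop :=
  ∀ i, y.1 ≠ (M.elem i).t₀ ∧ y.1 ≠ (M.elem i).t₁ ∧
    ∀ l, y.2 l ≠ (M.elem i).lo l ∧ y.2 l ≠ (M.elem i).hi l

/-- Off these finitely many null hyperplanes the hat functions are differentiable and the smooth
cutoffs converge to the half-open indicators. -/
theorem ae_generic : ∀ᵐ y : SpaceTime d, M.Generic y := by
  have h1 : ∀ c : ℝ, ∀ᵐ y : SpaceTime d, y.1 ≠ c := fun c =>
    Measure.quasiMeasurePreserving_fst.ae (p := fun t : ℝ => t ≠ c) (by simp [ae_iff])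
  have h2 : ∀ (l : Fin d) (c : ℝ), ∀ᵐ y : SpaceTime d, y.2 l ≠ c := fun l c =>
    Measure.quasiMeasurePreserving_snd.ae (p := fun x : Space d => x l ≠ c)
      (Measure.ae_eval_ne (μ := fun _ : Fin d => (volume : Measure ℝ)) l c)
  unfold Generic
  rw [ae_all_iff]
  intro i
  refine (h1 _).and ((h1 _).and ?_)
  rw [ae_all_iff]
  exact fun l => (h2 l _).and (h2 l _)

theorem space_pos (i : Fin M.N) (k : Fin d) : 0 < (M.elem i).hi k - (M.elem i).lo k :=
  sub_pos.2 ((M.elem i).space_lt k)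

theorem abs_hat_le_one (e : M.FaceIdx) (r : ℝ) : |M.hat e r| ≤ 1 := by
  unfold hat
  split_ifs with h1 h2
  · rw [abs_of_nonneg (div_nonneg (by linarith [h1.1]) (M.space_pos _ _).le),
      div_le_one (M.space_pos _ _)]
    linarith [h1.2]
  · rw [abs_of_nonneg (div_nonneg (by linarith [h2.2]) (M.space_pos _ _).le),
      div_le_one (M.space_pos _ _)]
    linarith [h2.1]
  · simp

/-- A bound for the derivative of the hat function. -/
def hatSlope (e : M.FaceIdx) : ℝ :=
  1 / ((M.elem e.1).hi e.2.2 - (M.elem e.1).lo e.2.2) +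
    1 / ((M.elem e.2.1).hi e.2.2 - (M.elem e.2.1).lo e.2.2)

theorem hatSlope_nonneg (e : M.FaceIdx) : 0 ≤ M.hatSlope e :=
  add_nonneg (one_div_nonneg.2 (M.space_pos _ _).le) (one_div_nonneg.2 (M.space_pos _ _).le)

theorem abs_hatDeriv_le (e : M.FaceIdx) (r : ℝ) : |M.hatDeriv e r| ≤ M.hatSlope e := by
  have h1 := one_div_nonneg.2 (M.space_pos e.1 e.2.2).le
  have h2 := one_div_nonneg.2 (M.space_pos e.2.1 e.2.2).le
  unfold hatDeriv hatSlope
  split_ifs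
  · rw [abs_of_nonneg h1]; linarith
  · rw [abs_neg, abs_of_nonneg h2]; linarith
  · simp only [abs_zero]; linarith

theorem hasDerivAt_hat (e : M.FaceIdx) {r : ℝ}
    (h1 : r ≠ (M.elem e.1).lo e.2.2) (h2 : r ≠ (M.elem e.1).hi e.2.2)
    (h3 : r ≠ (M.elem e.2.1).lo e.2.2) (h4 : r ≠ (M.elem e.2.1).hi e.2.2) :
    HasDerivAt (M.hat e) (M.hatDeriv e r) r := by
  -- Away from the endpoints, membership in the half-open interval is locally constant, so the hat
  -- function agrees near r with a single affine branch.
  have key : ∀ l h : ℝ, r ≠ l → r ≠ h →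
      ∀ᶠ s in 𝓝 r, (s ∈ Ioc l h ↔ r ∈ Ioc l h) := by
    intro l h hl hh
    rcases lt_or_gt_of_ne hl with h1 | h1
    · filter_upwards [gt_mem_nhds h1] with s hs
      exact ⟨fun h => absurd h.1 (not_lt.2 hs.le), fun h => absurd h.1 (not_lt.2 h1.le)⟩
    rcases lt_or_gt_of_ne hh with h2 | h2
    · filter_upwards [lt_mem_nhds h1, gt_mem_nhds h2] with s hs hs'
      exact ⟨fun _ => ⟨h1, h2.le⟩, fun _ => ⟨hs, hs'.le⟩⟩
    · filter_upwards [lt_mem_nhds h2] with s hs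
      exact ⟨fun h => absurd h.2 (not_le.2 hs), fun h => absurd h.2 (not_le.2 h2)⟩
  have e1 := key _ _ h1 h2
  have e2 := key _ _ h3 h4
  unfold hatDeriv
  split_ifs with c1 c2
  · have : HasDerivAt (fun s => (s - (M.elem e.1).lo e.2.2) /
        ((M.elem e.1).hi e.2.2 - (M.elem e.1).lo e.2.2))
        (1 / ((M.elem e.1).hi e.2.2 - (M.elem e.1).lo e.2.2)) r :=
      ((hasDerivAt_id r).sub_const _).div_const _
    refine this.congr_of_eventuallyEq ?_
    filter_upwards [e1] with s hs
    simp [hat, hs.2 c1]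
  · have : HasDerivAt (fun s => ((M.elem e.2.1).hi e.2.2 - s) /
        ((M.elem e.2.1).hi e.2.2 - (M.elem e.2.1).lo e.2.2))
        (- (1 / ((M.elem e.2.1).hi e.2.2 - (M.elem e.2.1).lo e.2.2))) r := by
      have := ((hasDerivAt_id r).const_sub ((M.elem e.2.1).hi e.2.2)).div_const
        ((M.elem e.2.1).hi e.2.2 - (M.elem e.2.1).lo e.2.2)
      rwa [neg_div] at this
    refine this.congr_of_eventuallyEq ?_
    filter_upwards [e1, e2] with s hs hs'
    simp only [hat]
    rw [if_neg (fun h => c1 (hs.1 h)), if_pos (hs'.2 c2)]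
  · refine (hasDerivAt_const r (0 : ℝ)).congr_of_eventuallyEq ?_
    filter_upwards [e1, e2] with s hs hs'
    simp only [hat]
    rw [if_neg (fun h => c1 (hs.1 h)), if_neg (fun h => c2 (hs'.1 h))]

theorem measurableSet_overFace (e : M.FaceIdx) : MeasurableSet {y | M.OverFace e y} := by
  have : {y | M.OverFace e y} =
      Prod.fst ⁻¹' Ioc (max (M.elem e.1).t₀ (M.elem e.2.1).t₀)
        (min (M.elem e.1).t₁ (M.elem e.2.1).t₁) ∩
      ⋂ l, ⋂ (_ : l ≠ e.2.2), (fun y : SpaceTime d => y.2 l) ⁻¹'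
        Ioc (max ((M.elem e.1).lo l) ((M.elem e.2.1).lo l))
        (min ((M.elem e.1).hi l) ((M.elem e.2.1).hi l)) := by
    ext y; simp [OverFace]
  rw [this]
  exact (measurable_fst measurableSet_Ioc).inter <|
    MeasurableSet.iInter fun l => MeasurableSet.iInter fun _ =>
      (measurable_pi_apply l).comp measurable_snd measurableSet_Ioc

theorem measurable_hat (e : M.FaceIdx) : Measurable (M.hat e) :=
  Measurable.ite measurableSet_Ioc (by fun_prop)
    (Measurable.ite measurableSet_Ioc (by fun_prop) measurable_const)

theorem measurable_hatDeriv (e : M.FaceIdx) : Measurable (M.hatDeriv e) :=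
  Measurable.ite measurableSet_Ioc measurable_const
    (Measurable.ite measurableSet_Ioc measurable_const measurable_const)

theorem measurable_faceHat (e : M.FaceIdx) : Measurable (M.faceHat e) :=
  Measurable.ite (M.measurableSet_overFace e)
    ((M.measurable_hat e).comp ((measurable_pi_apply _).comp measurable_snd)) measurable_const

theorem measurable_faceDiv (e : M.FaceIdx) : Measurable (M.faceDiv e) :=
  Measurable.ite (M.measurableSet_overFace e)
    ((M.measurable_hatDeriv e).comp ((measurable_pi_apply _).comp measurable_snd)) measurable_const

theorem abs_faceHat_le_one (e : M.FaceIdx) (y : SpaceTime d) : |M.faceHat e y| ≤ 1 := by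
  unfold faceHat
  split_ifs
  · exact M.abs_hat_le_one e _
  · simp

theorem abs_faceDiv_le (e : M.FaceIdx) (y : SpaceTime d) : |M.faceDiv e y| ≤ M.hatSlope e := by
  unfold faceDiv
  split_ifs
  · exact M.abs_hatDeriv_le e _
  · simpa using M.hatSlope_nonneg e

/-! ### Smooth approximations of the Raviart-Thomas functions -/

/-- Smooth approximation of the hat function. -/
def hatApprox (e : M.FaceIdx) (n : ℕ) (r : ℝ) : ℝ :=
  ramp n ((r - (M.elem e.1).lo e.2.2) / ((M.elem e.1).hi e.2.2 - (M.elem e.1).lo e.2.2)) -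
  ramp n ((r - (M.elem e.2.1).lo e.2.2) / ((M.elem e.2.1).hi e.2.2 - (M.elem e.2.1).lo e.2.2))

/-- Derivative of the smooth approximation of the hat function. -/
def hatApproxDeriv (e : M.FaceIdx) (n : ℕ) (r : ℝ) : ℝ :=
  cut n 0 1 ((r - (M.elem e.1).lo e.2.2) / ((M.elem e.1).hi e.2.2 - (M.elem e.1).lo e.2.2)) *
    (1 / ((M.elem e.1).hi e.2.2 - (M.elem e.1).lo e.2.2)) -
  cut n 0 1 ((r - (M.elem e.2.1).lo e.2.2) / ((M.elem e.2.1).hi e.2.2 - (M.elem e.2.1).lo e.2.2)) *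
    (1 / ((M.elem e.2.1).hi e.2.2 - (M.elem e.2.1).lo e.2.2))

theorem hasDerivAt_hatApprox (e : M.FaceIdx) (n : ℕ) (r : ℝ) :
    HasDerivAt (M.hatApprox e n) (M.hatApproxDeriv e n r) r := by
  have h : ∀ l c : ℝ, HasDerivAt (fun r => ramp n ((r - l) / c))
      (cut n 0 1 ((r - l) / c) * (1 / c)) r := fun l c =>
    (hasDerivAt_ramp n _).comp r (((hasDerivAt_id r).sub_const l).div_const c)
  exact (h _ _).sub (h _ _)

theorem contDiff_hatApprox (e : M.FaceIdx) (n : ℕ) : ContDiff ℝ ∞ (M.hatApprox e n) :=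
  ((contDiff_ramp n).comp (by fun_prop)).sub ((contDiff_ramp n).comp (by fun_prop))

theorem abs_hatApprox_le (e : M.FaceIdx) (n : ℕ) (r : ℝ) : |M.hatApprox e n r| ≤ 2 := by
  refine (abs_sub _ _).trans ?_
  linarith [abs_ramp_le_one n ((r - (M.elem e.1).lo e.2.2) /
      ((M.elem e.1).hi e.2.2 - (M.elem e.1).lo e.2.2)),
    abs_ramp_le_one n ((r - (M.elem e.2.1).lo e.2.2) /
      ((M.elem e.2.1).hi e.2.2 - (M.elem e.2.1).lo e.2.2))]

theorem abs_hatApproxDeriv_le (e : M.FaceIdx) (n : ℕ) (r : ℝ) :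
    |M.hatApproxDeriv e n r| ≤ M.hatSlope e := by
  refine (abs_sub _ _).trans ?_
  rw [abs_mul, abs_mul, abs_of_nonneg (one_div_nonneg.2 (M.space_pos e.1 e.2.2).le),
    abs_of_nonneg (one_div_nonneg.2 (M.space_pos e.2.1 e.2.2).le)]
  exact add_le_add
    (mul_le_of_le_one_left (one_div_nonneg.2 (M.space_pos _ _).le) (abs_cut_le_one _ _ _ _))
    (mul_le_of_le_one_left (one_div_nonneg.2 (M.space_pos _ _).le) (abs_cut_le_one _ _ _ _))

section face

variable {M} {e : M.FaceIdx}

theorem tendsto_hatApproxDeriv (he : M.IsFace e) {r : ℝ}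
    (h2 : r ≠ (M.elem e.1).hi e.2.2)
    (h4 : r ≠ (M.elem e.2.1).hi e.2.2) :
    Tendsto (fun n => M.hatApproxDeriv e n r) atTop (𝓝 (M.hatDeriv e r)) := by
  have key : ∀ i : Fin M.N, r ≠ (M.elem i).hi e.2.2 → Tendsto (fun n => cut n 0 1
      ((r - (M.elem i).lo e.2.2) / ((M.elem i).hi e.2.2 - (M.elem i).lo e.2.2)) *
      (1 / ((M.elem i).hi e.2.2 - (M.elem i).lo e.2.2))) atTop
      (𝓝 (if r ∈ Ioc ((M.elem i).lo e.2.2) ((M.elem i).hi e.2.2) then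
        1 / ((M.elem i).hi e.2.2 - (M.elem i).lo e.2.2) else 0)) := by
    intro i hi
    have hp := M.space_pos i e.2.2
    have := (tendsto_cut (l := 0) (h := 1) (t := (r - (M.elem i).lo e.2.2) /
      ((M.elem i).hi e.2.2 - (M.elem i).lo e.2.2)) (by
        rw [Ne, div_eq_one_iff_eq hp.ne', sub_left_inj]; exact hi)).mul_const
      (1 / ((M.elem i).hi e.2.2 - (M.elem i).lo e.2.2))
    convert this using 2
    rw [ite_mul, one_mul, zero_mul]
    congr 1
    rw [mem_Ioc, mem_Ioc, div_pos_iff_of_pos_right hp, div_le_one hp, sub_pos, sub_le_sub_iff_right]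
  refine Eq.subst (motive := fun c => Tendsto _ atTop (𝓝 c)) ?_ ((key e.1 h2).sub (key e.2.1 h4))
  unfold hatDeriv
  -- The two intervals only meet end to end, so the difference of their indicators agrees with the
  -- nested conditional.
  have := he.1
  split_ifs with c1 c2 c2
  · exact absurd c2.1 (not_lt.2 (this ▸ c1.2))
  · simp
  · simp
  · simp

/-- The hat function is the difference of two ramps, one rising across the lower element and one
across the upper; the second starts where the first ends because the two faces coincide. -/
theorem tendsto_hatApprox (he : M.IsFace e) {r : ℝ} :
    Tendsto (fun n => M.hatApprox e n r) atTop (𝓝 (M.hat e r)) := by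
  have hface := he.1
  have hp1 := M.space_pos e.1 e.2.2
  have hp2 := M.space_pos e.2.1 e.2.2
  have hn : ∀ n : ℕ, 0 < 1 / (n + 1 : ℝ) := fun n => by positivity
  have hlow : ∀ s : ℝ, s ≤ 0 → Tendsto (fun n => ramp n s) atTop (𝓝 0) := fun s hs =>
    tendsto_const_nhds.congr fun n => (ramp_eq_zero (hs.trans (hn n).le)).symm
  have hhigh : ∀ s : ℝ, 1 ≤ s → Tendsto (fun n => ramp n s) atTop (𝓝 1) := fun s hs =>
    (tendsto_ramp zero_le_one le_rfl).congr fun n =>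
      (ramp_eq_ramp_one (by linarith [hn n])).symm
  unfold hat hatApprox
  split_ifs with c1 c2
  · have := (tendsto_ramp (s := (r - (M.elem e.1).lo e.2.2) /
      ((M.elem e.1).hi e.2.2 - (M.elem e.1).lo e.2.2))
      (div_nonneg (by linarith [c1.1]) hp1.le) ((div_le_one hp1).2 (by linarith [c1.2]))).sub
      (hlow ((r - (M.elem e.2.1).lo e.2.2) / ((M.elem e.2.1).hi e.2.2 - (M.elem e.2.1).lo e.2.2))
        (div_nonpos_of_nonpos_of_nonneg (by linarith [c1.2]) hp2.le))
    simpa using this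
  · have := (hhigh ((r - (M.elem e.1).lo e.2.2) /
      ((M.elem e.1).hi e.2.2 - (M.elem e.1).lo e.2.2)) ((one_le_div hp1).2 (by
        linarith [c2.1]))).sub (tendsto_ramp (s := (r - (M.elem e.2.1).lo e.2.2) /
      ((M.elem e.2.1).hi e.2.2 - (M.elem e.2.1).lo e.2.2))
      (div_nonneg (by linarith [c2.1]) hp2.le) ((div_le_one hp2).2 (by linarith [c2.2])))
    convert this using 2
    field_simp
    ring
  · rcases le_or_gt r ((M.elem e.1).lo e.2.2) with h | h
    · simpa using (hlow ((r - (M.elem e.1).lo e.2.2) /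
        ((M.elem e.1).hi e.2.2 - (M.elem e.1).lo e.2.2))
        (div_nonpos_of_nonpos_of_nonneg (by linarith) hp1.le)).sub
        (hlow ((r - (M.elem e.2.1).lo e.2.2) /
        ((M.elem e.2.1).hi e.2.2 - (M.elem e.2.1).lo e.2.2))
        (div_nonpos_of_nonpos_of_nonneg (by linarith) hp2.le))
    · have h' : (M.elem e.1).hi e.2.2 < r := not_le.1 fun h2 => c1 ⟨h, h2⟩
      have h'' : (M.elem e.2.1).hi e.2.2 < r := not_le.1 fun h2 => c2 ⟨hface ▸ h', h2⟩
      simpa using (hhigh ((r - (M.elem e.1).lo e.2.2) /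
        ((M.elem e.1).hi e.2.2 - (M.elem e.1).lo e.2.2)) ((one_le_div hp1).2 (by linarith))).sub
        (hhigh ((r - (M.elem e.2.1).lo e.2.2) /
        ((M.elem e.2.1).hi e.2.2 - (M.elem e.2.1).lo e.2.2)) ((one_le_div hp2).2 (by linarith)))

/-- Below the interval both ramps vanish, above it both sit on the same plateau. This makes the
support compact inside the two elements. -/
theorem hatApprox_eq_zero (he : M.IsFace e) {n : ℕ} {r : ℝ}
    (hr : r ∉ Ioo ((M.elem e.1).lo e.2.2 +
        ((M.elem e.1).hi e.2.2 - (M.elem e.1).lo e.2.2) * (1 / (n + 1 : ℝ)))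
      ((M.elem e.2.1).hi e.2.2 -
        ((M.elem e.2.1).hi e.2.2 - (M.elem e.2.1).lo e.2.2) * (1 / (n + 1 : ℝ)))) :
    M.hatApprox e n r = 0 := by
  have hface := he.1
  have hp1 := M.space_pos e.1 e.2.2
  have hp2 := M.space_pos e.2.1 e.2.2
  have hn : 0 < 1 / (n + 1 : ℝ) := by positivity
  have hn1 : 1 / (n + 1 : ℝ) ≤ 1 := by
    rw [div_le_one (by positivity)]
    linarith [(Nat.cast_nonneg n : (0 : ℝ) ≤ n)]
  rw [mem_Ioo, not_and_or, not_lt, not_lt] at hr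
  unfold hatApprox
  rcases hr with hr | hr
  · rw [ramp_eq_zero ((div_le_iff₀ hp1).2 (by linarith)), ramp_eq_zero, sub_zero]
    rw [div_le_iff₀ hp2]
    nlinarith
  · rw [ramp_eq_ramp_one (n := n) ((le_div_iff₀ hp1).2 (by nlinarith)),
      ramp_eq_ramp_one (n := n) ((le_div_iff₀ hp2).2 (by nlinarith)), sub_self]

end face

/-- Smooth approximation of the indicator function of the set of points over a face. -/
def faceCut (e : M.FaceIdx) (n : ℕ) (y : SpaceTime d) : ℝ :=
  cut n (max (M.elem e.1).t₀ (M.elem e.2.1).t₀) (min (M.elem e.1).t₁ (M.elem e.2.1).t₁) y.1 *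
    ∏ l ∈ Finset.univ.erase e.2.2, cut n (max ((M.elem e.1).lo l) ((M.elem e.2.1).lo l))
      (min ((M.elem e.1).hi l) ((M.elem e.2.1).hi l)) (y.2 l)

theorem abs_faceCut_le (e : M.FaceIdx) (n : ℕ) (y : SpaceTime d) : |M.faceCut e n y| ≤ 1 := by
  rw [faceCut, abs_mul, Finset.abs_prod]
  exact mul_le_one₀ (abs_cut_le_one _ _ _ _) (Finset.prod_nonneg fun _ _ => abs_nonneg _)
    (Finset.prod_le_one (fun _ _ => abs_nonneg _) fun _ _ => abs_cut_le_one _ _ _ _)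

theorem contDiff_faceCut (e : M.FaceIdx) (n : ℕ) : ContDiff ℝ ∞ (M.faceCut e n) := by
  refine ((contDiff_cut _ _ _).comp contDiff_fst).mul (contDiff_prod fun l _ => ?_)
  exact (contDiff_cut _ _ _).comp ((contDiff_apply ℝ ℝ l).comp contDiff_snd)

open Classical in
theorem tendsto_faceCut (e : M.FaceIdx) {y : SpaceTime d} (hy : M.Generic y) :
    Tendsto (fun n => M.faceCut e n y) atTop (𝓝 (if M.OverFace e y then 1 else 0)) := by
  have h1 : y.1 ≠ min (M.elem e.1).t₁ (M.elem e.2.1).t₁ := by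
    rcases min_choice (M.elem e.1).t₁ (M.elem e.2.1).t₁ with h | h <;> rw [h]
    exacts [(hy _).2.1, (hy _).2.1]
  have h2 : ∀ l, y.2 l ≠ min ((M.elem e.1).hi l) ((M.elem e.2.1).hi l) := fun l => by
    rcases min_choice ((M.elem e.1).hi l) ((M.elem e.2.1).hi l) with h | h <;> rw [h]
    exacts [((hy _).2.2 l).2, ((hy _).2.2 l).2]
  have := (tendsto_cut (l := max (M.elem e.1).t₀ (M.elem e.2.1).t₀) h1).mul
    (tendsto_finsetProd (Finset.univ.erase e.2.2) fun l _ =>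
      tendsto_cut (l := max ((M.elem e.1).lo l) ((M.elem e.2.1).lo l)) (h2 l))
  refine Eq.subst (motive := fun c => Tendsto _ atTop (𝓝 c)) ?_ this
  rw [Finset.prod_ite_zero, Finset.prod_const_one, ite_mul, one_mul, zero_mul, ← ite_and]
  simp only [OverFace, Finset.mem_erase, Finset.mem_univ, and_true]
  congr

/-- The cutoff does not involve the normal variable, so the normal derivative of the product falls
on the hat factor alone. -/
theorem faceCut_add_dirX (e : M.FaceIdx) (n : ℕ) (y : SpaceTime d) (s : ℝ) :
    M.faceCut e n (y + s • dirX e.2.2) = M.faceCut e n y := by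
  unfold faceCut
  congr 1
  · simp [dirX]
  · refine Finset.prod_congr rfl fun l hl => ?_
    simp [dirX, Finset.ne_of_mem_erase hl]

/-- Smooth approximation of the normal component of the Raviart-Thomas function of a face. -/
def faceApprox (e : M.FaceIdx) (n : ℕ) (y : SpaceTime d) : ℝ :=
  M.faceCut e n y * M.hatApprox e n (y.2 e.2.2)

theorem contDiff_faceApprox (e : M.FaceIdx) (n : ℕ) : ContDiff ℝ ∞ (M.faceApprox e n) :=
  (M.contDiff_faceCut e n).mul
    ((M.contDiff_hatApprox e n).comp ((contDiff_apply ℝ ℝ _).comp contDiff_snd))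

theorem fderiv_faceApprox (e : M.FaceIdx) (n : ℕ) (y : SpaceTime d) :
    fderiv ℝ (M.faceApprox e n) y (dirX e.2.2) =
      M.faceCut e n y * M.hatApproxDeriv e n (y.2 e.2.2) := by
  have h1 : HasFDerivAt (M.faceApprox e n) (fderiv ℝ (M.faceApprox e n) y)
      (y + (0 : ℝ) • dirX e.2.2) := by
    rw [zero_smul, add_zero]
    exact ((M.contDiff_faceApprox e n).differentiable (by simp) y).hasFDerivAt
  have h2 : HasDerivAt (fun s : ℝ => y + s • dirX e.2.2) (dirX e.2.2) (0 : ℝ) := by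
    simpa using ((hasDerivAt_id (0 : ℝ)).smul_const (dirX e.2.2)).const_add y
  have h3 := h1.comp_hasDerivAt 0 h2
  have h4 : HasDerivAt (fun s : ℝ => M.faceCut e n y * M.hatApprox e n (y.2 e.2.2 + s))
      (M.faceCut e n y * M.hatApproxDeriv e n (y.2 e.2.2)) 0 := by
    have := (M.hasDerivAt_hatApprox e n (y.2 e.2.2 + 0)).comp_const_add (y.2 e.2.2) 0
    rw [add_zero] at this
    exact this.const_mul _
  refine h3.unique (h4.congr_of_eventuallyEq (Eventually.of_forall fun s => ?_))
  simp only [Function.comp, faceApprox, faceCut_add_dirX]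
  simp [dirX]

/-- The open box over a face, of the two adjacent sub-boxes. -/
def faceBox (e : M.FaceIdx) : Set (SpaceTime d) :=
  Ioo (max (M.elem e.1).t₀ (M.elem e.2.1).t₀) (min (M.elem e.1).t₁ (M.elem e.2.1).t₁) ×ˢ
    Set.pi univ (fun l => if l = e.2.2 then Ioo ((M.elem e.1).lo l) ((M.elem e.2.1).hi l) else
      Ioo (max ((M.elem e.1).lo l) ((M.elem e.2.1).lo l))
        (min ((M.elem e.1).hi l) ((M.elem e.2.1).hi l)))

/-- This is where the absence of faces on ∂Ω enters: the box over an interior face is an open set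
covered by the two adjacent elements, and an open subset of (a, b] × closure `Ω` lies in (a, b) ×
`Ω`. -/
theorem faceBox_subset (hΩ : interior (closure Ω) = Ω) {e : M.FaceIdx} (he : M.IsFace e) :
    M.faceBox e ⊆ Ioo a b ×ˢ Ω := by
  refine subset_open_slab hΩ (isOpen_Ioo.prod (isOpen_set_pi finite_univ fun l _ => ?_)) ?_
  · split_ifs <;> exact isOpen_Ioo
  rintro y ⟨hy1, hy2⟩
  have hk := hy2 e.2.2 trivial
  simp only [if_true] at hk
  rw [mem_Ioo, max_lt_iff, lt_min_iff] at hy1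
  have hl : ∀ l, l ≠ e.2.2 → y.2 l ∈ Ioo (max ((M.elem e.1).lo l) ((M.elem e.2.1).lo l))
        (min ((M.elem e.1).hi l) ((M.elem e.2.1).hi l)) := fun l hl => by
    have := hy2 l trivial
    simpa only [if_neg hl] using this
  simp only [mem_Ioo, max_lt_iff, lt_min_iff] at hl
  rcases le_or_gt (y.2 e.2.2) ((M.elem e.1).hi e.2.2) with h | h
  · refine M.carrier_subset e.1 (Elem.mem_carrier.2 ⟨⟨hy1.1.1, hy1.2.1.le⟩, fun l => ?_⟩)
    by_cases hle : l = e.2.2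
    · subst hle
      exact ⟨hk.1, h⟩
    · exact ⟨(hl l hle).1.1, (hl l hle).2.1.le⟩
  · refine M.carrier_subset e.2.1 (Elem.mem_carrier.2 ⟨⟨hy1.1.2, hy1.2.2.le⟩, fun l => ?_⟩)
    by_cases hle : l = e.2.2
    · subst hle
      exact ⟨he.1 ▸ h, hk.2.le⟩
    · exact ⟨(hl l hle).1.2, (hl l hle).2.2.le⟩

theorem exists_compact_faceApprox {e : M.FaceIdx} (he : M.IsFace e) (n : ℕ) :
    ∃ K : Set (SpaceTime d), IsCompact K ∧ K ⊆ M.faceBox e ∧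
      Function.support (M.faceApprox e n) ⊆ K := by
  have hn : 0 < 1 / (n + 1 : ℝ) := by positivity
  have hp1 := mul_pos (M.space_pos e.1 e.2.2) hn
  have hp2 := mul_pos (M.space_pos e.2.1 e.2.2) hn
  refine ⟨Icc (max (M.elem e.1).t₀ (M.elem e.2.1).t₀ + 1 / (n + 1 : ℝ))
      (min (M.elem e.1).t₁ (M.elem e.2.1).t₁ - 1 / (n + 1 : ℝ)) ×ˢ
    Set.pi univ (fun l => if l = e.2.2 then
      Icc ((M.elem e.1).lo l + ((M.elem e.1).hi l - (M.elem e.1).lo l) * (1 / (n + 1 : ℝ)))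
        ((M.elem e.2.1).hi l - ((M.elem e.2.1).hi l - (M.elem e.2.1).lo l) * (1 / (n + 1 : ℝ)))
      else Icc (max ((M.elem e.1).lo l) ((M.elem e.2.1).lo l) + 1 / (n + 1 : ℝ))
        (min ((M.elem e.1).hi l) ((M.elem e.2.1).hi l) - 1 / (n + 1 : ℝ))),
    isCompact_Icc.prod (isCompact_univ_pi fun l => ?_), prod_mono ?_ (pi_mono fun l _ => ?_), ?_⟩
  · split_ifs <;> exact isCompact_Icc
  · exact Icc_subset_Ioo (by linarith) (by linarith)
  · split_ifs with h
    · subst h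
      exact Icc_subset_Ioo (by linarith) (by linarith)
    · exact Icc_subset_Ioo (by linarith) (by linarith)
  · intro y hy
    have hy' : M.faceCut e n y * M.hatApprox e n (y.2 e.2.2) ≠ 0 := hy
    have hc := left_ne_zero_of_mul hy'
    have hh := right_ne_zero_of_mul hy'
    refine ⟨Ioo_subset_Icc_self (not_not.1 fun h => left_ne_zero_of_mul hc (cut_eq_zero h)),
      fun l _ => ?_⟩
    beta_reduce
    split_ifs with h
    · subst h
      exact Ioo_subset_Icc_self (not_not.1 fun h => hh (hatApprox_eq_zero he h))
    · have := Finset.prod_ne_zero_iff.1 (right_ne_zero_of_mul hc) l (by simp [h])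
      exact Ioo_subset_Icc_self (not_not.1 fun h => this (cut_eq_zero h))

/-- The weak derivative identity tested with a Raviart-Thomas function. -/
theorem integral_mul_faceDiv (hΩ : interior (closure Ω) = Ω) {e : M.FaceIdx} (he : M.IsFace e)
    {f g : SpaceTime d → ℝ} (hf : IntegrableOn f (slab Ω a b)) (hg : IntegrableOn g (slab Ω a b))
    (hfg : HasWeakDeriv Ω a b (dirX e.2.2) f g) :
    ∫ y in slab Ω a b, f y * M.faceDiv e y = - ∫ y in slab Ω a b, g y * M.faceHat e y := by
  have hgen : ∀ᵐ y ∂(volume.restrict (slab Ω a b)), M.Generic y := ae_restrict_of_ae M.ae_generic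
  -- Only the normal derivative is tested. The derivatives of the cutoff in time and in the
  -- tangential directions, which grow with n, never appear, and the bounds needed for dominated
  -- convergence are uniform in n.
  have heq : ∀ n, ∫ y in slab Ω a b, f y * (M.faceCut e n y * M.hatApproxDeriv e n (y.2 e.2.2)) =
      - ∫ y in slab Ω a b, g y * M.faceApprox e n y := by
    intro n
    obtain ⟨K, hK, hKb, hs⟩ := M.exists_compact_faceApprox he n
    have hts : tsupport (M.faceApprox e n) ⊆ K := closure_minimal hs hK.isClosed
    have := hfg (M.faceApprox e n) (M.contDiff_faceApprox e n)
      (hK.of_isClosed_subset (isClosed_tsupport _) hts)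
      (hts.trans (hKb.trans (M.faceBox_subset hΩ he)))
    simpa only [M.fderiv_faceApprox e n] using this
  have hsnd : Measurable fun y : SpaceTime d => y.2 e.2.2 :=
    (measurable_pi_apply _).comp measurable_snd
  have hmd : ∀ n, Measurable (fun y : SpaceTime d => M.hatApproxDeriv e n (y.2 e.2.2)) := fun n => by
    have : Continuous (M.hatApproxDeriv e n) := by
      have := (contDiff_cut n 0 1).continuous
      unfold hatApproxDeriv
      fun_prop
    exact this.measurable.comp hsnd
  have hlim1 : Tendsto (fun n => ∫ y in slab Ω a b,
      f y * (M.faceCut e n y * M.hatApproxDeriv e n (y.2 e.2.2))) atTop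
      (𝓝 (∫ y in slab Ω a b, f y * M.faceDiv e y)) := by
    refine tendsto_integral_of_dominated_convergence (fun y => ‖f y‖ * M.hatSlope e)
      (fun n => hf.1.mul ((M.contDiff_faceCut e n).continuous.measurable.mul
        (hmd n)).aestronglyMeasurable) (hf.norm.mul_const _) (fun n => ae_of_all _ fun y => ?_) ?_
    · rw [norm_mul, norm_mul]
      gcongr
      exact (mul_le_of_le_one_left (norm_nonneg _) (M.abs_faceCut_le e n y)).trans
        (M.abs_hatApproxDeriv_le e n _)
    · filter_upwards [hgen] with y hy
      refine Tendsto.const_mul _ ?_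
      have := (M.tendsto_faceCut e hy).mul
        (tendsto_hatApproxDeriv he ((hy e.1).2.2 _).2 ((hy e.2.1).2.2 _).2)
      simpa [faceDiv] using this
  have hlim2 : Tendsto (fun n => ∫ y in slab Ω a b, g y * M.faceApprox e n y) atTop
      (𝓝 (∫ y in slab Ω a b, g y * M.faceHat e y)) := by
    refine tendsto_integral_of_dominated_convergence (fun y => ‖g y‖ * 2)
      (fun n => hg.1.mul (M.contDiff_faceApprox e n).continuous.aestronglyMeasurable)
      (hg.norm.mul_const _) (fun n => ae_of_all _ fun y => ?_) ?_
    · rw [norm_mul, faceApprox, norm_mul]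
      gcongr
      exact (mul_le_of_le_one_left (norm_nonneg _) (M.abs_faceCut_le e n y)).trans
        (M.abs_hatApprox_le e n _)
    · filter_upwards [hgen] with y hy
      refine Tendsto.const_mul _ ?_
      have := (M.tendsto_faceCut e hy).mul (tendsto_hatApprox he (r := y.2 e.2.2))
      simpa [faceHat, faceApprox] using this
  simp_rw [heq] at hlim1
  exact tendsto_nhds_unique hlim1 hlim2.neg

/-! ### Fields of the enhanced velocity space -/

theorem vel_apply (U : M.FaceIdx → ℝ) (y : SpaceTime d) (k : Fin d) :
    M.vel U y k = ∑ e ∈ M.faces, if k = e.2.2 then U e * M.faceHat e y else 0 := by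
  simp [vel, Finset.sum_apply, faceFun_eq, Pi.single_apply]

-- Moving a point in direction k does not change whether it lies over a face normal to k, so each
-- summand is a constant or a multiple of a hat function of the moving coordinate.
open Classical in
theorem divX_vel (U : M.FaceIdx → ℝ) {y : SpaceTime d} (hy : M.Generic y) :
    divX (M.vel U) y = ∑ e ∈ M.faces, U e * M.faceDiv e y := by
  have hover : ∀ (e : M.FaceIdx) (r : ℝ), M.OverFace e (y.1, Function.update y.2 e.2.2 r) ↔
      M.OverFace e y := by
    intro e r
    refine and_congr_right fun _ => forall_congr' fun l => imp_congr_right fun hl => ?_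
    simp [Function.update_of_ne hl]
  have hhat : ∀ (e : M.FaceIdx) (r : ℝ), M.faceHat e (y.1, Function.update y.2 e.2.2 r) =
      if M.OverFace e y then M.hat e r else 0 := by
    intro e r
    unfold faceHat
    by_cases ho : M.OverFace e y
    · rw [if_pos ho, if_pos ((hover e r).2 ho)]
      simp
    · rw [if_neg ho, if_neg fun h => ho ((hover e r).1 h)]
  have hder : ∀ k, HasDerivAt (fun r => M.vel U (y.1, Function.update y.2 k r) k)
      (∑ e ∈ M.faces, if k = e.2.2 then U e * M.faceDiv e y else 0) (y.2 k) := by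
    intro k
    simp_rw [vel_apply]
    refine HasDerivAt.fun_sum fun e _ => ?_
    by_cases hk : k = e.2.2
    · subst hk
      simp only [if_true]
      refine HasDerivAt.const_mul _ ?_
      simp_rw [hhat]
      unfold faceDiv
      split_ifs
      · exact M.hasDerivAt_hat e ((hy _).2.2 _).1 ((hy _).2.2 _).2 ((hy _).2.2 _).1
          ((hy _).2.2 _).2
      · exact hasDerivAt_const _ _
    · simp only [hk, if_false]
      exact hasDerivAt_const _ _
  unfold divX
  simp_rw [fun k => (hder k).deriv]
  rw [Finset.sum_comm]
  simp

theorem measurable_vel (U : M.FaceIdx → ℝ) (k : Fin d) : Measurable fun y => M.vel U y k := by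
  simp_rw [vel_apply]
  refine Finset.measurable_fun_sum _ fun e _ => ?_
  split_ifs
  · exact (M.measurable_faceHat e).const_mul _
  · exact measurable_const

theorem abs_vel_le (U : M.FaceIdx → ℝ) (y : SpaceTime d) (k : Fin d) :
    |M.vel U y k| ≤ ∑ e ∈ M.faces, |U e| := by
  rw [vel_apply]
  refine (Finset.abs_sum_le_sum_abs _ _).trans (Finset.sum_le_sum fun e _ => ?_)
  split_ifs
  · rw [abs_mul]
    exact mul_le_of_le_one_right (abs_nonneg _) (M.abs_faceHat_le_one e y)
  · simp

theorem memL2_divX_vel (hΩ : interior (closure Ω) = Ω) (U : M.FaceIdx → ℝ) :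
    MemL2 Ω a b (divX (M.vel U)) := by
  have : IsFiniteMeasure (volume.restrict (slab Ω a b)) :=
    ⟨by simpa using (M.volume_slab_ne_top hΩ).lt_top⟩
  have h : MemL2 Ω a b (fun y => ∑ e ∈ M.faces, U e * M.faceDiv e y) :=
    memLp_finsetSum _ fun e _ => (MemLp.of_bound (M.measurable_faceDiv e).aestronglyMeasurable
      _ (ae_of_all _ (M.abs_faceDiv_le e))).const_mul _
  refine h.ae_eq (ae_restrict_of_ae ?_)
  filter_upwards [M.ae_generic] with y hy
  exact (M.divX_vel U hy).symm

theorem memL2_vel (hΩ : interior (closure Ω) = Ω) (U : M.FaceIdx → ℝ) (k : Fin d) :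
    MemL2 Ω a b (fun y => M.vel U y k) := by
  have : IsFiniteMeasure (volume.restrict (slab Ω a b)) :=
    ⟨by simpa using (M.volume_slab_ne_top hΩ).lt_top⟩
  exact MemLp.of_bound (M.measurable_vel U k).aestronglyMeasurable _
    (ae_of_all _ fun y => M.abs_vel_le U y k)

/-- Green's formula: fields of the enhanced velocity space have no normal trace on `∂Ω`, and the
elementwise divergence is their weak divergence. -/
theorem hasDivNoFlow_vel (hΩ : interior (closure Ω) = Ω) (U : M.FaceIdx → ℝ) :
    HasDivNoFlow Ω a b (M.vel U) (divX (M.vel U)) where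
  u_mem := M.memL2_vel hΩ U
  div_mem := M.memL2_divX_vel hΩ U
  green ψ := by
    have : IsFiniteMeasure (volume.restrict (slab Ω a b)) :=
      ⟨by simpa using (M.volume_slab_ne_top hΩ).lt_top⟩
    have hval : IntegrableOn ψ.val (slab Ω a b) := ψ.val_mem.integrable (by norm_num)
    have hgrad : ∀ k, IntegrableOn (fun y => ψ.grad y k) (slab Ω a b) := fun k =>
      (ψ.grad_mem k).integrable (by norm_num)
    have hpt : ∀ᵐ y ∂(volume.restrict (slab Ω a b)),
        M.vel U y ⬝ᵥ ψ.grad y + divX (M.vel U) y * ψ.val y =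
        ∑ e ∈ M.faces, U e * (ψ.grad y e.2.2 * M.faceHat e y + ψ.val y * M.faceDiv e y) := by
      refine ae_restrict_of_ae ?_
      filter_upwards [M.ae_generic] with y hy
      rw [M.divX_vel U hy]
      simp only [dotProduct, vel_apply, Finset.sum_mul, ite_mul, zero_mul]
      rw [Finset.sum_comm]
      simp only [Finset.sum_ite_eq', Finset.mem_univ, if_true]
      rw [← Finset.sum_add_distrib]
      exact Finset.sum_congr rfl fun e _ => by ring
    have i1 : ∀ e : M.FaceIdx, IntegrableOn (fun y => ψ.grad y e.2.2 * M.faceHat e y)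
        (slab Ω a b) := fun e =>
      (hgrad _).mul_bdd (c := 1) (M.measurable_faceHat e).aestronglyMeasurable
        (ae_of_all _ (M.abs_faceHat_le_one e))
    have i2 : ∀ e : M.FaceIdx, IntegrableOn (fun y => ψ.val y * M.faceDiv e y)
        (slab Ω a b) := fun e =>
      hval.mul_bdd (M.measurable_faceDiv e).aestronglyMeasurable
        (ae_of_all _ (M.abs_faceDiv_le e))
    have i3 : ∀ e : M.FaceIdx, IntegrableOn
        (fun y => U e * (ψ.grad y e.2.2 * M.faceHat e y + ψ.val y * M.faceDiv e y))
        (slab Ω a b) := fun e => ((i1 e).add (i2 e)).const_mul _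
    rw [integral_congr_ae hpt, integral_finsetSum _ fun e _ => i3 e]
    refine Finset.sum_eq_zero fun e he => ?_
    have hface : M.IsFace e := by simpa [faces] using he
    rw [integral_const_mul, integral_add (i1 e) (i2 e),
      M.integral_mul_faceDiv hΩ hface hval (hgrad _) (ψ.grad_weak _), add_neg_cancel, mul_zero]

end Mesh

end TwoPhase

/-! ### Positive definite matrices -/

section MatrixFacts

variable {n : Type*} [Fintype n] {K : Matrix n n ℝ} {k₀ : ℝ}

theorem dotProduct_self_nonneg_real (v : n → ℝ) : 0 ≤ v ⬝ᵥ v :=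
  Finset.sum_nonneg fun _ _ => mul_self_nonneg _

variable {α : Type*} [MeasurableSpace α] {μ : Measure α}

theorem aestronglyMeasurable_dotProduct_mulVec {A : α → Matrix n n ℝ}
    (hA : ∀ i j, AEStronglyMeasurable (fun x => A x i j) μ) {v w : α → n → ℝ}
    (hv : ∀ i, AEStronglyMeasurable (fun x => v x i) μ)
    (hw : ∀ i, AEStronglyMeasurable (fun x => w x i) μ) :
    AEStronglyMeasurable (fun x => v x ⬝ᵥ (A x *ᵥ w x)) μ := by
  simp only [dotProduct, Matrix.mulVec]
  exact Finset.aestronglyMeasurable_fun_sum _ fun i _ => (hv i).mul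
    (Finset.aestronglyMeasurable_fun_sum _ fun j _ => (hA i j).mul (hw j))

theorem integrable_dotProduct {v w : α → n → ℝ}
    (hv : ∀ i, MemLp (fun x => v x i) 2 μ) (hw : ∀ i, MemLp (fun x => w x i) 2 μ) :
    Integrable (fun x => v x ⬝ᵥ w x) μ :=
  integrable_finsetSum _ fun i _ => (hv i).integrable_mul (hw i)

variable [DecidableEq n]

theorem isUnit_of_coercive (hk : 0 < k₀) (hK : ∀ ξ : n → ℝ, k₀ * (ξ ⬝ᵥ ξ) ≤ ξ ⬝ᵥ (K *ᵥ ξ)) :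
    IsUnit K := by
  rw [← Matrix.mulVec_injective_iff_isUnit, ← Matrix.coe_mulVecLin,
    ← LinearMap.ker_eq_bot, LinearMap.ker_eq_bot']
  intro ξ hξ
  rw [Matrix.mulVecLin_apply] at hξ
  have h := hK ξ
  rw [hξ, dotProduct_zero] at h
  have : ξ ⬝ᵥ ξ = 0 := le_antisymm (by nlinarith) (dotProduct_self_nonneg_real ξ)
  exact dotProduct_self_eq_zero.1 this

theorem mulVec_inv_mulVec_of_coercive (hk : 0 < k₀)
    (hK : ∀ ξ : n → ℝ, k₀ * (ξ ⬝ᵥ ξ) ≤ ξ ⬝ᵥ (K *ᵥ ξ)) (v : n → ℝ) : K *ᵥ (K⁻¹ *ᵥ v) = v := by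
  rw [Matrix.mulVec_mulVec, Matrix.mul_nonsing_inv _
    ((Matrix.isUnit_iff_isUnit_det _).1 (isUnit_of_coercive hk hK)), Matrix.one_mulVec]

/-- This is the quadratic form of K at s K⁻¹v − w, expanded; symmetry of K turns the mixed terms
into v·w. No square root of K is needed. -/
theorem quadratic_inv_nonneg (hk : 0 < k₀) (hs : K.IsSymm)
    (hK : ∀ ξ : n → ℝ, k₀ * (ξ ⬝ᵥ ξ) ≤ ξ ⬝ᵥ (K *ᵥ ξ)) (v w : n → ℝ) (s : ℝ) :
    0 ≤ (v ⬝ᵥ (K⁻¹ *ᵥ v)) * (s * s) + (-2 * (v ⬝ᵥ w)) * s + w ⬝ᵥ (K *ᵥ w) := by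
  have hz := mulVec_inv_mulVec_of_coercive hk hK v
  set z := K⁻¹ *ᵥ v
  have h := (mul_nonneg hk.le (dotProduct_self_nonneg_real (s • z - w))).trans (hK (s • z - w))
  have hsym : z ⬝ᵥ (K *ᵥ w) = v ⬝ᵥ w := by
    rw [Matrix.dotProduct_mulVec, ← Matrix.mulVec_transpose, hs.eq, hz]
  simp only [Matrix.mulVec_sub, Matrix.mulVec_smul, hz, sub_dotProduct, dotProduct_sub,
    smul_dotProduct, dotProduct_smul, smul_eq_mul, hsym] at h
  rw [dotProduct_comm w v, dotProduct_comm z v] at h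
  linarith

theorem dotProduct_inv_mulVec_nonneg (hk : 0 < k₀)
    (hK : ∀ ξ : n → ℝ, k₀ * (ξ ⬝ᵥ ξ) ≤ ξ ⬝ᵥ (K *ᵥ ξ)) (v : n → ℝ) : 0 ≤ v ⬝ᵥ (K⁻¹ *ᵥ v) := by
  have h := hK (K⁻¹ *ᵥ v)
  rw [mulVec_inv_mulVec_of_coercive hk hK, dotProduct_comm _ v] at h
  exact (mul_nonneg hk.le (dotProduct_self_nonneg_real _)).trans h

/-- With z = K⁻¹v, coercivity reads k₀ z·z ≤ v·z; combine it with (v − k₀z)·(v − k₀z) ≥ 0. -/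
theorem dotProduct_inv_mulVec_le (hk : 0 < k₀)
    (hK : ∀ ξ : n → ℝ, k₀ * (ξ ⬝ᵥ ξ) ≤ ξ ⬝ᵥ (K *ᵥ ξ)) (v : n → ℝ) :
    v ⬝ᵥ (K⁻¹ *ᵥ v) ≤ k₀⁻¹ * (v ⬝ᵥ v) := by
  have h := hK (K⁻¹ *ᵥ v)
  rw [mulVec_inv_mulVec_of_coercive hk hK] at h
  set z := K⁻¹ *ᵥ v
  have h2 := dotProduct_self_nonneg_real (v - k₀ • z)
  simp only [sub_dotProduct, dotProduct_sub, smul_dotProduct, dotProduct_smul, smul_eq_mul] at h2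
  rw [dotProduct_comm z v] at h h2
  rw [inv_mul_eq_div, le_div_iff₀ hk]
  nlinarith

theorem aestronglyMeasurable_det {A : α → Matrix n n ℝ}
    (hA : ∀ i j, AEStronglyMeasurable (fun x => A x i j) μ) :
    AEStronglyMeasurable (fun x => (A x).det) μ := by
  simp_rw [Matrix.det_apply']
  exact Finset.aestronglyMeasurable_fun_sum _ fun σ _ =>
    (Finset.aestronglyMeasurable_fun_prod _ fun i _ => hA _ _).const_mul _

/-- Cramer's rule: the entries of the inverse are cofactors divided by the determinant. -/
theorem aestronglyMeasurable_inv_apply {A : α → Matrix n n ℝ}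
    (hA : ∀ i j, AEStronglyMeasurable (fun x => A x i j) μ) (i j : n) :
    AEStronglyMeasurable (fun x => (A x)⁻¹ i j) μ := by
  simp_rw [Matrix.inv_def, Matrix.smul_apply, Ring.inverse_eq_inv', Matrix.adjugate_apply,
    smul_eq_mul]
  have h1 := (aestronglyMeasurable_det hA).aemeasurable.inv.aestronglyMeasurable
  refine h1.mul (aestronglyMeasurable_det fun i' j' => ?_)
  by_cases h : i' = j
  · subst h
    simpa using aestronglyMeasurable_const
  · simpa [Matrix.updateRow_ne h] using hA i' j'

theorem integrable_inv_quadratic (hk : 0 < k₀) {A : α → Matrix n n ℝ}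
    (hA : ∀ i j, AEStronglyMeasurable (fun x => A x i j) μ)
    (hc : ∀ᵐ x ∂μ, ∀ ξ : n → ℝ, k₀ * (ξ ⬝ᵥ ξ) ≤ ξ ⬝ᵥ (A x *ᵥ ξ)) {v : α → n → ℝ}
    (hv : ∀ i, MemLp (fun x => v x i) 2 μ) :
    Integrable (fun x => v x ⬝ᵥ ((A x)⁻¹ *ᵥ v x)) μ := by
  refine Integrable.mono' ((integrable_dotProduct hv hv).const_mul k₀⁻¹)
    (aestronglyMeasurable_dotProduct_mulVec (aestronglyMeasurable_inv_apply hA)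
      (fun i => (hv i).1) fun i => (hv i).1) ?_
  filter_upwards [hc] with x hx
  rw [Real.norm_of_nonneg (dotProduct_inv_mulVec_nonneg hk hx _)]
  exact dotProduct_inv_mulVec_le hk hx _

/-- A nonnegative quadratic polynomial has nonpositive discriminant. It is applied to the integral
of the pointwise polynomial in s. -/
theorem abs_le_sqrt_mul_sqrt_of_quadratic {A B I : ℝ} (hA : 0 ≤ A)
    (h : ∀ s : ℝ, 0 ≤ A * (s * s) + (-2 * I) * s + B) : |I| ≤ √A * √B := by
  have := discrim_le_zero h
  rw [discrim] at this
  rw [← Real.sqrt_mul hA]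
  exact Real.abs_le_sqrt (by nlinarith)

/-- Cauchy-Schwarz inequality for dual weighted norms. -/
theorem abs_integral_dotProduct_le (hk : 0 < k₀) {A : α → Matrix n n ℝ}
    (hA : ∀ i j, AEStronglyMeasurable (fun x => A x i j) μ)
    (hs : ∀ᵐ x ∂μ, (A x).IsSymm)
    (hc : ∀ᵐ x ∂μ, ∀ ξ : n → ℝ, k₀ * (ξ ⬝ᵥ ξ) ≤ ξ ⬝ᵥ (A x *ᵥ ξ)) {v w : α → n → ℝ}
    (hv : ∀ i, MemLp (fun x => v x i) 2 μ) (hw : ∀ i, MemLp (fun x => w x i) 2 μ)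
    (hwA : Integrable (fun x => w x ⬝ᵥ (A x *ᵥ w x)) μ) :
    |∫ x, v x ⬝ᵥ w x ∂μ| ≤
      √(∫ x, v x ⬝ᵥ ((A x)⁻¹ *ᵥ v x) ∂μ) * √(∫ x, w x ⬝ᵥ (A x *ᵥ w x) ∂μ) := by
  have i1 := integrable_inv_quadratic hk hA hc hv
  have i2 := integrable_dotProduct hv hw
  refine abs_le_sqrt_mul_sqrt_of_quadratic (integral_nonneg_of_ae ?_) fun s => ?_
  · filter_upwards [hc] with x hx using dotProduct_inv_mulVec_nonneg hk hx _
  · have j1 : Integrable (fun x => (v x ⬝ᵥ ((A x)⁻¹ *ᵥ v x)) * (s * s)) μ := i1.mul_const _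
    have j2 : Integrable (fun x => (-2 * (v x ⬝ᵥ w x)) * s) μ := (i2.const_mul _).mul_const _
    have j3 : Integrable (fun x => (v x ⬝ᵥ ((A x)⁻¹ *ᵥ v x)) * (s * s) +
      (-2 * (v x ⬝ᵥ w x)) * s) μ := j1.add j2
    have : 0 ≤ ∫ x, ((v x ⬝ᵥ ((A x)⁻¹ *ᵥ v x)) * (s * s) + (-2 * (v x ⬝ᵥ w x)) * s +
        w x ⬝ᵥ (A x *ᵥ w x)) ∂μ := by
      refine integral_nonneg_of_ae ?_
      filter_upwards [hs, hc] with x h1 h2 using quadratic_inv_nonneg hk h1 h2 _ _ s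
    rwa [integral_add j3 hwA, integral_add j1 j2, integral_mul_const, integral_mul_const,
      integral_const_mul] at this

end MatrixFacts

namespace TwoPhase

open Filter Topology

variable {d : ℕ} {Ω : Set (Space d)} {a b : ℝ}

/-! ### Square integrability of the discrete functions -/

theorem memL2_comp_snd {f : Space d → ℝ} (hf : MemLp f 2 (volume.restrict Ω)) :
    MemL2 Ω a b (fun y => f y.2) := by
  unfold MemL2
  rw [Mesh.restrict_slab_eq]
  exact hf.comp_snd _

theorem aestronglyMeasurable_comp_snd {f : Space d → ℝ}
    (hf : AEStronglyMeasurable f (volume.restrict Ω)) :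
    AEStronglyMeasurable (fun y : SpaceTime d => f y.2) (volume.restrict (slab Ω a b)) := by
  rw [Mesh.restrict_slab_eq]
  exact hf.comp_snd

namespace Mesh

variable (M : Mesh Ω a b)

theorem memL2_of_box (hΩ : interior (closure Ω) = Ω) {f : SpaceTime d → ℝ}
    (g : Fin M.N → SpaceTime d → ℝ) (hg : ∀ i, MemL2 Ω a b (g i))
    (hfg : ∀ i, ∀ y ∈ (M.elem i).box, f y = g i y) : MemL2 Ω a b f := by
  have h : MemL2 Ω a b (fun y => ∑ i, (M.elem i).carrier.indicator (g i) y) :=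
    memLp_finsetSum _ fun i _ => (hg i).indicator (M.elem i).measurableSet_carrier
  refine h.ae_eq ((M.ae_slab_iff hΩ).2 fun i => ?_)
  filter_upwards [ae_restrict_mem (M.elem i).measurableSet_box] with y hy
  rw [M.sum_indicator_carrier g ((M.elem i).box_subset_carrier hy), hfg i y hy]

theorem measurable_scal (w : Fin M.N → ℝ) : Measurable (M.scal w) :=
  Finset.measurable_fun_sum _ fun i _ =>
    measurable_const.indicator (M.elem i).measurableSet_carrier

theorem abs_scal_le (w : Fin M.N → ℝ) (y : SpaceTime d) : |M.scal w y| ≤ ∑ i, |w i| := by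
  refine (Finset.abs_sum_le_sum_abs _ _).trans (Finset.sum_le_sum fun i _ => ?_)
  by_cases h : y ∈ (M.elem i).carrier <;> simp [h]

theorem memLp_leftVal (M : Mesh Ω a b) (hab : a < b) (hΩ : interior (closure Ω) = Ω)
    {f₀ : Space d → ℝ} {f : SpaceTime d → ℝ} (hf₀ : MemLp f₀ 2 (volume.restrict Ω))
    (hf : Measurable f) {C : ℝ} (hC : ∀ y, |f y| ≤ C) (τ : ℝ) :
    MemLp (leftVal a f₀ f τ) 2 (volume.restrict Ω) := by
  have : IsFiniteMeasure (volume.restrict Ω) :=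
    ⟨by simpa using (M.volume_domain_ne_top hab hΩ).lt_top⟩
  unfold leftVal
  by_cases h : τ = a
  · simpa [h] using hf₀
  · simp only [h, if_false]
    exact MemLp.of_bound (hf.comp measurable_prodMk_left).aestronglyMeasurable C
      (ae_of_all _ fun x => hC _)

theorem memL2_interp (hab : a < b) (hΩ : interior (closure Ω) = Ω) {f₀ : Space d → ℝ}
    {f : SpaceTime d → ℝ} (hf₀ : MemLp f₀ 2 (volume.restrict Ω)) (hf : Measurable f)
    {C : ℝ} (hC : ∀ y, |f y| ≤ C) : MemL2 Ω a b (M.interp f₀ f) := by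
  have hleft := M.memLp_leftVal hab hΩ hf₀ hf hC
  -- The interpolation weights lie in [0, 1] only on their own element. Clamping makes them bounded
  -- on the whole slab without changing them on the element.
  have hcut : ∀ (c : ℝ → ℝ) (_ : Measurable c) (τ : ℝ),
      MemL2 Ω a b (fun y => max 0 (min 1 (c y.1)) * leftVal a f₀ f τ y.2) := fun c hc τ => by
    refine (memL2_comp_snd (hleft τ)).mul' (p := ⊤) (memLp_top_of_bound
      (measurable_const.max (measurable_const.min
        (hc.comp measurable_fst))).aestronglyMeasurable 1 (ae_of_all _ fun y => ?_))
    rw [Real.norm_of_nonneg (le_max_left _ _)]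
    exact max_le zero_le_one (min_le_left _ _)
  refine M.memL2_of_box hΩ (fun i y =>
    max 0 (min 1 ((y.1 - (M.elem i).t₀) / ((M.elem i).t₁ - (M.elem i).t₀))) *
      leftVal a f₀ f (M.elem i).t₁ y.2 +
    max 0 (min 1 (((M.elem i).t₁ - y.1) / ((M.elem i).t₁ - (M.elem i).t₀))) *
      leftVal a f₀ f (M.elem i).t₀ y.2) (fun i =>
        (hcut (fun t => (t - (M.elem i).t₀) / ((M.elem i).t₁ - (M.elem i).t₀))
          (by fun_prop) _).add
        (hcut (fun t => ((M.elem i).t₁ - t) / ((M.elem i).t₁ - (M.elem i).t₀))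
          (by fun_prop) _)) fun i y hy => ?_
  have ht := (Elem.mem_box.1 hy).1
  have hp := (M.elem i).timeLength_pos
  rw [M.interp_eq f₀ f ((M.elem i).box_subset_carrier hy)]
  simp only [smul_eq_mul]
  rw [min_eq_right, max_eq_right, min_eq_right, max_eq_right]
  · exact div_nonneg (by linarith [ht.2]) hp.le
  · rw [div_le_one hp]; linarith [ht.1]
  · exact div_nonneg (by linarith [ht.1]) hp.le
  · rw [div_le_one hp]; linarith [ht.2]

theorem interp_apply (f₀ : Space d → Fin d → ℝ) (f : SpaceTime d → Fin d → ℝ)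
    (y : SpaceTime d) (k : Fin d) :
    M.interp f₀ f y k = M.interp (fun x => f₀ x k) (fun z => f z k) y := by
  unfold interp
  rw [Finset.sum_apply]
  refine Finset.sum_congr rfl fun i _ => ?_
  by_cases h : y ∈ (M.elem i).carrier
  · have : ∀ τ, leftVal a f₀ f τ y.2 k = leftVal a (fun x => f₀ x k) (fun z => f z k) τ y.2 := by
      intro τ
      unfold leftVal
      split_ifs <;> rfl
    simp [h, this]
  · simp [h]

end Mesh

section Scheme

variable {P : FlowData d Ω a b} {M : Mesh Ω a b} (S : DiscreteState M) (Z : StartData P)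
  (α : Phase)

theorem memL2_interp_vel (hab : a < b) (hΩ : interior (closure Ω) = Ω)
    {f₀ : Space d → Fin d → ℝ} (hf₀ : ∀ k, MemLp (fun x => f₀ x k) 2 (volume.restrict Ω))
    (U : M.FaceIdx → ℝ) (k : Fin d) : MemL2 Ω a b (fun y => M.interp f₀ (M.vel U) y k) := by
  simp_rw [Mesh.interp_apply]
  exact M.memL2_interp hab hΩ (hf₀ k) (M.measurable_vel U k) fun y => M.abs_vel_le U y k

theorem continuous_conc (P : FlowData d Ω a b) (α : Phase) :
    Continuous fun z : ℝ × ℝ => P.conc α z.1 z.2 := by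
  unfold FlowData.conc FlowData.ρ
  fun_prop

theorem measurable_concH : Measurable (concH P S α) :=
  (continuous_conc P α).measurable.comp
    ((M.measurable_scal (S.p α)).prodMk (M.measurable_scal (S.s α)))

theorem exists_concH_bound : ∃ C, ∀ y, |concH P S α y| ≤ C := by
  obtain ⟨C, hC⟩ := (isCompact_Icc.prod isCompact_Icc :
    IsCompact (Icc (-∑ i, |S.p α i|) (∑ i, |S.p α i|) ×ˢ
      Icc (-∑ i, |S.s α i|) (∑ i, |S.s α i|))).exists_bound_of_continuousOn
    (continuous_conc P α).continuousOn
  exact ⟨C, fun y => hC (M.scal (S.p α) y, M.scal (S.s α) y)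
    ⟨abs_le.1 (M.abs_scal_le _ _), abs_le.1 (M.abs_scal_le _ _)⟩⟩

/-- The value of `C_{α,h}` at `τ⁻`. -/
def leftConc (τ : ℝ) (x : Space d) : ℝ :=
  Mesh.leftVal a (fun x => P.conc α (Z.p α x) (Z.s α x)) (concH P S α) τ x

theorem dtConc_eq {i : Fin M.N} {y : SpaceTime d} (hy : y ∈ (M.elem i).box) :
    dtConc S Z α y = P.φ y.2 * ((leftConc S Z α (M.elem i).t₁ y.2 -
      leftConc S Z α (M.elem i).t₀ y.2) / ((M.elem i).t₁ - (M.elem i).t₀)) := by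
  have hyb := Elem.mem_box.1 hy
  unfold dtConc
  set A := leftConc S Z α (M.elem i).t₁ y.2 with hA
  set B := leftConc S Z α (M.elem i).t₀ y.2 with hB
  have h1 : HasDerivAt (fun t => P.φ y.2 *
      ((t - (M.elem i).t₀) / ((M.elem i).t₁ - (M.elem i).t₀) * A +
      ((M.elem i).t₁ - t) / ((M.elem i).t₁ - (M.elem i).t₀) * B))
      (P.φ y.2 * (1 / ((M.elem i).t₁ - (M.elem i).t₀) * A +
        -1 / ((M.elem i).t₁ - (M.elem i).t₀) * B)) y.1 :=
    (((((hasDerivAt_id y.1).sub_const _).div_const _).mul_const A).add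
      ((((hasDerivAt_id y.1).const_sub _).div_const _).mul_const B)).const_mul _
  have h2 := h1.congr_of_eventuallyEq (f₁ := fun t => P.φ y.2 *
    M.interp (fun x => P.conc α (Z.p α x) (Z.s α x)) (concH P S α) (t, y.2)) (by
      filter_upwards [isOpen_Ioo.mem_nhds hyb.1] with t ht
      have hmem : (t, y.2) ∈ (M.elem i).carrier :=
        (M.elem i).box_subset_carrier (Elem.mem_box.2 ⟨ht, hyb.2⟩)
      rw [M.interp_eq _ _ hmem]
      rfl)
  rw [h2.deriv]
  ring

theorem memL2_dtConc (hab : a < b) (hΩ : interior (closure Ω) = Ω) :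
    MemL2 Ω a b (dtConc S Z α) := by
  obtain ⟨C, hC⟩ := exists_concH_bound (P := P) S α
  have hleft : ∀ τ, MemLp (leftConc S Z α τ) 2 (volume.restrict Ω) :=
    M.memLp_leftVal hab hΩ (Z.C_mem α) (measurable_concH S α) hC
  refine M.memL2_of_box hΩ (fun i y => P.φ y.2 * ((leftConc S Z α (M.elem i).t₁ y.2 -
      leftConc S Z α (M.elem i).t₀ y.2) / ((M.elem i).t₁ - (M.elem i).t₀))) (fun i => ?_)
    fun i y hy => dtConc_eq S Z α hy
  refine memL2_comp_snd (f := fun x => P.φ x * ((leftConc S Z α (M.elem i).t₁ x -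
      leftConc S Z α (M.elem i).t₀ x) / ((M.elem i).t₁ - (M.elem i).t₀))) ?_
  refine MemLp.mul' (p := ⊤) (q := 2) ?_ P.φ_bdd
  simp_rw [div_eq_mul_inv]
  exact ((hleft _).sub (hleft _)).mul_const _

end Scheme

end TwoPhase

namespace TwoPhase

open Filter Topology

variable {d : ℕ} {Ω : Set (Space d)} {a b : ℝ}

/-! ### Poincaré inequality on an element -/

theorem eq_sum_dir (v : SpaceTime d) : v = v.1 • dirT d + ∑ k, v.2 k • dirX k := by
  refine Prod.ext ?_ ?_
  · simp [dirT, dirX, Prod.fst_sum]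
  · ext l
    simp [dirT, dirX, Prod.snd_sum, Finset.sum_apply, Pi.single_apply]

/-- The directional derivative built from the weak derivatives of `ψ`. -/
def XSpace.dirDeriv (ψ : XSpace Ω a b) (y v : SpaceTime d) : ℝ :=
  ψ.dt y * v.1 + ∑ k, ψ.grad y k * v.2 k

theorem XSpace.integral_mul_fderiv (ψ : XSpace Ω a b) (hfin : volume (slab Ω a b) ≠ ⊤)
    {θ : SpaceTime d → ℝ} (hθ : ContDiff ℝ ∞ θ) (hc : HasCompactSupport θ)
    (hs : tsupport θ ⊆ Ioo a b ×ˢ Ω) (v : SpaceTime d) :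
    ∫ y in slab Ω a b, ψ.val y * fderiv ℝ θ y v =
      - ∫ y in slab Ω a b, ψ.dirDeriv y v * θ y := by
  have : IsFiniteMeasure (volume.restrict (slab Ω a b)) := ⟨by simpa using hfin.lt_top⟩
  have hval : IntegrableOn ψ.val (slab Ω a b) := ψ.val_mem.integrable (by norm_num)
  have hdt : IntegrableOn ψ.dt (slab Ω a b) := ψ.dt_mem.integrable (by norm_num)
  have hgrad : ∀ k, IntegrableOn (fun y => ψ.grad y k) (slab Ω a b) := fun k =>
    (ψ.grad_mem k).integrable (by norm_num)
  obtain ⟨C, hC⟩ := hc.exists_bound_of_continuous hθ.continuous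
  have hbdd : ∀ {f : SpaceTime d → ℝ}, IntegrableOn f (slab Ω a b) →
      IntegrableOn (fun y => f y * θ y) (slab Ω a b) := fun hf =>
    hf.mul_bdd hθ.continuous.aestronglyMeasurable (ae_of_all _ hC)
  have hbdd' : ∀ w, IntegrableOn (fun y => ψ.val y * fderiv ℝ θ y w) (slab Ω a b) := by
    intro w
    have hcont : Continuous fun y => fderiv ℝ θ y w :=
      (hθ.continuous_fderiv (by simp)).clm_apply continuous_const
    have hcs : HasCompactSupport fun y => fderiv ℝ θ y w := hc.fderiv_apply ℝ w
    obtain ⟨C', hC'⟩ := hcs.exists_bound_of_continuous hcont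
    exact hval.mul_bdd hcont.aestronglyMeasurable (ae_of_all _ hC')
  have h1 : ∀ y, ψ.val y * fderiv ℝ θ y v = v.1 * (ψ.val y * fderiv ℝ θ y (dirT d)) +
      ∑ k, v.2 k * (ψ.val y * fderiv ℝ θ y (dirX k)) := by
    intro y
    conv_lhs => rw [eq_sum_dir v]
    simp only [map_add, map_smul, map_sum, smul_eq_mul, mul_add, Finset.mul_sum]
    congr 1
    · ring
    · exact Finset.sum_congr rfl fun k _ => by ring
  have h2 : ∀ y, ψ.dirDeriv y v * θ y = v.1 * (ψ.dt y * θ y) +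
      ∑ k, v.2 k * (ψ.grad y k * θ y) := by
    intro y
    simp only [XSpace.dirDeriv, add_mul, Finset.sum_mul]
    congr 1
    · ring
    · exact Finset.sum_congr rfl fun k _ => by ring
  simp_rw [h1, h2]
  rw [integral_add ((hbdd' _).const_mul _)
      (integrable_finsetSum _ fun k _ => (hbdd' _).const_mul _),
    integral_add ((hbdd hdt).const_mul _)
      (integrable_finsetSum _ fun k _ => (hbdd (hgrad k)).const_mul _),
    integral_finsetSum _ fun k _ => (hbdd' _).const_mul _,
    integral_finsetSum _ fun k _ => (hbdd (hgrad k)).const_mul _, neg_add,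
    ← Finset.sum_neg_distrib]
  simp_rw [integral_const_mul]
  congr 1
  · rw [ψ.dt_weak θ hθ hc hs, mul_neg]
  · exact Finset.sum_congr rfl fun k _ => by rw [ψ.grad_weak k θ hθ hc hs, mul_neg]

namespace Mesh

variable (M : Mesh Ω a b)

theorem hasWeakGradient (hΩ : interior (closure Ω) = Ω) (ψ : XSpace Ω a b) (i : Fin M.N) :
    HasWeakGradient volume (M.elem i).box ψ.val ψ.dirDeriv := by
  intro θ hθ hc hs v
  have hzero : ∀ y ∉ (M.elem i).box, θ y = 0 := fun y hy =>
    image_eq_zero_of_notMem_tsupport fun h => hy (hs h)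
  have hzero' : ∀ y ∉ (M.elem i).box, fderiv ℝ θ y = 0 := fun y hy =>
    image_eq_zero_of_notMem_tsupport fun h => hy (hs (tsupport_fderiv_subset ℝ h))
  have hsub := M.box_subset_slab hΩ i
  have hslab : MeasurableSet (slab Ω a b) :=
    measurableSet_Ioc.prod (hΩ ▸ isOpen_interior.measurableSet)
  have := ψ.integral_mul_fderiv (M.volume_slab_ne_top hΩ) hθ hc (hs.trans (M.box_subset hΩ i)) v
  rwa [setIntegral_eq_of_subset_of_forall_sdiff_eq_zero hslab hsub
      (fun y hy => by rw [hzero' y hy.2]; simp),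
    setIntegral_eq_of_subset_of_forall_sdiff_eq_zero hslab hsub
      (fun y hy => by rw [hzero y hy.2, mul_zero])] at this

/-- Time and space increments are estimated separately, so that the time step multiplies only ψ_t
and the diameter only ∇ψ. This produces the two residual estimators. -/
theorem abs_dirDeriv_le (ψ : XSpace Ω a b) (i : Fin M.N) (z : SpaceTime d) {x y : SpaceTime d}
    (hx : x ∈ (M.elem i).box) (hy : y ∈ (M.elem i).box) :
    |ψ.dirDeriv z (x - y)| ≤ (M.elem i).timeSize * |ψ.dt z| +
      (M.elem i).spaceSize * √(∑ k, ψ.grad z k ^ 2) := by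
  rw [Elem.mem_box] at hx hy
  have hdist : ∀ {l h s t : ℝ}, s ∈ Ioo l h → t ∈ Ioo l h → |s - t| ≤ |h - l| := by
    intro l h s t hs ht
    rw [abs_of_pos (by linarith [hs.1, hs.2] : 0 < h - l), abs_le]
    constructor <;> linarith [hs.1, hs.2, ht.1, ht.2]
  refine (abs_add_le _ _).trans (add_le_add ?_ ?_)
  · rw [abs_mul, mul_comm]
    exact mul_le_mul_of_nonneg_right (hdist hx.1 hy.1) (abs_nonneg _)
  · calc |∑ k, ψ.grad z k * (x - y).2 k| ≤ ∑ k, |(x - y).2 k| * |ψ.grad z k| :=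
          (Finset.abs_sum_le_sum_abs _ _).trans (le_of_eq (Finset.sum_congr rfl fun k _ => by
            rw [abs_mul, mul_comm]))
      _ ≤ √(∑ k, |(x - y).2 k| ^ 2) * √(∑ k, |ψ.grad z k| ^ 2) :=
          Real.sum_mul_le_sqrt_mul_sqrt _ _ _
      _ ≤ _ := by
          simp only [sq_abs]
          unfold Elem.spaceSize
          exact mul_le_mul_of_nonneg_right (Real.sqrt_le_sqrt (Finset.sum_le_sum fun k _ =>
            sq_le_sq.2 (hdist (hx.2 k) (hy.2 k)))) (Real.sqrt_nonneg _)

theorem abs_integral_mul_le (hΩ : interior (closure Ω) = Ω) (ψ : XSpace Ω a b)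
    (i : Fin M.N) {r : SpaceTime d → ℝ} (hr : MemL2 Ω a b r)
    (hr0 : ∫ y in (M.elem i).box, r y = 0) :
    |∫ y in (M.elem i).box, r y * ψ.val y| ≤
      2 ^ (d + 1) * √(∫ y in (M.elem i).box, r y ^ 2) *
        ((M.elem i).timeSize * √(∫ y in (M.elem i).box, ψ.dt y ^ 2) +
         (M.elem i).spaceSize * √(∫ y in (M.elem i).box, ψ.grad y ⬝ᵥ ψ.grad y)) := by
  set B := (M.elem i).box with hB
  set τ := (M.elem i).timeSize with hτ
  set D := (M.elem i).spaceSize with hD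
  have hτ0 : 0 ≤ τ := abs_nonneg _
  have hD0 : 0 ≤ D := Real.sqrt_nonneg _
  have hle := M.restrict_box_le hΩ i
  have hrB : MemLp r 2 (volume.restrict B) := hr.mono_measure hle
  have hvB : MemLp ψ.val 2 (volume.restrict B) := ψ.val_mem.mono_measure hle
  have htB : MemLp ψ.dt 2 (volume.restrict B) := ψ.dt_mem.mono_measure hle
  have hgB : ∀ k, MemLp (fun y => ψ.grad y k) 2 (volume.restrict B) := fun k =>
    (ψ.grad_mem k).mono_measure hle
  -- The Poincaré inequality needs a measurable majorant, hence the measurable representatives of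
  -- the weak derivatives.
  set h : SpaceTime d → ℝ := fun z => τ * |htB.1.mk ψ.dt z| +
    D * √(∑ k, (hgB k).1.mk (fun y => ψ.grad y k) z ^ 2) with hh
  have hhm : Measurable h := by
    have h1 : Measurable (htB.1.mk ψ.dt) := htB.1.stronglyMeasurable_mk.measurable
    have h2 : ∀ k, Measurable ((hgB k).1.mk (fun y => ψ.grad y k)) := fun k =>
      (hgB k).1.stronglyMeasurable_mk.measurable
    have h3 : Measurable fun z => ∑ k, (hgB k).1.mk (fun y => ψ.grad y k) z ^ 2 :=
      Finset.measurable_fun_sum _ fun k _ => (h2 k).pow_const 2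
    have h4 : Measurable fun z => |htB.1.mk ψ.dt z| := h1.abs
    exact (h4.const_mul _).add (h3.sqrt.const_mul _)
  have hh0 : ∀ z, 0 ≤ h z := fun z => by positivity
  have hhe : ∀ᵐ z ∂(volume.restrict B), h z = τ * |ψ.dt z| + D * √(∑ k, ψ.grad z k ^ 2) := by
    have h2 : ∀ᵐ z ∂(volume.restrict B), ∀ k,
        ψ.grad z k = (hgB k).1.mk (fun y => ψ.grad y k) z :=
      ae_all_iff.2 fun k => (hgB k).1.ae_eq_mk
    filter_upwards [htB.1.ae_eq_mk, h2] with z h1 h2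
    simp only [hh, ← h1, ← h2]
  have : (volume : Measure (SpaceTime d)).IsAddHaarMeasure :=
    Measure.prod.instIsAddHaarMeasure _ _
  have key := enorm_integral_mul_sq_le (M.elem i).isOpen_box (M.elem i).convex_box
    (M.elem i).volume_box_ne_top hvB (M.hasWeakGradient hΩ ψ i)
    (H := fun z => ENNReal.ofReal (h z)) hhm.ennreal_ofReal (by
      filter_upwards [hhe] with z hz x hx y hy
      rw [← ofReal_norm, Real.norm_eq_abs, hz]
      exact ENNReal.ofReal_le_ofReal (M.abs_dirDeriv_le ψ i z hx hy)) hrB hr0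
  have hdim : Module.finrank ℝ (SpaceTime d) = d + 1 := by
    simp [Module.finrank_prod, add_comm]
  have hgi : Integrable (fun y => ψ.grad y ⬝ᵥ ψ.grad y) (volume.restrict B) :=
    integrable_dotProduct hgB hgB
  have hrint : ∫⁻ y in B, ‖r y‖ₑ ^ 2 = ENNReal.ofReal (∫ y in B, r y ^ 2) := by
    rw [ofReal_integral_eq_lintegral_ofReal hrB.integrable_sq (ae_of_all _ fun y => sq_nonneg _)]
    refine lintegral_congr fun y => ?_
    rw [← ofReal_norm, ← ENNReal.ofReal_pow (norm_nonneg _), Real.norm_eq_abs, sq_abs]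
  have hHint : ∫⁻ y in B, ENNReal.ofReal (h y) ^ 2 ≤ ENNReal.ofReal
      (2 * τ ^ 2 * (∫ y in B, ψ.dt y ^ 2) + 2 * D ^ 2 * ∫ y in B, ψ.grad y ⬝ᵥ ψ.grad y) := by
    have j1 : Integrable (fun y => 2 * τ ^ 2 * ψ.dt y ^ 2) (volume.restrict B) :=
      htB.integrable_sq.const_mul _
    have j2 : Integrable (fun y => 2 * D ^ 2 * (ψ.grad y ⬝ᵥ ψ.grad y)) (volume.restrict B) :=
      hgi.const_mul _
    have j3 : Integrable (fun y => 2 * τ ^ 2 * ψ.dt y ^ 2 +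
      2 * D ^ 2 * (ψ.grad y ⬝ᵥ ψ.grad y)) (volume.restrict B) := j1.add j2
    rw [← integral_const_mul, ← integral_const_mul, ← integral_add j1 j2,
      ofReal_integral_eq_lintegral_ofReal j3 (ae_of_all _ fun y => by
        have := dotProduct_self_nonneg_real (ψ.grad y)
        simp only [Pi.zero_apply]
        positivity)]
    refine lintegral_mono_ae ?_
    filter_upwards [hhe] with y hy
    rw [← ENNReal.ofReal_pow (hh0 y), hy]
    refine ENNReal.ofReal_le_ofReal ?_
    have hsum : ∑ k, ψ.grad y k ^ 2 = ψ.grad y ⬝ᵥ ψ.grad y := by simp [dotProduct, sq]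
    have h3 := Real.sq_sqrt (dotProduct_self_nonneg_real (ψ.grad y))
    rw [hsum]
    have h4 := sq_abs (ψ.dt y)
    nlinarith [sq_nonneg (τ * |ψ.dt y| - D * √(ψ.grad y ⬝ᵥ ψ.grad y))]
  set R := ∫ y in B, r y ^ 2 with hR
  set β := ∫ y in B, ψ.dt y ^ 2 with hβ
  set γ := ∫ y in B, ψ.grad y ⬝ᵥ ψ.grad y with hγ
  have hR0 : 0 ≤ R := integral_nonneg fun y => sq_nonneg _
  have hβ0 : 0 ≤ β := integral_nonneg fun y => sq_nonneg _
  have hγ0 : 0 ≤ γ := integral_nonneg fun y => dotProduct_self_nonneg_real _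
  have hreal : (∫ y in B, r y * ψ.val y) ^ 2 ≤
      2 ^ (d + 1) * R * (2 * τ ^ 2 * β + 2 * D ^ 2 * γ) := by
    rw [← sq_abs (∫ y in B, r y * ψ.val y), ← ENNReal.ofReal_le_ofReal_iff (by positivity),
      ENNReal.ofReal_mul (by positivity), ENNReal.ofReal_mul (by positivity),
      ENNReal.ofReal_pow (abs_nonneg _), ENNReal.ofReal_pow zero_le_two, ← Real.norm_eq_abs,
      ofReal_norm]
    refine key.trans ?_
    rw [hdim, hrint]
    gcongr
    simp
  refine abs_le_of_sq_le_sq (hreal.trans ?_) (by positivity)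
  -- The squared estimate carries 2^(d+1) from Poincaré and 2 from (x + y)² ≤ 2x² + 2y²; their
  -- product is absorbed into (2^(d+1))².
  have hpow : (2 : ℝ) * 2 ^ (d + 1) ≤ (2 ^ (d + 1)) ^ 2 := by
    rw [← pow_mul, ← pow_succ']
    exact pow_le_pow_right₀ (by norm_num) (by omega)
  rw [mul_pow, mul_pow, Real.sq_sqrt hR0]
  have hsq : τ ^ 2 * β + D ^ 2 * γ ≤ (τ * √β + D * √γ) ^ 2 := by
    have h1 := Real.sq_sqrt hβ0
    have h2 := Real.sq_sqrt hγ0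
    have h3 : 0 ≤ (τ * √β) * (D * √γ) := by positivity
    nlinarith
  calc 2 ^ (d + 1) * R * (2 * τ ^ 2 * β + 2 * D ^ 2 * γ)
      = (2 * 2 ^ (d + 1)) * R * (τ ^ 2 * β + D ^ 2 * γ) := by ring
    _ ≤ _ := by gcongr

end Mesh

end TwoPhase

namespace TwoPhase

open Filter Topology

variable {d : ℕ} {Ω : Set (Space d)} {a b : ℝ}

/-! ### Raviart-Thomas fields on an element -/

/-- The form of the field is required at one time only, since the coefficients of the interpolated
velocity vary with time. -/
theorem hasDerivAt_coord_of_box {E : Elem d} {u : SpaceTime d → Fin d → ℝ} {t : ℝ}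
    {A B : Fin d → ℝ} (hu : ∀ y ∈ E.box, y.1 = t → ∀ k, u y k = A k + B k * y.2 k)
    {y : SpaceTime d} (hy : y ∈ E.box) (ht : y.1 = t) (k : Fin d) :
    HasDerivAt (fun r => u (y.1, Function.update y.2 k r) k) (B k) (y.2 k) := by
  have h1 : HasDerivAt (fun r : ℝ => A k + B k * r) (B k) (y.2 k) := by
    simpa using ((hasDerivAt_id (y.2 k)).const_mul (B k)).const_add (A k)
  refine h1.congr_of_eventuallyEq ?_
  rw [Elem.mem_box] at hy
  filter_upwards [isOpen_Ioo.mem_nhds (hy.2 k)] with r hr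
  have hmem : (y.1, Function.update y.2 k r) ∈ E.box := by
    refine Elem.mem_box.2 ⟨hy.1, fun l => ?_⟩
    by_cases h : l = k
    · subst h; simpa using hr
    · simpa [h] using hy.2 l
  simpa using hu _ hmem ht k

theorem divX_of_box {E : Elem d} {u : SpaceTime d → Fin d → ℝ} {t : ℝ}
    {A B : Fin d → ℝ} (hu : ∀ y ∈ E.box, y.1 = t → ∀ k, u y k = A k + B k * y.2 k)
    {y : SpaceTime d} (hy : y ∈ E.box) (ht : y.1 = t) : divX u y = ∑ k, B k :=
  Finset.sum_congr rfl fun k _ => (hasDerivAt_coord_of_box hu hy ht k).deriv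

theorem setIntegral_box_time (E : Elem d) :
    ∫ y in E.box, (E.t₁ - y.1) / (E.t₁ - E.t₀) = volume.real E.box / 2 := by
  have hp := E.timeLength_pos
  have h := setIntegral_prod_mul (μ := (volume : Measure ℝ)) (ν := (volume : Measure (Space d)))
    (fun t : ℝ => (E.t₁ - t) / (E.t₁ - E.t₀)) (fun _ => (1 : ℝ)) (Ioo E.t₀ E.t₁)
    (Set.pi univ (fun k => Ioo (E.lo k) (E.hi k)))
  have ht : ∫ t in Ioo E.t₀ E.t₁, (E.t₁ - t) / (E.t₁ - E.t₀) = (E.t₁ - E.t₀) / 2 := by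
    rw [← integral_Ioc_eq_integral_Ioo, ← intervalIntegral.integral_of_le E.time_lt.le,
      intervalIntegral.integral_div, intervalIntegral.integral_sub (by simp) (by simp)]
    simp only [intervalIntegral.integral_const, integral_id, smul_eq_mul]
    field_simp
    ring
  simp only [mul_one] at h
  rw [Elem.box, Measure.volume_eq_prod, h, ht, Measure.real, Measure.prod_prod, ENNReal.toReal_mul]
  simp [Measure.real, hp.le]
  ring

/-! ### The mass balance residual on an element -/

section Scheme

variable {P : FlowData d Ω a b} {M : Mesh Ω a b} {S : DiscreteState M} {Z : StartData P}
  {α : Phase}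

/-- The residual of the discrete mass balance. -/
def massResidual (Z : StartData P) (S : DiscreteState M) (α : Phase) (y : SpaceTime d) : ℝ :=
  P.q α y - dtConc S Z α y - divX (M.vel (S.uup α)) y

theorem memL2_massResidual (hab : a < b) (hΩ : interior (closure Ω) = Ω) :
    MemL2 Ω a b (massResidual Z S α) :=
  ((P.q_mem α).sub (memL2_dtConc S Z α hab hΩ)).sub (M.memL2_divX_vel hΩ _)

theorem setIntegral_mul_scal_single (hΩ : interior (closure Ω) = Ω) {f : SpaceTime d → ℝ}
    (hf : IntegrableOn f (slab Ω a b)) (i : Fin M.N) :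
    ∫ y in slab Ω a b, f y * M.scal (Pi.single i 1) y = ∫ y in (M.elem i).box, f y := by
  have hint : IntegrableOn (fun y => f y * M.scal (Pi.single i 1) y) (slab Ω a b) :=
    Integrable.mul_bdd hf (M.measurable_scal _).aestronglyMeasurable
      (ae_of_all _ (M.abs_scal_le _))
  rw [M.setIntegral_slab hΩ hint]
  have : ∀ j, ∫ y in (M.elem j).box, f y * M.scal (Pi.single i 1) y =
      ∫ y in (M.elem j).box, f y * (Pi.single i (1 : ℝ) : Fin M.N → ℝ) j := fun j =>
    setIntegral_congr_fun (M.elem j).measurableSet_box fun y hy => by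
      simp only [M.scal_eq _ ((M.elem j).box_subset_carrier hy)]
  simp_rw [this, integral_mul_const]
  rw [Finset.sum_eq_single i]
  · simp
  · intro j _ hj
    simp [hj]
  · simp

/-- The discrete mass balance tested with the indicator of the element; it supplies the mean zero
weight for the Poincaré inequality. -/
theorem setIntegral_massResidual (hab : a < b) (hΩ : interior (closure Ω) = Ω)
    (hS : IsDiscreteSolution P M Z S) (i : Fin M.N) :
    ∫ y in (M.elem i).box, massResidual Z S α y = 0 := by
  have : IsFiniteMeasure (volume.restrict (slab Ω a b)) :=
    ⟨by simpa using (M.volume_slab_ne_top hΩ).lt_top⟩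
  have i1 : IntegrableOn (dtConc S Z α) (slab Ω a b) :=
    (memL2_dtConc S Z α hab hΩ).integrable (by norm_num)
  have i2 : IntegrableOn (divX (M.vel (S.uup α))) (slab Ω a b) :=
    (M.memL2_divX_vel hΩ _).integrable (by norm_num)
  have i3 : IntegrableOn (P.q α) (slab Ω a b) := (P.q_mem α).integrable (by norm_num)
  have h := hS.mass_balance α (Pi.single i 1)
  rw [setIntegral_mul_scal_single hΩ i1, setIntegral_mul_scal_single hΩ i2,
    setIntegral_mul_scal_single hΩ i3] at h
  have hsub := M.box_subset_slab hΩ i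
  have j1 := i1.mono_set hsub
  have j2 := i2.mono_set hsub
  have j3 := i3.mono_set hsub
  have j31 : IntegrableOn (fun y => P.q α y - dtConc S Z α y) (M.elem i).box := j3.sub j1
  unfold massResidual
  rw [integral_sub j31 j2, integral_sub j3 j1]
  linarith

theorem elemResidual_eq (v : SpaceTime d → Fin d → ℝ) (i : Fin M.N) :
    elemResidual Z S α v i =
      √(∫ y in (M.elem i).box, (dtConc S Z α y + divX v y - P.q α y) ^ 2) := by
  unfold elemResidual
  simp_rw [sq_abs]
  rw [setIntegral_congr_set (M.elem i).box_ae_eq_carrier.symm]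

theorem sqrt_massResidual_eq (i : Fin M.N) :
    √(∫ y in (M.elem i).box, massResidual Z S α y ^ 2) =
      elemResidual Z S α (M.vel (S.uup α)) i := by
  rw [elemResidual_eq]
  congr 1
  refine integral_congr_ae (ae_of_all _ fun y => ?_)
  simp only [massResidual]
  ring

/-- Time interpolation of the upwind velocity does not decrease the residual by more than a
constant factor. -/
theorem sqrt_massResidual_le_upTau (hab : a < b) (hΩ : interior (closure Ω) = Ω)
    (hS : IsDiscreteSolution P M Z S) (hRT : UpwindElementwiseRT0 Z S α) (i : Fin M.N) :
    √(∫ y in (M.elem i).box, massResidual Z S α y ^ 2) ≤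
      4 * elemResidual Z S α (upTau S Z α) i := by
  obtain ⟨A, B, A₀, B₀, hAB⟩ := hRT i
  set E := M.elem i with hE
  have hp := E.timeLength_pos
  have hcar : ∀ y ∈ E.box, y ∈ E.carrier := fun y hy => E.box_subset_carrier hy
  set D₁ := ∑ k, B k with hD₁
  set D₀ := ∑ k, B₀ k with hD₀
  set m : SpaceTime d → ℝ := fun y => (E.t₁ - y.1) / (E.t₁ - E.t₀) with hm
  have hdiv : ∀ y ∈ E.box, divX (M.vel (S.uup α)) y = D₁ := fun y hy =>
    divX_of_box (t := y.1) (fun z hz _ k => (hAB z (hcar z hz) k).1) hy rfl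
  have hdivτ : ∀ y ∈ E.box, divX (upTau S Z α) y = D₁ + (D₀ - D₁) * m y := by
    intro y hy
    rw [divX_of_box (t := y.1) (E := E)
      (A := fun k => (y.1 - E.t₀) / (E.t₁ - E.t₀) * A k + m y * A₀ k)
      (B := fun k => (y.1 - E.t₀) / (E.t₁ - E.t₀) * B k + m y * B₀ k) ?_ hy rfl]
    · rw [Finset.sum_add_distrib, ← Finset.mul_sum, ← Finset.mul_sum]
      simp only [hm, ← hD₁, ← hD₀]
      field_simp
      ring
    · intro z hz hzt k
      have hzc := hcar z hz
      -- Since t₁ > a, the value at the end of the element is never the starting value; only the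
      -- value at t₀ can be.
      have htop : Mesh.leftVal a (Z.uup α) (M.vel (S.uup α)) E.t₁ z.2 =
          M.vel (S.uup α) (E.t₁, z.2) :=
        if_neg (ne_of_gt ((M.time_bounds hΩ i).1.trans_lt E.time_lt))
      have hzt₁ : ((E.t₁, z.2) : SpaceTime d) ∈ E.carrier :=
        Elem.mem_carrier.2 ⟨⟨E.time_lt, le_rfl⟩, (Elem.mem_carrier.1 hzc).2⟩
      unfold upTau
      rw [M.interp_eq _ _ hzc]
      simp only [Pi.add_apply, Pi.smul_apply, smul_eq_mul]
      rw [htop, (hAB _ hzt₁ k).1, (hAB z hzc k).2, hzt]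
      simp only [hm]
      ring
  have hfin : IsFiniteMeasure (volume.restrict E.box) :=
    ⟨by simpa using E.volume_box_ne_top.lt_top⟩
  set r := massResidual Z S α with hr
  have hrB : MemLp r 2 (volume.restrict E.box) :=
    (memL2_massResidual hab hΩ).mono_measure (M.restrict_box_le hΩ i)
  have hm01 : ∀ y ∈ E.box, 0 ≤ m y ∧ m y ≤ 1 := by
    intro y hy
    have := (Elem.mem_box.1 hy).1
    exact ⟨div_nonneg (by linarith [this.2]) hp.le, (div_le_one hp).2 (by linarith [this.1])⟩
  have hmm : Measurable m := by fun_prop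
  have hmB : MemLp m 2 (volume.restrict E.box) := by
    refine MemLp.of_bound hmm.aestronglyMeasurable 1 ?_
    filter_upwards [ae_restrict_mem E.measurableSet_box] with y hy
    rw [Real.norm_of_nonneg (hm01 y hy).1]
    exact (hm01 y hy).2
  set c := D₀ - D₁ with hc
  -- On the element this is the residual formed with the interpolated velocity.
  set ρ : SpaceTime d → ℝ := fun y => c * m y - r y with hρ
  have hρB : MemLp ρ 2 (volume.restrict E.box) := (hmB.const_mul c).sub hrB
  have hres : elemResidual Z S α (upTau S Z α) i = √(∫ y in E.box, ρ y ^ 2) := by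
    rw [elemResidual_eq]
    congr 1
    refine setIntegral_congr_fun E.measurableSet_box fun y hy => ?_
    simp only [hρ, hr, massResidual, hdiv y hy, hdivτ y hy]
    ring
  have hmean : ∫ y in E.box, ρ y = c * (volume.real E.box / 2) := by
    simp only [hρ]
    rw [integral_sub ((hmB.integrable (by norm_num)).const_mul c) (hrB.integrable (by norm_num)),
      setIntegral_massResidual hab hΩ hS, sub_zero, integral_const_mul, setIntegral_box_time]
  set W := volume.real E.box with hW
  set Q := ∫ y in E.box, ρ y ^ 2 with hQ
  have hW0 : 0 ≤ W := measureReal_nonneg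
  have hQ0 : 0 ≤ Q := integral_nonneg fun y => sq_nonneg _
  have hiρ : Integrable ρ (volume.restrict E.box) := hρB.integrable (by norm_num)
  -- As r has mean zero and m has mean 1/2, ∫ρ = cW/2. Expanding ∫(ρ − c/2)² ≥ 0 leaves Q − c²W/4 ≥
  -- 0.
  have hcW : c ^ 2 * W ≤ 4 * Q := by
    have h0 : 0 ≤ ∫ y in E.box, (ρ y - c / 2) ^ 2 := integral_nonneg fun y => sq_nonneg _
    have h1 : ∀ y, (ρ y - c / 2) ^ 2 = ρ y ^ 2 - c * ρ y + c ^ 2 / 4 := fun y => by ring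
    have h2 : Integrable (fun y => ρ y ^ 2 - c * ρ y) (volume.restrict E.box) :=
      hρB.integrable_sq.sub (hiρ.const_mul c)
    simp_rw [h1] at h0
    rw [integral_add h2 (integrable_const _),
      integral_sub hρB.integrable_sq (hiρ.const_mul c), integral_const_mul, hmean,
      integral_const, measureReal_restrict_apply_univ, smul_eq_mul] at h0
    nlinarith
  -- From r = cm − ρ and 0 ≤ m ≤ 1. Together with the bound on c²W this gives ∫r² ≤ 10Q ≤ 4²Q.
  have hrQ : ∫ y in E.box, r y ^ 2 ≤ 2 * (c ^ 2 * W) + 2 * Q := by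
    have hle : ∫ y in E.box, r y ^ 2 ≤ ∫ y in E.box, (2 * c ^ 2 + 2 * ρ y ^ 2) := by
      refine setIntegral_mono_on hrB.integrable_sq
        ((integrable_const _).add (hρB.integrable_sq.const_mul 2)) E.measurableSet_box
        fun y hy => ?_
      have h1 : r y = c * m y - ρ y := by simp only [hρ]; ring
      have h2 : (c * m y) ^ 2 ≤ c ^ 2 := by
        rw [mul_pow]
        exact mul_le_of_le_one_right (sq_nonneg _) (pow_le_one₀ (hm01 y hy).1 (hm01 y hy).2)
      rw [h1]
      nlinarith [sq_nonneg (c * m y + ρ y)]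
    rw [integral_add (integrable_const _) (hρB.integrable_sq.const_mul 2), integral_const,
      integral_const_mul, measureReal_restrict_apply_univ, smul_eq_mul] at hle
    linarith
  rw [hres, show (4 : ℝ) = √(4 ^ 2) by rw [Real.sqrt_sq (by norm_num)],
    ← Real.sqrt_mul (by norm_num)]
  exact Real.sqrt_le_sqrt (by linarith)

/-! ### The estimate -/

/-- The energy density of the gradient of a test function. -/
def gradEnergy (P : FlowData d Ω a b) (ψ : XSpace Ω a b) (y : SpaceTime d) : ℝ :=
  ψ.grad y ⬝ᵥ (P.K y.2 *ᵥ ψ.grad y)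

theorem gradEnergy_nonneg {k₀ : ℝ} (hk : 0 < k₀)
    (hK : ∀ x ∈ Ω, ∀ ξ : Fin d → ℝ, k₀ * (ξ ⬝ᵥ ξ) ≤ ξ ⬝ᵥ (P.K x *ᵥ ξ)) (ψ : XSpace Ω a b)
    {y : SpaceTime d} (hy : y.2 ∈ Ω) : 0 ≤ gradEnergy P ψ y :=
  (mul_nonneg hk.le (dotProduct_self_nonneg_real _)).trans (hK _ hy _)

theorem energy_bounds {k₀ : ℝ} (hk : 0 < k₀) (hΩm : MeasurableSet Ω)
    (hK : ∀ x ∈ Ω, ∀ ξ : Fin d → ℝ, k₀ * (ξ ⬝ᵥ ξ) ≤ ξ ⬝ᵥ (P.K x *ᵥ ξ)) {ψ : XSpace Ω a b}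
    (hψ : P.normX ψ = 1) :
    IntegrableOn (gradEnergy P ψ) (slab Ω a b) ∧
      ∫ y in slab Ω a b, gradEnergy P ψ y ≤ 1 ∧ ∫ y in slab Ω a b, ψ.dt y ^ 2 ≤ 1 := by
  unfold FlowData.normX at hψ
  rw [Real.sqrt_eq_one] at hψ
  have hi : Integrable (fun y => ψ.val y ^ 2 + ψ.grad y ⬝ᵥ (P.K y.2 *ᵥ ψ.grad y) + ψ.dt y ^ 2)
      (volume.restrict (slab Ω a b)) := by
    -- A non-integrable density would have integral zero by convention, contradicting the unit norm.
    by_contra h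
    rw [integral_undef h] at hψ
    exact zero_ne_one hψ
  have hv := ψ.val_mem.integrable_sq
  have ht := ψ.dt_mem.integrable_sq
  have hg : Integrable (gradEnergy P ψ) (volume.restrict (slab Ω a b)) := by
    refine ((hi.sub hv).sub ht).congr (ae_of_all _ fun y => ?_)
    simp only [Pi.sub_apply, gradEnergy]
    ring
  have hvg : Integrable (fun y => ψ.val y ^ 2 + gradEnergy P ψ y)
    (volume.restrict (slab Ω a b)) := hv.add hg
  change ∫ y in slab Ω a b, (ψ.val y ^ 2 + gradEnergy P ψ y + ψ.dt y ^ 2) = 1 at hψ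
  rw [integral_add hvg ht, integral_add hv hg] at hψ
  have h1 : 0 ≤ ∫ y in slab Ω a b, ψ.val y ^ 2 := integral_nonneg fun y => sq_nonneg _
  have h2 : 0 ≤ ∫ y in slab Ω a b, ψ.dt y ^ 2 := integral_nonneg fun y => sq_nonneg _
  have h3 : 0 ≤ ∫ y in slab Ω a b, gradEnergy P ψ y :=
    setIntegral_nonneg (measurableSet_Ioc.prod hΩm) fun y hy => gradEnergy_nonneg hk hK ψ hy.2
  exact ⟨hg, by linarith, by linarith⟩

/-- Discrete Cauchy-Schwarz that sums the element estimates; `c i` is the share of the unit energy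
of ψ on the i-th element. -/
theorem sum_mul_sqrt_le {ι : Type*} (s : Finset ι) (x c : ι → ℝ) (hc : ∀ i ∈ s, 0 ≤ c i)
    (hsum : ∑ i ∈ s, c i ≤ 1) : ∑ i ∈ s, x i * √(c i) ≤ √(∑ i ∈ s, x i ^ 2) := by
  refine (Real.sum_mul_le_sqrt_mul_sqrt s x fun i => √(c i)).trans ?_
  rw [Finset.sum_congr rfl fun i hi => Real.sq_sqrt (hc i hi)]
  exact mul_le_of_le_one_right (Real.sqrt_nonneg _) (Real.sqrt_le_one.2 hsum)

theorem abs_flux_le {k₀ : ℝ} (hk : 0 < k₀) (hΩ : interior (closure Ω) = Ω)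
    (hK : ∀ x ∈ Ω, ∀ ξ : Fin d → ℝ, k₀ * (ξ ⬝ᵥ ξ) ≤ ξ ⬝ᵥ (P.K x *ᵥ ξ)) {ψ : XSpace Ω a b}
    (hψ : P.normX ψ = 1) {v : SpaceTime d → Fin d → ℝ}
    (hv : ∀ k, MemL2 Ω a b (fun y => v y k)) :
    |∫ y in slab Ω a b, v y ⬝ᵥ ψ.grad y| ≤ √(∑ i, elemFluxNorm P M v i ^ 2) := by
  have hΩm : MeasurableSet Ω := hΩ ▸ isOpen_interior.measurableSet
  obtain ⟨hg, hg1, -⟩ := energy_bounds hk hΩm hK hψ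
  rw [M.setIntegral_slab hΩ (integrable_dotProduct hv ψ.grad_mem)]
  rw [M.setIntegral_slab hΩ hg] at hg1
  refine (Finset.abs_sum_le_sum_abs _ _).trans (le_trans (Finset.sum_le_sum fun i _ => ?_)
    (sum_mul_sqrt_le Finset.univ (elemFluxNorm P M v) _ (fun i _ => ?_) hg1))
  · have hle := M.restrict_box_le hΩ i
    have hbox : ∀ᵐ y ∂(volume.restrict (M.elem i).box), y.2 ∈ Ω := by
      filter_upwards [ae_restrict_mem (M.elem i).measurableSet_box] with y hy
      exact (M.box_subset hΩ i hy).2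
    have h := abs_integral_dotProduct_le (A := fun y : SpaceTime d => P.K y.2) hk
      (fun k l => (aestronglyMeasurable_comp_snd (P.K_meas k l)).mono_measure hle)
      (hbox.mono fun y hy => P.K_symm _ hy) (hbox.mono fun y hy => hK _ hy)
      (fun k => (hv k).mono_measure hle) (fun k => (ψ.grad_mem k).mono_measure hle)
      (Integrable.mono_measure hg hle)
    unfold elemFluxNorm
    rwa [setIntegral_congr_set (M.elem i).box_ae_eq_carrier.symm]
  · exact setIntegral_nonneg (M.elem i).measurableSet_box fun y hy =>
      gradEnergy_nonneg hk hK ψ (M.box_subset hΩ i hy).2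

/-- The integrands differ by the two Green integrands, of the exact and of the upwind velocity,
whose integrals vanish; the exact mass balance replaces ∂_t(φC) + ∇·u by q. -/
theorem residual_eq (hab : a < b) (hΩ : interior (closure Ω) = Ω) (X : ExactSolution P)
    (ψ : XSpace Ω a b) :
    residual X Z S α ψ = (∫ y in slab Ω a b, massResidual Z S α y * ψ.val y) -
      (∫ y in slab Ω a b, (M.vel (S.u α) y - velTau S Z α y) ⬝ᵥ ψ.grad y) -
      ∫ y in slab Ω a b, (M.vel (S.uup α) y - M.vel (S.u α) y) ⬝ᵥ ψ.grad y := by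
  have hτ := memL2_interp_vel hab hΩ (Z.u_mem α) (S.u α)
  have i1 : Integrable (fun y => massResidual Z S α y * ψ.val y)
      (volume.restrict (slab Ω a b)) := (memL2_massResidual hab hΩ).integrable_mul ψ.val_mem
  have i2 : Integrable (fun y => (M.vel (S.u α) y - velTau S Z α y) ⬝ᵥ ψ.grad y)
      (volume.restrict (slab Ω a b)) :=
    integrable_dotProduct (fun k => (M.memL2_vel hΩ (S.u α) k).sub (hτ k)) ψ.grad_mem
  have i3 : Integrable (fun y => (M.vel (S.uup α) y - M.vel (S.u α) y) ⬝ᵥ ψ.grad y)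
      (volume.restrict (slab Ω a b)) :=
    integrable_dotProduct (fun k => (M.memL2_vel hΩ (S.uup α) k).sub
      (M.memL2_vel hΩ (S.u α) k)) ψ.grad_mem
  have green : ∀ {u : SpaceTime d → Fin d → ℝ} {D : SpaceTime d → ℝ},
      HasDivNoFlow Ω a b u D → Integrable (fun y => u y ⬝ᵥ ψ.grad y + D y * ψ.val y)
        (volume.restrict (slab Ω a b)) := fun h =>
    (integrable_dotProduct h.u_mem ψ.grad_mem).add (h.div_mem.integrable_mul ψ.val_mem)
  have hX := X.div_noFlow α
  have hU := M.hasDivNoFlow_vel hΩ (S.uup α)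
  have hpt : ∀ᵐ y ∂(volume.restrict (slab Ω a b)),
      (X.dtC α y - dtConc S Z α y) * ψ.val y - (X.u α y - velTau S Z α y) ⬝ᵥ ψ.grad y =
      massResidual Z S α y * ψ.val y - (M.vel (S.u α) y - velTau S Z α y) ⬝ᵥ ψ.grad y -
        (M.vel (S.uup α) y - M.vel (S.u α) y) ⬝ᵥ ψ.grad y +
        (M.vel (S.uup α) y ⬝ᵥ ψ.grad y + divX (M.vel (S.uup α)) y * ψ.val y) -
        (X.u α y ⬝ᵥ ψ.grad y + X.divu α y * ψ.val y) := by
    filter_upwards [X.mass_balance α] with y hy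
    simp only [massResidual, sub_dotProduct]
    linear_combination ψ.val y * hy
  have i12 := i1.sub i2
  have i123 := i12.sub i3
  have i4 := i123.add (green hU)
  unfold residual
  rw [integral_congr_ae hpt]
  refine (integral_sub i4 (green hX)).trans ?_
  rw [hX.green ψ, sub_zero]
  refine (integral_add i123 (green hU)).trans ?_
  rw [hU.green ψ, add_zero]
  refine (integral_sub i12 i3).trans ?_
  congr 1
  exact integral_sub i1 i2

/-- The bounds `R` are left free, with a factor 4 in reserve, so that one estimate serves both the
upwind velocity and its time interpolation. -/
theorem abs_integral_massResidual_le {k₀ : ℝ} (hk : 0 < k₀) (hab : a < b)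
    (hΩ : interior (closure Ω) = Ω)
    (hK : ∀ x ∈ Ω, ∀ ξ : Fin d → ℝ, k₀ * (ξ ⬝ᵥ ξ) ≤ ξ ⬝ᵥ (P.K x *ᵥ ξ))
    (hS : IsDiscreteSolution P M Z S) {ψ : XSpace Ω a b} (hψ : P.normX ψ = 1)
    {R : Fin M.N → ℝ}
    (hR : ∀ i, √(∫ y in (M.elem i).box, massResidual Z S α y ^ 2) ≤ 4 * R i) :
    |∫ y in slab Ω a b, massResidual Z S α y * ψ.val y| ≤
      (1 + 1 / √k₀) * (4 * 2 ^ (d + 1)) * (√(∑ i, ((M.elem i).timeSize * R i) ^ 2) +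
        √(∑ i, ((M.elem i).spaceSize * R i) ^ 2)) := by
  have hΩm : MeasurableSet Ω := hΩ ▸ isOpen_interior.measurableSet
  obtain ⟨hg, hg1, ht1⟩ := energy_bounds hk hΩm hK hψ
  have hr := memL2_massResidual (S := S) (Z := Z) (α := α) hab hΩ
  have ht := ψ.dt_mem.integrable_sq
  rw [M.setIntegral_slab hΩ hg] at hg1
  rw [M.setIntegral_slab hΩ ht] at ht1
  have hrψ : IntegrableOn (fun y => massResidual Z S α y * ψ.val y) (slab Ω a b) :=
    hr.integrable_mul ψ.val_mem
  rw [M.setIntegral_slab hΩ hrψ]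
  have hsk : 0 < √k₀ := Real.sqrt_pos.2 hk
  -- Coercivity passes from the Euclidean gradient to the energy; this is the source of 1/√k₀ in the
  -- constant.
  have hgrad : ∀ i, √(∫ y in (M.elem i).box, ψ.grad y ⬝ᵥ ψ.grad y) ≤
      1 / √k₀ * √(∫ y in (M.elem i).box, gradEnergy P ψ y) := by
    intro i
    have hle := M.restrict_box_le hΩ i
    rw [one_div, ← Real.sqrt_inv, ← Real.sqrt_mul (by positivity), ← integral_const_mul]
    refine Real.sqrt_le_sqrt (setIntegral_mono_on
      (integrable_dotProduct (fun k => (ψ.grad_mem k).mono_measure hle)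
        fun k => (ψ.grad_mem k).mono_measure hle)
      ((Integrable.mono_measure hg hle).const_mul _) (M.elem i).measurableSet_box fun y hy => ?_)
    rw [inv_mul_eq_div, le_div_iff₀ hk, mul_comm]
    exact hK _ (M.box_subset hΩ i hy).2 _
  have hR0 : ∀ i, 0 ≤ R i := fun i => by linarith [(Real.sqrt_nonneg _).trans (hR i)]
  have hτ0 : ∀ i, 0 ≤ (M.elem i).timeSize := fun i => abs_nonneg _
  have hD0 : ∀ i, 0 ≤ (M.elem i).spaceSize := fun i => Real.sqrt_nonneg _
  have hterm : ∀ i, |∫ y in (M.elem i).box, massResidual Z S α y * ψ.val y| ≤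
      4 * 2 ^ (d + 1) * (((M.elem i).timeSize * R i) *
        √(∫ y in (M.elem i).box, ψ.dt y ^ 2)) +
      4 * 2 ^ (d + 1) * (1 / √k₀) * (((M.elem i).spaceSize * R i) *
        √(∫ y in (M.elem i).box, gradEnergy P ψ y)) := by
    intro i
    calc _ ≤ 2 ^ (d + 1) * √(∫ y in (M.elem i).box, massResidual Z S α y ^ 2) *
          ((M.elem i).timeSize * √(∫ y in (M.elem i).box, ψ.dt y ^ 2) +
          (M.elem i).spaceSize * √(∫ y in (M.elem i).box, ψ.grad y ⬝ᵥ ψ.grad y)) :=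
          M.abs_integral_mul_le hΩ ψ i hr (setIntegral_massResidual hab hΩ hS i)
      _ ≤ 2 ^ (d + 1) * (4 * R i) *
          ((M.elem i).timeSize * √(∫ y in (M.elem i).box, ψ.dt y ^ 2) +
          (M.elem i).spaceSize * (1 / √k₀ * √(∫ y in (M.elem i).box, gradEnergy P ψ y))) := by
          have := hτ0 i
          have := hD0 i
          have := hR0 i
          have := hR i
          have := hgrad i
          gcongr
      _ = _ := by ring
  have hT := sum_mul_sqrt_le Finset.univ (fun i => (M.elem i).timeSize * R i) _
    (fun i _ => setIntegral_nonneg (M.elem i).measurableSet_box fun y _ => sq_nonneg (ψ.dt y)) ht1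
  have hX := sum_mul_sqrt_le Finset.univ (fun i => (M.elem i).spaceSize * R i) _
    (fun i _ => setIntegral_nonneg (M.elem i).measurableSet_box fun y hy =>
      gradEnergy_nonneg hk hK ψ (M.box_subset hΩ i hy).2) hg1
  refine (Finset.abs_sum_le_sum_abs _ _).trans ((Finset.sum_le_sum fun i _ => hterm i).trans ?_)
  rw [Finset.sum_add_distrib, ← Finset.mul_sum, ← Finset.mul_sum]
  set T := √(∑ i, ((M.elem i).timeSize * R i) ^ 2)
  set Y := √(∑ i, ((M.elem i).spaceSize * R i) ^ 2)
  have hT0 : 0 ≤ T := Real.sqrt_nonneg _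
  have hY0 : 0 ≤ Y := Real.sqrt_nonneg _
  calc _ ≤ 4 * 2 ^ (d + 1) * T + 4 * 2 ^ (d + 1) * (1 / √k₀) * Y := by gcongr
    -- The missing cross terms are added to reach the product form (1 + 1/√k₀)(T + Y).
    _ ≤ 4 * 2 ^ (d + 1) * T + 4 * 2 ^ (d + 1) * (1 / √k₀) * Y +
        (4 * 2 ^ (d + 1) * (1 / √k₀) * T + 4 * 2 ^ (d + 1) * Y) :=
        le_add_of_nonneg_right (by positivity)
    _ = _ := by ring

theorem residual_le_errorBound {k₀ : ℝ} (hk : 0 < k₀) (hab : a < b)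
    (hΩ : interior (closure Ω) = Ω)
    (hK : ∀ x ∈ Ω, ∀ ξ : Fin d → ℝ, k₀ * (ξ ⬝ᵥ ξ) ≤ ξ ⬝ᵥ (P.K x *ᵥ ξ))
    (hS : IsDiscreteSolution P M Z S) (X : ExactSolution P) {v : SpaceTime d → Fin d → ℝ}
    (hv : ∀ i, √(∫ y in (M.elem i).box, massResidual Z S α y ^ 2) ≤
      4 * elemResidual Z S α v i) {ψ : XSpace Ω a b} (hψ : P.normX ψ = 1) :
    residual X Z S α ψ ≤ errorBound ((1 + 1 / √k₀) * (4 * 2 ^ (d + 1))) Z S α v := by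
  have h1 := abs_integral_massResidual_le hk hab hΩ hK hS hψ hv
  have h2 := abs_flux_le (M := M) hk hΩ hK hψ
    (v := fun y => M.vel (S.u α) y - velTau S Z α y) fun k =>
      (M.memL2_vel hΩ (S.u α) k).sub (memL2_interp_vel hab hΩ (Z.u_mem α) (S.u α) k)
  have h3 := abs_flux_le (M := M) hk hΩ hK hψ
    (v := fun y => M.vel (S.uup α) y - M.vel (S.u α) y) fun k =>
      (M.memL2_vel hΩ (S.uup α) k).sub (M.memL2_vel hΩ (S.u α) k)
  rw [residual_eq hab hΩ]
  unfold errorBound etaTF etaSF etaTR etaSR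
  linarith [le_abs_self (∫ y in slab Ω a b, massResidual Z S α y * ψ.val y),
    neg_abs_le (∫ y in slab Ω a b, (M.vel (S.u α) y - velTau S Z α y) ⬝ᵥ ψ.grad y),
    neg_abs_le (∫ y in slab Ω a b, (M.vel (S.uup α) y - M.vel (S.u α) y) ⬝ᵥ ψ.grad y)]

end Scheme

end TwoPhase

end

theorem lemma1 (d : ℕ) (hd : 1 ≤ d) :
    ∃ Cpoin : ℝ, 0 < Cpoin ∧ ∀ k₀ : ℝ, 0 < k₀ → ∃ C : ℝ, 0 < C ∧
      ∀ (Ω : Set (TwoPhase.Space d)) (a b : ℝ), IsOpen Ω → interior (closure Ω) = Ω → a < b →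
      ∀ (P : TwoPhase.FlowData d Ω a b),
        (∀ x ∈ Ω, ∀ ξ : Fin d → ℝ, k₀ * (ξ ⬝ᵥ ξ) ≤ ξ ⬝ᵥ (P.K x *ᵥ ξ)) →
      ∀ (X : TwoPhase.ExactSolution P) (M : TwoPhase.Mesh Ω a b) (Z : TwoPhase.StartData P)
        (S : TwoPhase.DiscreteState M), TwoPhase.IsDiscreteSolution P M Z S →
      ∀ α : TwoPhase.Phase,
        BddAbove (TwoPhase.residualValues X Z S α) ∧
        TwoPhase.dualNorm X Z S α ≤
          TwoPhase.errorBound (C * Cpoin) Z S α (M.vel (S.uup α)) ∧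
        (TwoPhase.UpwindElementwiseRT0 Z S α →
          TwoPhase.dualNorm X Z S α ≤
            TwoPhase.errorBound (C * Cpoin) Z S α (TwoPhase.upTau S Z α)) := by
  -- 2^(d+1) is the Poincaré constant on a box, 4 the loss in passing to the interpolated velocity;
  -- 1 belongs to the time derivative and 1/√k₀ to the gradient.
  refine ⟨4 * 2 ^ (d + 1), by positivity, fun k₀ hk => ⟨1 + 1 / √k₀, by positivity, ?_⟩⟩
  intro Ω a b _ hΩ hab P hK X M Z S hS α
  have hbound : ∀ v, (∀ i, √(∫ y in (M.elem i).box, TwoPhase.massResidual Z S α y ^ 2) ≤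
      4 * TwoPhase.elemResidual Z S α v i) → ∀ r ∈ TwoPhase.residualValues X Z S α,
      r ≤ TwoPhase.errorBound ((1 + 1 / √k₀) * (4 * 2 ^ (d + 1))) Z S α v := by
    rintro v hv r ⟨ψ, hψ, rfl⟩
    exact TwoPhase.residual_le_errorBound hk hab hΩ hK hS X hv hψ
  have hsup : ∀ v, (∀ i, √(∫ y in (M.elem i).box, TwoPhase.massResidual Z S α y ^ 2) ≤
      4 * TwoPhase.elemResidual Z S α v i) → TwoPhase.dualNorm X Z S α ≤
      TwoPhase.errorBound ((1 + 1 / √k₀) * (4 * 2 ^ (d + 1))) Z S α v := fun v hv =>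
    -- Nonnegativity of the bound covers the case of an empty unit sphere, where the supremum is
    -- zero by convention.
    Real.sSup_le (hbound v hv) (by unfold TwoPhase.errorBound; positivity)
  have hup : ∀ i, √(∫ y in (M.elem i).box, TwoPhase.massResidual Z S α y ^ 2) ≤
      4 * TwoPhase.elemResidual Z S α (M.vel (S.uup α)) i := fun i => by
    rw [TwoPhase.sqrt_massResidual_eq]
    have : 0 ≤ TwoPhase.elemResidual Z S α (M.vel (S.uup α)) i := Real.sqrt_nonneg _
    linarith
  exact ⟨⟨_, hbound _ hup⟩, hsup _ hup, fun hRT =>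
    hsup _ (TwoPhase.sqrt_massResidual_le_upTau hab hΩ hS hRT)⟩
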